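/- Let $0<\alpha\le\bar\alpha<1$ and $\beta>0$. Let $g:[0,\infty)\to\mathbb R$ be smooth up to $0$, with $g(r)=r^{-\bar\alpha}$ for $r\ge 2$ and $g(r)=g(0)+\tfrac{g''(0)}{2}r^2$ for $r$ near $0$. For $x=(x_1,x_2)\in\mathbb R^2$ put $x^\perp=(-x_2,x_1)$ and $$\bar\Omega(x)=g(|x|),\qquad \bar V(x)=\zeta(|x|)\,x^\perp,\qquad \zeta(r)=\frac1{r^2}\int_0^r\rho\, g(\rho)\,d\rho .$$ For an integer $m\ge 2$ let $L^2_m$ be the closed subspace of those $\Omega\in L^2(\mathbb R^2,\mathbb C)$ with $\Omega=\Omega\circ R_{2\pi/m}$, where $R_\theta$ is the counterclockwise rotation of angle $\theta$ around the origin. Let $K_2(x)=\frac{x^\perp}{2\pi|x|^2}$, and denote still by $\Omega\mapsto K_2*\Omega$ the unique continuous extension of $\vartheta\mapsto K_2*\vartheta$ from the $m$-fold symmetric Schwartz functions to an operator from $L^2_m$ to the (vector-valued) tempered distributions with their weak topology. In the sense of tempered distributions let $$L_{ss}(\Omega)=\Big(1-\frac2\alpha\Big)\Omega-\mathrm{div}\Big(\Big(-\frac{\xi}{\alpha}+\beta\bar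 V\Big)\Omega\Big)-\beta\,(K_2*\Omega\cdot\nabla)\bar\Omega ,$$ and regard $L_{ss}$ as an unbounded operator on $L^2_m$ with domain $D_m(L_{ss})=\{\Omega\in L^2_m: L_{ss}(\Omega)\in L^2_m\}$. Let $\mathrm{spec}_m(L_{ss})$ be its spectrum, i.e. the complement of the set of $z\in\mathbb C$ for which $L_{ss}-z$ has a bounded inverse on $L^2_m$. **Theorem.** For every $m\ge 2$, $L_{ss}$ is the generator of a strongly continuous semigroup $(e^{\tau L_{ss}})_{\tau\ge0}$ on $L^2_m$, and $$a_0:=\sup\{\mathrm{Re}\,z: z\in \mathrm{spec}_m(L_{ss})\}<\infty .$$ If $a_0\ge 1-\frac1\alpha$, then the growth bound of the semigroup, i.e. the infimum of all $w\in\mathbb R$ for which there is $M\ge1$ with $\|e^{\tau L_{ss}}\|\le Me^{w\tau}$ for all $\tau\ge0$, equals $a_0$. In particular, in that case, for every $\delta>0$ there is a constant $M(\delta)$ such that $$\|e^{\tau L_{ss}}\Omega\|_{L^2}\le M(\delta)\,e^{(a_0+\delta)\tau}\|\Omega\|_{L^2}\qquad\forall\,\tau\ge0,\ \forall\,\Omega\in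 L^2_m .$$ -/

import Mathlib

open MeasureTheory Filter Topology Set
open scoped ContDiff NNReal ENNReal SchwartzMap

noncomputable section

namespace VortexSemigroup

/-- The Euclidean plane. -/
abbrev Plane := EuclideanSpace ℝ (Fin 2)

/-- `x^⊥ = (-x₂, x₁)`. -/
def perp (x : Plane) : Plane := !₂[-(x 1), x 0]

/-- The counterclockwise rotation `R_θ` of angle `θ` around the origin. -/
def rot (θ : ℝ) (x : Plane) : Plane :=
  !₂[Real.cos θ * x 0 - Real.sin θ * x 1, Real.sin θ * x 0 + Real.cos θ * x 1]

/-- `R_θ` as a linear isometry (used only to see that it preserves Lebesgue measure). -/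
def rotIsometry (θ : ℝ) : Plane →ₗᵢ[ℝ] Plane where
  toFun := rot θ
  map_add' x y := by
    ext i; fin_cases i <;> simp [rot] <;> ring
  map_smul' c x := by
    ext i; fin_cases i <;> simp [rot] <;> ring
  norm_map' x := by
    have h := Real.sin_sq_add_cos_sq θ
    simp only [LinearMap.coe_mk, AddHom.coe_mk, rot, EuclideanSpace.norm_eq, Fin.sum_univ_two,
      Real.norm_eq_abs, sq_abs]
    congr 1
    simp
    linear_combination ((x 0) ^ 2 + (x 1) ^ 2) * h

theorem measurePreserving_rot (θ : ℝ) :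
    MeasurePreserving (rot θ) (volume : Measure Plane) volume :=
  ((rotIsometry θ).toLinearIsometryEquiv rfl).measurePreserving

/-- The complex Hilbert space `L²(ℝ², ℂ)`. -/
abbrev L2 := Lp ℂ 2 (volume : Measure Plane)

/-- `L²_m`: the `m`-fold symmetric elements of `L²(ℝ², ℂ)`, i.e. those with
`ϑ = ϑ ∘ R_{2π/m}` almost everywhere, with the norm of `L²`. -/
def L2m (m : ℕ) : Submodule ℂ L2 where
  carrier := {f | (f : Plane → ℂ) ∘ rot (2 * Real.pi / m) =ᵐ[volume] f}
  zero_mem' := by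
    have h := Lp.coeFn_zero ℂ 2 (volume : Measure Plane)
    exact ((measurePreserving_rot _).quasiMeasurePreserving.ae_eq_comp h).trans h.symm
  add_mem' := by
    intro f g hf hg
    have h := Lp.coeFn_add f g
    refine ((measurePreserving_rot _).quasiMeasurePreserving.ae_eq_comp h).trans
      (EventuallyEq.trans ?_ h.symm)
    filter_upwards [show _ ∘ _ =ᵐ[volume] _ from hf, show _ ∘ _ =ᵐ[volume] _ from hg] with x hfx hgx
    simp only [Function.comp_apply, Pi.add_apply] at *
    rw [hfx, hgx]
  smul_mem' := by
    intro c f hf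
    have h := Lp.coeFn_smul c f
    refine ((measurePreserving_rot _).quasiMeasurePreserving.ae_eq_comp h).trans
      (EventuallyEq.trans ?_ h.symm)
    filter_upwards [show _ ∘ _ =ᵐ[volume] _ from hf] with x hfx
    simp only [Function.comp_apply, Pi.smul_apply] at *
    rw [hfx]

/-! ### The background vortex -/

/-- The conditions on the radial profile `g`: it is smooth on `[0, ∞)`, equals `r ^ (-abar)` for
`r ≥ 2`, and equals `g 0 + g''(0) / 2 * r ^ 2` near `0`. -/
structure IsProfile (abar : ℝ) (g : ℝ → ℝ) : Prop where
  smooth : ContDiffOn ℝ ∞ g (Ici 0)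
  decay : ∀ r, 2 ≤ r → g r = r ^ (-abar)
  near_zero : ∀ᶠ r in 𝓝[≥] (0 : ℝ),
    g r = g 0 + iteratedDerivWithin 2 g (Ici 0) 0 / 2 * r ^ 2

/-- The background vorticity `Ω̄(x) = g(|x|)`. -/
def bgVorticity (g : ℝ → ℝ) (x : Plane) : ℝ := g ‖x‖

/-- `ζ(r) = r⁻² ∫₀^r ρ g(ρ) dρ`. -/
def zeta (g : ℝ → ℝ) (r : ℝ) : ℝ := (r ^ 2)⁻¹ * ∫ ρ in (0 : ℝ)..r, ρ * g ρ

/-- The background velocity `V̄(x) = ζ(|x|) x^⊥`. -/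
def bgVelocity (g : ℝ → ℝ) (x : Plane) : Plane := zeta g ‖x‖ • perp x

/-- The `j`-th component of the gradient of a real function. -/
def grad (f : Plane → ℝ) (x : Plane) (j : Fin 2) : ℝ :=
  fderiv ℝ f x (EuclideanSpace.single j 1)

/-! ### The Biot-Savart operator on `L²_m` -/

/-- The Biot-Savart kernel `K₂(x) = x^⊥ / (2π|x|²)`. -/
def biotSavartKernel (x : Plane) : Plane := (2 * Real.pi * ‖x‖ ^ 2)⁻¹ • perp x

/-- The velocity `K₂ * ϑ` of a Schwartz function `ϑ` (an absolutely convergent integral). -/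
def biotSavartConv (ϑ : 𝓢(Plane, ℂ)) (x : Plane) (j : Fin 2) : ℂ :=
  ∫ y, ((biotSavartKernel (x - y) j : ℝ) : ℂ) * ϑ y

/-- The filter of `m`-fold symmetric Schwartz functions converging to `Ω` in `L²`. -/
def schwartzApprox (m : ℕ) (Ω : L2m m) : Filter 𝓢(Plane, ℂ) :=
  comap (fun ϑ : 𝓢(Plane, ℂ) => (ϑ.toLp 2 : L2)) (𝓝 (Ω : L2)) ⊓
    𝓟 {ϑ | ∀ x, ϑ (rot (2 * Real.pi / m) x) = ϑ x}

/-- The continuous extension of `ϑ ↦ K₂ * ϑ` from the `m`-fold symmetric Schwartz functions to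
an operator from `L²_m` to tempered distributions with the weak topology: `biotSavart m Ω ψ` is the
value of the distribution `K₂ * Ω` at the vector-valued Schwartz function `ψ`, that is, the limit of
`∫ (K₂ * ϑ) · ψ` as `ϑ → Ω` in `L²` through `m`-fold symmetric Schwartz functions. -/
def biotSavart (m : ℕ) (Ω : L2m m) (ψ : Plane → Fin 2 → ℂ) : ℂ :=
  limUnder (schwartzApprox m Ω) fun ϑ => ∫ x, ∑ j, biotSavartConv ϑ x j * ψ x j

/-! ### The operator `L_ss` -/

/-- The tempered distribution
`L_ss(Ω) = (1 - 2/α) Ω - div((-ξ/α + β V̄) Ω) - β ((K₂ * Ω) · ∇) Ω̄`, evaluated at `φ`. -/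
def LssDist (α β : ℝ) (g : ℝ → ℝ) (m : ℕ) (Ω : L2m m) (φ : 𝓢(Plane, ℂ)) : ℂ :=
  ((1 - 2 / α : ℝ) : ℂ) * (∫ ξ, (Ω : L2) ξ * φ ξ)
    + (∫ ξ, (Ω : L2) ξ * fderiv ℝ φ ξ (-(α⁻¹ • ξ) + β • bgVelocity g ξ))
    - (β : ℂ) * biotSavart m Ω (fun ξ j => φ ξ * ((grad (bgVorticity g) ξ j : ℝ) : ℂ))

/-- The graph of the unbounded operator `L_ss` on `L²_m`: `Ω` belongs to the domain
`D_m(L_ss) = {Ω ∈ L²_m : L_ss(Ω) ∈ L²_m}` and `L_ss(Ω) = Θ`. -/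
def Lss (α β : ℝ) (g : ℝ → ℝ) (m : ℕ) (Ω Θ : L2m m) : Prop :=
  ∀ φ : 𝓢(Plane, ℂ), LssDist α β g m Ω φ = ∫ ξ, (Θ : L2) ξ * φ ξ

/-! ### Spectra and semigroups. Unbounded operators are given by their graphs. -/

section Abstract

variable {X : Type*} [NormedAddCommGroup X] [NormedSpace ℂ X]

/-- The resolvent set: those `z` for which `A - z` is a bijection from the domain of `A` onto `X`
with a bounded inverse. -/
def resolventSet (A : X → X → Prop) : Set ℂ :=
  {z | ∃ R : X →L[ℂ] X, (∀ y, A (R y) (y + z • R y)) ∧ ∀ x y, A x y → R (y - z • x) = x}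

/-- The spectrum: the complement of the resolvent set. -/
def spec (A : X → X → Prop) : Set ℂ := (resolventSet A)ᶜ

variable (X) in
/-- Strongly continuous semigroups of bounded linear operators. -/
structure C0Semigroup where
  toFun : ℝ≥0 → X →L[ℂ] X
  map_zero : toFun 0 = ContinuousLinearMap.id ℂ X
  map_add : ∀ s t, toFun (s + t) = (toFun s).comp (toFun t)
  continuous_orbit : ∀ x, Continuous fun t => toFun t x

/-- `A` is the (infinitesimal) generator of `S`: `x` is in the domain of `A` with `A x = y` if and
only if `(S(t) x - x) / t → y` as `t ↓ 0`. -/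
def IsGenerator (A : X → X → Prop) (S : C0Semigroup X) : Prop :=
  ∀ x y, A x y ↔
    Tendsto (fun t : ℝ≥0 => (((t : ℝ) : ℂ)⁻¹) • (S.toFun t x - x)) (𝓝[>] 0) (𝓝 y)

/-- The growth bound
`inf {w ∈ ℝ : there is M ≥ 1 with ‖S(t)‖ ≤ M e^{wt} for all t ≥ 0} ∈ [-∞, ∞]`. -/
def growthBound (S : C0Semigroup X) : EReal :=
  sInf {e : EReal | ∃ w : ℝ, e = (w : EReal) ∧
    ∃ M : ℝ, 1 ≤ M ∧ ∀ t : ℝ≥0, ‖S.toFun t‖ ≤ M * Real.exp (w * t)}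

end Abstract

end VortexSemigroup

end

/-!
The operator is `L_ss = A - β K`, where `A Ω = Ω + (ξ/α - β V̄) · ∇Ω` is a transport operator (the
field `ξ/α - β V̄` has divergence `2/α`) and `K Ω = (K₂ * Ω · ∇) Ω̄`. The proof has three parts.

*Transport.* The field is the sum of a dilation and of a rotation whose speed depends on `|ξ|` only,
so its flow `Φ_t` is explicit: `e ^ (t/α)` times a rotation by an angle depending on `|ξ|²`
(`FlowData.flow`). Such differential rotations preserve Lebesgue measure, hence
`T(t) Ω = e ^ t Ω ∘ Φ_t` is `e ^ ((1 - 1/α) t)` times a unitary group (`FlowData.koopman`,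
`FlowData.norm_transport_le`). Its generator is `A` with the maximal domain given by the weak
formulation (`FlowData.hasGen_transport_iff`); smooth compactly supported test functions are
invariant under the flow, so no mollification is needed. The angular speed is smooth in `|ξ|²`
because the profile is affine in `|ξ|²` near the origin (`IsProfile.exists_radial`).

*Compactness.* The integral `K₂ * Ω` does not converge absolutely for all `Ω ∈ L²`, but an
`m`-fold symmetric `ϑ` with `m ≥ 2` has `∫_{|y| ≥ 1} K₂(y) ϑ(y) dy = 0`. So `K₂(x - y)` may be
replaced by `K₂(x - y) + 1_{|y| ≥ 1} K₂(y)`, which gains decay in `y` at the price of a factor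
`(1 + |x|) ^ δ` (`norm_farKernel_add_le`). The decay `|∇Ω̄(x)| ≤ A (1 + |x|) ^ (-1-ᾱ)` with
`δ = ᾱ/2` makes the kernel of `K` Hilbert–Schmidt away from the diagonal, and by Young's inequality
the part within distance `ε` of the diagonal has norm `O(ε)`. Hence `K` is compact on all of `L²`
(`exists_advection_op`), and on `L²_m` it agrees with the extension of `ϑ ↦ (K₂ * ϑ · ∇) Ω̄` by
density of the symmetric Schwartz functions (`exists_advection_op_L2m`).

*Semigroups.* If `‖T(t)‖ ≤ e ^ (w₀ t)` and the perturbation is compact, the perturbed semigroup `S`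
exists by Duhamel's formula, and `S(1) - T(1)` is compact (`isCompactOperator_sub`). A point `μ` of
the spectrum of `S(1)` with `|μ| > e ^ w₀` is therefore an eigenvalue of finite multiplicity. Its
eigenspace is invariant under `S`, so it contains a common eigenvector of all `S(t)`, and
`μ = e ^ z` for an eigenvalue `z` of the generator (`norm_le_of_mem_spectrum`). If the spectral
bound `a₀` is at least `w₀`, the spectral radius of `S(1)` is at most `e ^ a₀`, and Gelfand's
formula bounds the growth. Conversely, the half-plane to the right of the growth bound lies in the
resolvent set by the Laplace transform. This is `exists_semigroup_growthBound_eq`, used with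
`w₀ = 1 - 1/α`.
-/

noncomputable section

namespace VortexSemigroup

/-! ### Perturbation of strongly continuous semigroups -/

section Perturbation

variable {X : Type*} [NormedAddCommGroup X] [NormedSpace ℂ X]

/-- The rescaled semigroup `t ↦ e ^ (z t) S(t)`. -/
def C0Semigroup.rescale (S : C0Semigroup X) (z : ℂ) : C0Semigroup X where
  toFun t := Complex.exp (z * ((t : ℝ) : ℂ)) • S.toFun t
  map_zero := by simp [S.map_zero]
  map_add s t := by
    rw [S.map_add]
    ext x
    simp only [NNReal.coe_add, Complex.ofReal_add, mul_add, Complex.exp_add,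
      smul_apply, ContinuousLinearMap.comp_apply, map_smul, smul_smul]
    rw [mul_comm]
  continuous_orbit x := by
    have h := S.continuous_orbit x
    simp only [smul_apply]
    fun_prop

theorem C0Semigroup.rescale_apply (S : C0Semigroup X) (z : ℂ) (t : ℝ≥0) (x : X) :
    (S.rescale z).toFun t x = Complex.exp (z * ((t : ℝ) : ℂ)) • S.toFun t x := rfl

theorem C0Semigroup.norm_rescale (S : C0Semigroup X) (z : ℂ) (t : ℝ≥0) :
    ‖(S.rescale z).toFun t‖ = Real.exp (z.re * t) * ‖S.toFun t‖ := by
  simp [C0Semigroup.rescale, norm_smul, Complex.norm_exp]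

theorem C0Semigroup.toFun_zero_apply (S : C0Semigroup X) (x : X) : S.toFun 0 x = x := by
  simp [S.map_zero]

theorem C0Semigroup.toFun_add_apply (S : C0Semigroup X) (s t : ℝ≥0) (x : X) :
    S.toFun (s + t) x = S.toFun s (S.toFun t x) := by
  simp [S.map_add]

theorem C0Semigroup.toFun_comm_apply (S : C0Semigroup X) (s t : ℝ≥0) (x : X) :
    S.toFun s (S.toFun t x) = S.toFun t (S.toFun s x) := by
  rw [← S.toFun_add_apply, ← S.toFun_add_apply, add_comm]

/-- An exponentially bounded semigroup is jointly continuous in time and space. -/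
theorem C0Semigroup.continuous_uncurry (S : C0Semigroup X) {M w : ℝ}
    (hS : ∀ t : ℝ≥0, ‖S.toFun t‖ ≤ M * Real.exp (w * t)) :
    Continuous fun p : ℝ≥0 × X => S.toFun p.1 p.2 := by
  rw [continuous_iff_continuousAt]
  rintro ⟨t, x⟩
  have h1 : Tendsto (fun p : ℝ≥0 × X => S.toFun p.1 (p.2 - x)) (𝓝 (t, x)) (𝓝 0) := by
    have hb : Tendsto (fun p : ℝ≥0 × X => M * Real.exp (w * p.1) * ‖p.2 - x‖) (𝓝 (t, x))
        (𝓝 0) := by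
      have : Continuous fun p : ℝ≥0 × X => M * Real.exp (w * p.1) * ‖p.2 - x‖ := by fun_prop
      simpa using this.tendsto (t, x)
    refine squeeze_zero_norm (fun p => ?_) hb
    exact ((S.toFun p.1).le_opNorm _).trans (by gcongr; exact hS _)
  have h2 : Tendsto (fun p : ℝ≥0 × X => S.toFun p.1 x) (𝓝 (t, x)) (𝓝 (S.toFun t x)) :=
    ((S.continuous_orbit x).comp continuous_fst).tendsto (t, x)
  have h3 := h1.add h2
  simp only [map_sub, sub_add_cancel, zero_add] at h3
  exact h3

/-- The integrand of the Duhamel formula is continuous. -/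
theorem C0Semigroup.continuous_duhamel (T : C0Semigroup X) {M w : ℝ}
    (hT : ∀ t : ℝ≥0, ‖T.toFun t‖ ≤ M * Real.exp (w * t)) (K : X →L[ℂ] X) {u : ℝ≥0 → X}
    (hu : Continuous u) :
    Continuous fun p : ℝ × ℝ => T.toFun (p.1 - p.2).toNNReal (K (u p.2.toNNReal)) :=
  (T.continuous_uncurry hT).comp
    (by fun_prop : Continuous fun p : ℝ × ℝ => ((p.1 - p.2).toNNReal, K (u p.2.toNNReal)))

variable [CompleteSpace X]

open scoped BoundedContinuousFunction in
/-- **Bounded perturbation**, exponentially stable case: the Duhamel equation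
`S(t) x = T(t) x + ∫₀ᵗ T(t - s) K S(s) x ds` is solved by a Neumann series in the space of bounded
continuous functions of time. -/
theorem exists_perturbation_of_stable (T : C0Semigroup X) (K : X →L[ℂ] X) {c : ℝ}
    (hc : ‖K‖ < c) (hT : ∀ t : ℝ≥0, ‖T.toFun t‖ ≤ Real.exp (-c * t)) :
    ∃ S : C0Semigroup X, (∃ M : ℝ, 1 ≤ M ∧ ∀ t, ‖S.toFun t‖ ≤ M) ∧
      ∀ (t : ℝ≥0) x, S.toFun t x = T.toFun t x +
        ∫ s in (0 : ℝ)..t, T.toFun ((t : ℝ) - s).toNNReal (K (S.toFun s.toNNReal x)) := by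
  have hc0 : 0 < c := (norm_nonneg K).trans_lt hc
  have hT' : ∀ t : ℝ≥0, ‖T.toFun t‖ ≤ 1 * Real.exp (-c * t) := by simpa using hT
  have hT1 : ∀ t : ℝ≥0, ‖T.toFun t‖ ≤ 1 := fun t => (hT t).trans
    (Real.exp_le_one_iff.2 (by nlinarith [t.2, NNReal.coe_nonneg t]))
  have hcont : ∀ u : ℝ≥0 → X, Continuous u → Continuous fun p : ℝ × ℝ =>
      T.toFun (p.1 - p.2).toNNReal (K (u p.2.toNNReal)) :=
    fun u hu => T.continuous_duhamel hT' K hu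
  have hii : ∀ u : ℝ≥0 → X, Continuous u → ∀ t a b : ℝ, IntervalIntegrable
      (fun s => T.toFun (t - s).toNNReal (K (u s.toNNReal))) volume a b := fun u hu t a b =>
    ((hcont u hu).comp (by fun_prop : Continuous fun s : ℝ => (t, s))).intervalIntegrable a b
  -- the Volterra operator
  have hVcont : ∀ u : ℝ≥0 → X, Continuous u → Continuous fun t : ℝ≥0 =>
      ∫ s in (0 : ℝ)..t, T.toFun ((t : ℝ) - s).toNNReal (K (u s.toNNReal)) := by
    intro u hu
    refine intervalIntegral.continuous_parametric_intervalIntegral_of_continuous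
      (f := fun (t : ℝ≥0) s => T.toFun ((t : ℝ) - s).toNNReal (K (u s.toNNReal))) ?_
      NNReal.continuous_coe
    exact (hcont u hu).comp (by fun_prop : Continuous fun p : ℝ≥0 × ℝ => ((p.1 : ℝ), p.2))
  have hVnorm : ∀ (u : ℝ≥0 →ᵇ X) (t : ℝ≥0),
      ‖∫ s in (0 : ℝ)..t, T.toFun ((t : ℝ) - s).toNNReal (K (u s.toNNReal))‖
        ≤ ‖K‖ / c * ‖u‖ := by
    intro u t
    have h1 : ‖∫ s in (0 : ℝ)..t, T.toFun ((t : ℝ) - s).toNNReal (K (u s.toNNReal))‖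
        ≤ ∫ s in (0 : ℝ)..t, Real.exp (-c * (t - s)) * (‖K‖ * ‖u‖) := by
      refine intervalIntegral.norm_integral_le_of_norm_le t.2 ?_
        (Continuous.intervalIntegrable (by fun_prop) _ _)
      filter_upwards with s hs
      refine ((T.toFun _).le_opNorm _).trans ?_
      have h2 := hT ((t : ℝ) - s).toNNReal
      rw [Real.coe_toNNReal _ (sub_nonneg.2 hs.2)] at h2
      gcongr
      exact (K.le_opNorm _).trans (by gcongr; exact u.norm_coe_le_norm _)
    have h2 : ∫ s in (0 : ℝ)..t, Real.exp (-c * (t - s)) * (‖K‖ * ‖u‖)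
        = (1 - Real.exp (-c * t)) / c * (‖K‖ * ‖u‖) := by
      rw [intervalIntegral.integral_mul_const]
      congr 1
      have hd : ∀ s ∈ uIcc (0 : ℝ) t, HasDerivAt (fun s : ℝ => Real.exp (-c * (t - s)) / c)
          (Real.exp (-c * (t - s))) s := by
        intro s _
        have h := ((((hasDerivAt_id s).const_sub (t : ℝ)).const_mul (-c)).exp).div_const c
        refine HasDerivAt.congr_deriv h ?_
        rw [mul_neg_one, neg_neg, mul_div_assoc, div_self hc0.ne', mul_one]
        rfl
      rw [intervalIntegral.integral_eq_sub_of_hasDerivAt hd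
        (Continuous.intervalIntegrable (by fun_prop) _ _)]
      simp [sub_div]
    rw [h2] at h1
    refine h1.trans ?_
    have h3 : (1 - Real.exp (-c * t)) / c ≤ 1 / c := by
      gcongr
      linarith [Real.exp_pos (-c * t)]
    calc _ ≤ 1 / c * (‖K‖ * ‖u‖) := by gcongr
      _ = _ := by ring
  let Vl : (ℝ≥0 →ᵇ X) →ₗ[ℂ] (ℝ≥0 →ᵇ X) :=
    { toFun := fun u => BoundedContinuousFunction.ofNormedAddCommGroup _ (hVcont u u.continuous)
        (‖K‖ / c * ‖u‖) (hVnorm u)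
      map_add' := by
        intro u v
        ext t
        simp only [BoundedContinuousFunction.coe_ofNormedAddCommGroup,
          BoundedContinuousFunction.coe_add, Pi.add_apply, map_add]
        exact intervalIntegral.integral_add (hii u u.continuous _ _ _) (hii v v.continuous _ _ _)
      map_smul' := by
        intro a u
        ext t
        simp only [BoundedContinuousFunction.coe_ofNormedAddCommGroup,
          BoundedContinuousFunction.coe_smul, map_smul, RingHom.id_apply]
        exact intervalIntegral.integral_smul _ _ }
  have hVlb : ∀ u, ‖Vl u‖ ≤ ‖K‖ / c * ‖u‖ := fun u =>
    (BoundedContinuousFunction.norm_le (by positivity)).2 (hVnorm u)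
  let V : (ℝ≥0 →ᵇ X) →L[ℂ] (ℝ≥0 →ᵇ X) := Vl.mkContinuous (‖K‖ / c) hVlb
  have hV1 : ‖V‖ < 1 := (Vl.mkContinuous_norm_le (by positivity) hVlb).trans_lt
    ((div_lt_one hc0).2 hc)
  let Jl : X →ₗ[ℂ] (ℝ≥0 →ᵇ X) :=
    { toFun := fun x => BoundedContinuousFunction.ofNormedAddCommGroup _ (T.continuous_orbit x)
        ‖x‖ (fun t => ((T.toFun t).le_opNorm x).trans
          (mul_le_of_le_one_left (norm_nonneg _) (hT1 t)))
      map_add' := by intro x y; ext t; simp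
      map_smul' := by intro a x; ext t; simp }
  let J : X →L[ℂ] (ℝ≥0 →ᵇ X) := Jl.mkContinuous 1 (fun x => by
    rw [one_mul]
    exact (BoundedContinuousFunction.norm_le (norm_nonneg _)).2 fun t =>
      ((T.toFun t).le_opNorm x).trans (mul_le_of_le_one_left (norm_nonneg _) (hT1 t)))
  let U := Units.oneSub V hV1
  let R : (ℝ≥0 →ᵇ X) →L[ℂ] (ℝ≥0 →ᵇ X) := ↑(U⁻¹)
  have hU : (U : (ℝ≥0 →ᵇ X) →L[ℂ] (ℝ≥0 →ᵇ X)) = 1 - V := rfl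
  have hR1 : ∀ u, R u - V (R u) = u := by
    intro u
    have h : ((U : (ℝ≥0 →ᵇ X) →L[ℂ] (ℝ≥0 →ᵇ X)) * R) u = u := by
      simp only [R, Units.mul_inv, one_apply_eq_self]
    simpa [hU] using h
  have hR2 : ∀ u v, u - V u = v → u = R v := by
    intro u v huv
    have h : (R * (U : (ℝ≥0 →ᵇ X) →L[ℂ] (ℝ≥0 →ᵇ X))) u = u := by
      simp only [R, Units.inv_mul, one_apply_eq_self]
    rw [← huv]
    exact h.symm
  let sol : X →L[ℂ] (ℝ≥0 →ᵇ X) := R.comp J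
  have hsol : ∀ x (t : ℝ≥0), sol x t = T.toFun t x +
      ∫ s in (0 : ℝ)..t, T.toFun ((t : ℝ) - s).toNNReal (K (sol x s.toNNReal)) := by
    intro x t
    have h := congrArg (fun u : ℝ≥0 →ᵇ X => u t) (hR1 (J x))
    simp only [BoundedContinuousFunction.coe_sub, Pi.sub_apply, sub_eq_iff_eq_add] at h
    exact h
  have huniq : ∀ (u : ℝ≥0 →ᵇ X) x, (∀ t : ℝ≥0, u t = T.toFun t x +
      ∫ s in (0 : ℝ)..t, T.toFun ((t : ℝ) - s).toNNReal (K (u s.toNNReal))) → u = sol x := by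
    intro u x h
    refine hR2 u (J x) ?_
    ext t
    simp only [BoundedContinuousFunction.coe_sub, Pi.sub_apply, sub_eq_iff_eq_add]
    exact h t
  -- a time translate of a solution is the solution with the translated initial value
  have hshift : ∀ x (t s : ℝ≥0), sol x (t + s) = sol (sol x s) t := by
    intro x t s
    let u : ℝ≥0 →ᵇ X := (sol x).compContinuous ⟨fun t => t + s, by fun_prop⟩
    suffices h : u = sol (sol x s) from congrArg (fun v : ℝ≥0 →ᵇ X => v t) h
    refine huniq u _ fun r => ?_
    change sol x (r + s) = _
    rw [hsol x (r + s)]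
    rw [hsol x s]
    rw [T.toFun_add_apply, map_add, add_assoc]
    congr 1
    have hsplit := intervalIntegral.integral_add_adjacent_intervals
      (hii (sol x) (sol x).continuous (r + s) 0 s)
      (hii (sol x) (sol x).continuous (r + s) s (r + s))
    rw [NNReal.coe_add, ← hsplit]
    congr 1
    · rw [← ContinuousLinearMap.intervalIntegral_comp_comm _ (hii _ (sol x).continuous _ _ _)]
      refine intervalIntegral.integral_congr fun q hq => ?_
      rw [uIcc_of_le s.coe_nonneg] at hq
      rw [← T.toFun_add_apply]
      congr 2
      have : (r : ℝ) + s - q = r + (s - q) := by ring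
      rw [this, Real.toNNReal_add r.coe_nonneg (sub_nonneg.2 hq.2), Real.toNNReal_coe]
    · have h := intervalIntegral.integral_comp_add_right (a := (0 : ℝ)) (b := r)
        (fun q => T.toFun ((r : ℝ) + s - q).toNNReal (K (sol x q.toNNReal))) (s : ℝ)
      rw [zero_add] at h
      rw [← h]
      refine intervalIntegral.integral_congr fun q hq => ?_
      rw [uIcc_of_le r.coe_nonneg] at hq
      simp only [u, BoundedContinuousFunction.compContinuous_apply, ContinuousMap.coe_mk]
      rw [Real.toNNReal_add hq.1 s.coe_nonneg, Real.toNNReal_coe]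
      congr 2
      ring_nf
  let ev : ℝ≥0 → ((ℝ≥0 →ᵇ X) →L[ℂ] X) := fun t => BoundedContinuousFunction.evalCLM ℂ t
  refine ⟨⟨fun t => (ev t).comp sol, ?_, ?_, ?_⟩, ⟨max 1 ‖sol‖, le_max_left _ _, ?_⟩, ?_⟩
  · ext x
    have := hsol x 0
    simpa [ev, T.toFun_zero_apply] using this
  · intro s t
    ext x
    exact hshift x s t
  · intro x
    exact (sol x).continuous
  · intro t
    refine ContinuousLinearMap.opNorm_le_bound _ (by positivity) fun x => ?_
    calc ‖sol x t‖ ≤ ‖sol x‖ := (sol x).norm_coe_le_norm t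
      _ ≤ ‖sol‖ * ‖x‖ := sol.le_opNorm x
      _ ≤ _ := by gcongr; exact le_max_right _ _
  · intro t x
    exact hsol x t

/-- **Bounded perturbation theorem** for a semigroup with `‖T(t)‖ ≤ e ^ (w₀ t)`, in the form of the
Duhamel formula. -/
theorem exists_perturbation (T : C0Semigroup X) (K : X →L[ℂ] X) {w₀ : ℝ}
    (hT : ∀ t : ℝ≥0, ‖T.toFun t‖ ≤ Real.exp (w₀ * t)) :
    ∃ S : C0Semigroup X, (∃ M w : ℝ, 1 ≤ M ∧ ∀ t : ℝ≥0, ‖S.toFun t‖ ≤ M * Real.exp (w * t)) ∧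
      ∀ (t : ℝ≥0) x, S.toFun t x = T.toFun t x +
        ∫ s in (0 : ℝ)..t, T.toFun ((t : ℝ) - s).toNNReal (K (S.toFun s.toNNReal x)) := by
  set c : ℝ := ‖K‖ + 1
  set w : ℝ := w₀ + c
  obtain ⟨S, ⟨M, hM, hSM⟩, hS⟩ := exists_perturbation_of_stable (T.rescale ((-w : ℝ) : ℂ)) K
    (c := c) (by simp [c]) (fun t => by
      rw [T.norm_rescale, Complex.ofReal_re]
      calc _ ≤ Real.exp (-w * t) * Real.exp (w₀ * t) := by gcongr; exact hT t
        _ = _ := by rw [← Real.exp_add]; congr 1; simp only [w]; ring)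
  refine ⟨S.rescale (w : ℂ), ⟨M, w, hM, fun t => ?_⟩, fun t x => ?_⟩
  · rw [S.norm_rescale, Complex.ofReal_re, mul_comm]
    gcongr
    exact hSM t
  · rw [S.rescale_apply, hS t x, smul_add, T.rescale_apply, smul_smul, ← Complex.exp_add,
      ← intervalIntegral.integral_smul]
    congr 1
    · simp
    · refine intervalIntegral.integral_congr fun s hs => ?_
      rw [uIcc_of_le t.coe_nonneg] at hs
      simp only [C0Semigroup.rescale_apply, map_smul, smul_smul, ← Complex.exp_add]
      rw [Real.coe_toNNReal _ hs.1, Real.coe_toNNReal _ (sub_nonneg.2 hs.2)]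
      congr 2
      push_cast
      ring

end Perturbation

/-! ### Generators and their perturbation -/

section Generation

variable {X : Type*} [NormedAddCommGroup X] [NormedSpace ℂ X]

/-- `S.HasGen x y` says that `x` lies in the domain of the generator of `S`, with value `y`. -/
def C0Semigroup.HasGen (S : C0Semigroup X) (x y : X) : Prop :=
  Tendsto (fun t : ℝ≥0 => (((t : ℝ) : ℂ)⁻¹) • (S.toFun t x - x)) (𝓝[>] 0) (𝓝 y)

theorem tendsto_inv_smul_cexp_sub_one (a : ℂ) :
    Tendsto (fun t : ℝ≥0 => ((t : ℝ) : ℂ)⁻¹ * (Complex.exp (a * ((t : ℝ) : ℂ)) - 1)) (𝓝[>] 0)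
      (𝓝 a) := by
  have h : HasDerivAt (fun t : ℂ => Complex.exp (a * t)) a 0 := by
    simpa using ((hasDerivAt_id (0 : ℂ)).const_mul a).cexp
  have h2 := h.tendsto_slope_zero
  simp only [zero_add, mul_zero, Complex.exp_zero, smul_eq_mul] at h2
  refine h2.comp (tendsto_nhdsWithin_iff.2 ⟨?_, ?_⟩)
  · have : Continuous fun t : ℝ≥0 => ((t : ℝ) : ℂ) := by fun_prop
    simpa using (this.tendsto 0).mono_left nhdsWithin_le_nhds
  · filter_upwards [self_mem_nhdsWithin] with t ht
    simpa using (ne_of_gt ht)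

theorem C0Semigroup.HasGen.rescale {S : C0Semigroup X} {x y : X} (h : S.HasGen x y) (a : ℂ) :
    (S.rescale a).HasGen x (y + a • x) := by
  have h1 : Tendsto (fun t : ℝ≥0 => Complex.exp (a * ((t : ℝ) : ℂ))) (𝓝[>] 0) (𝓝 1) := by
    have : Continuous fun t : ℝ≥0 => Complex.exp (a * ((t : ℝ) : ℂ)) := by fun_prop
    simpa using (this.tendsto 0).mono_left nhdsWithin_le_nhds
  have h2 := (h1.smul h).add ((tendsto_inv_smul_cexp_sub_one a).smul_const x)
  rw [one_smul] at h2
  refine h2.congr fun t => ?_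
  simp only [S.rescale_apply]
  module

theorem C0Semigroup.hasGen_rescale_neg {S : C0Semigroup X} {x y : X} {z : ℂ} :
    (S.rescale (-z)).HasGen x y ↔ S.HasGen x (y + z • x) := by
  refine ⟨fun h => ?_, fun h => ?_⟩
  · have h1 := h.rescale z
    refine Tendsto.congr (fun t => ?_) h1
    simp only [C0Semigroup.rescale_apply, smul_smul, ← Complex.exp_add]
    simp
  · have h1 := h.rescale (-z)
    simpa using h1

theorem C0Semigroup.continuous_orbit_real (S : C0Semigroup X) (x : X) :
    Continuous fun s : ℝ => S.toFun s.toNNReal x :=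
  (S.continuous_orbit x).comp continuous_real_toNNReal

variable [CompleteSpace X]

/-- Averages over `[0, t]` of a jointly continuous function converge as `t ↓ 0`. -/
theorem tendsto_average_zero {F : ℝ × ℝ → X} (hF : Continuous F) :
    Tendsto (fun t : ℝ≥0 => (((t : ℝ) : ℂ)⁻¹) • ∫ s in (0 : ℝ)..t, F (t, s)) (𝓝[>] 0)
      (𝓝 (F (0, 0))) := by
  have hc : Continuous fun t : ℝ≥0 => ∫ r in (0 : ℝ)..1, F (t, t * r) :=
    intervalIntegral.continuous_parametric_intervalIntegral_of_continuous'
      (f := fun (t : ℝ≥0) r => F (t, t * r))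
      (hF.comp (by fun_prop : Continuous fun p : ℝ≥0 × ℝ => ((p.1 : ℝ), (p.1 : ℝ) * p.2))) 0 1
  have h0 := (hc.tendsto 0).mono_left (nhdsWithin_le_nhds (s := Ioi 0))
  simp only [NNReal.coe_zero, zero_mul, intervalIntegral.integral_const, sub_zero, one_smul] at h0
  refine h0.congr' ?_
  filter_upwards [self_mem_nhdsWithin] with t ht
  have ht' : (t : ℝ) ≠ 0 := by simpa using (ne_of_gt ht)
  have h := intervalIntegral.smul_integral_comp_mul_left (a := (0 : ℝ)) (b := 1)
    (fun s => F (t, s)) (t : ℝ)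
  rw [mul_zero, mul_one] at h
  rw [← h, ← Complex.ofReal_inv, Complex.coe_smul, smul_smul, inv_mul_cancel₀ ht', one_smul]

/-- The generator of a perturbed semigroup is the perturbed generator. -/
theorem hasGen_perturbation_iff {T S : C0Semigroup X} {K : X →L[ℂ] X} {M w : ℝ}
    (hT : ∀ t : ℝ≥0, ‖T.toFun t‖ ≤ M * Real.exp (w * t))
    (hS : ∀ (t : ℝ≥0) x, S.toFun t x = T.toFun t x +
        ∫ s in (0 : ℝ)..t, T.toFun ((t : ℝ) - s).toNNReal (K (S.toFun s.toNNReal x)))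
    (x y : X) : S.HasGen x y ↔ T.HasGen x (y - K x) := by
  have h := tendsto_average_zero (T.continuous_duhamel hT K (S.continuous_orbit x))
  simp only [sub_zero, Real.toNNReal_zero, S.toFun_zero_apply, T.toFun_zero_apply] at h
  have hq : ∀ t : ℝ≥0, (((t : ℝ) : ℂ)⁻¹) • (S.toFun t x - x) =
      (((t : ℝ) : ℂ)⁻¹) • (T.toFun t x - x) + (((t : ℝ) : ℂ)⁻¹) •
        ∫ s in (0 : ℝ)..t, T.toFun ((t : ℝ) - s).toNNReal (K (S.toFun s.toNNReal x)) := by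
    intro t
    rw [← smul_add]
    congr 1
    rw [hS t x]
    abel
  constructor
  · intro hg
    refine (Tendsto.sub hg h).congr fun t => ?_
    rw [hq t, add_sub_cancel_right]
  · intro hg
    have h2 := Tendsto.add hg h
    rw [sub_add_cancel] at h2
    exact h2.congr fun t => (hq t).symm

end Generation

/-! ### Compact perturbations and the growth bound -/

section GrowthBound

variable {X : Type*} [NormedAddCommGroup X] [NormedSpace ℂ X]

theorem mem_spec_of_eigenvector {A : X → X → Prop} {z : ℂ} {v : X} (hv : v ≠ 0)
    (h : A v (z • v)) : z ∈ spec A := by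
  rintro ⟨R, -, hR⟩
  have := hR v _ h
  rw [sub_self, map_zero] at this
  exact hv this.symm

theorem integral_unit_mem_closedConvexHull [CompleteSpace X] {D : Set X} {f : ℝ → X}
    (hf : Continuous f) (hD : ∀ s ∈ Icc (0 : ℝ) 1, f s ∈ D) :
    ∫ s in (0 : ℝ)..1, f s ∈ closedConvexHull ℝ D := by
  rw [intervalIntegral.integral_of_le zero_le_one]
  have : IsProbabilityMeasure (volume.restrict (Ioc (0 : ℝ) 1)) := ⟨by simp⟩
  refine convex_closedConvexHull.integral_mem isClosed_closedConvexHull ?_ ?_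
  · rw [ae_restrict_iff' measurableSet_Ioc]
    exact ae_of_all _ fun s hs => subset_closedConvexHull (hD s ⟨hs.1.le, hs.2⟩)
  · exact (hf.integrableOn_Icc (a := 0) (b := 1)).mono_set Ioc_subset_Icc_self

/-- If `‖S(t)‖ ≤ M e ^ (w t)`, the half-plane `Re z > w` lies in the resolvent set of the
generator: the resolvent is the Laplace transform of the semigroup. -/
theorem mem_resolventSet_of_growth [CompleteSpace X] {S : C0Semigroup X} {A : X → X → Prop}
    (hA : IsGenerator A S) {M w : ℝ} (hS : ∀ t : ℝ≥0, ‖S.toFun t‖ ≤ M * Real.exp (w * t))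
    {z : ℂ} (hz : w < z.re) : z ∈ resolventSet A := by
  set S' := S.rescale (-z)
  set ε := z.re - w
  have hε : 0 < ε := sub_pos.2 hz
  have hS' : ∀ t : ℝ≥0, ‖S'.toFun t‖ ≤ M * Real.exp (-ε * t) := fun t => by
    rw [S.norm_rescale, Complex.neg_re]
    calc _ ≤ Real.exp (-z.re * t) * (M * Real.exp (w * t)) := by gcongr; exact hS t
      _ = M * (Real.exp (-z.re * t) * Real.exp (w * t)) := by ring
      _ = _ := by rw [← Real.exp_add]; congr 2; simp only [ε]; ring
  have hbi : IntegrableOn (fun t : ℝ => M * Real.exp (-ε * t)) (Ioi 0) :=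
    (integrableOn_exp_mul_Ioi (neg_lt_zero.2 hε) 0).const_mul M
  have hptw : ∀ x, ∀ᵐ t ∂(volume.restrict (Ioi (0 : ℝ))),
      ‖S'.toFun t.toNNReal x‖ ≤ M * Real.exp (-ε * t) * ‖x‖ := by
    intro x
    rw [ae_restrict_iff' measurableSet_Ioi]
    refine ae_of_all _ fun t ht => ((S'.toFun _).le_opNorm x).trans ?_
    have h := hS' t.toNNReal
    rw [Real.coe_toNNReal _ (le_of_lt ht)] at h
    gcongr
  have hint : ∀ x, IntegrableOn (fun t : ℝ => S'.toFun t.toNNReal x) (Ioi 0) := fun x =>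
    (hbi.mul_const ‖x‖).mono' (S'.continuous_orbit_real x).aestronglyMeasurable (hptw x)
  let Rl : X →ₗ[ℂ] X :=
    { toFun := fun x => -∫ t in Ioi (0 : ℝ), S'.toFun t.toNNReal x
      map_add' := fun x y => by
        simp only [map_add]
        rw [integral_add (hint x) (hint y), neg_add]
      map_smul' := fun a x => by
        simp only [map_smul, RingHom.id_apply]
        rw [integral_smul, smul_neg] }
  let R : X →L[ℂ] X := Rl.mkContinuous (∫ t in Ioi (0 : ℝ), M * Real.exp (-ε * t)) fun x => by
    change ‖-∫ t in Ioi (0 : ℝ), S'.toFun t.toNNReal x‖ ≤ _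
    rw [norm_neg, ← integral_mul_const]
    exact norm_integral_le_of_norm_le (hbi.mul_const _) (hptw x)
  have hR : ∀ x, R x = -∫ t in Ioi (0 : ℝ), S'.toFun t.toNNReal x := fun x => rfl
  -- the resolvent is `-∫₀^∞ S'`, where `S'` is the rescaled, exponentially decaying semigroup
  have hcomm : ∀ (h : ℝ≥0) x, R (S'.toFun h x) = S'.toFun h (R x) := by
    intro h x
    rw [hR, hR, map_neg, ← ContinuousLinearMap.integral_comp_comm _ (hint x)]
    congr 1
    exact integral_congr_ae (ae_of_all _ fun t => S'.toFun_comm_apply _ _ _)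
  have hshift : ∀ (h : ℝ≥0) x, S'.toFun h (R x) - R x =
      ∫ t in (0 : ℝ)..h, S'.toFun t.toNNReal x := by
    intro h x
    have h1 : S'.toFun h (R x) = -∫ t in Ioi (h : ℝ), S'.toFun t.toNNReal x := by
      rw [hR, map_neg, ← ContinuousLinearMap.integral_comp_comm _ (hint x),
        ← (measurePreserving_add_right volume (h : ℝ)).setIntegral_preimage_emb
          (measurableEmbedding_addRight (h : ℝ)) (fun t => S'.toFun t.toNNReal x) (Ioi (h : ℝ))]
      congr 1
      have : (fun t : ℝ => t + (h : ℝ)) ⁻¹' Ioi (h : ℝ) = Ioi 0 := by ext; simp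
      rw [this]
      refine setIntegral_congr_fun measurableSet_Ioi fun t ht => ?_
      rw [Real.toNNReal_add (le_of_lt ht) h.coe_nonneg, Real.toNNReal_coe, add_comm,
        S'.toFun_add_apply]
    rw [h1, hR, ← intervalIntegral.integral_Ioi_sub_Ioi (hint x) h.coe_nonneg]
    abel
  have hgen : ∀ y, S'.HasGen (R y) y := by
    intro y
    have h := tendsto_average_zero (F := fun p : ℝ × ℝ => S'.toFun p.2.toNNReal y)
      ((S'.continuous_orbit_real y).comp continuous_snd)
    simp only [Real.toNNReal_zero, S'.toFun_zero_apply] at h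
    exact h.congr fun t => by rw [hshift]
  refine ⟨R, fun y => (hA _ _).2 (C0Semigroup.hasGen_rescale_neg.1 (hgen y)), fun x y hxy => ?_⟩
  have h1 : S'.HasGen x (y - z • x) := by
    refine C0Semigroup.hasGen_rescale_neg.2 ?_
    rw [sub_add_cancel]
    exact (hA _ _).1 hxy
  have h2 := (R.continuous.tendsto _).comp h1
  refine tendsto_nhds_unique (h2.congr fun t => ?_) (hgen x)
  simp only [Function.comp_apply, map_smul, map_sub, hcomm]

/-- The perturbed and unperturbed semigroups differ by a compact operator when the perturbation is
compact: Duhamel's integral takes values in the closed convex hull of a compact set. -/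
theorem isCompactOperator_sub [CompleteSpace X] {T S : C0Semigroup X} {K : X →L[ℂ] X}
    {M w M' w' : ℝ}
    (hT : ∀ t : ℝ≥0, ‖T.toFun t‖ ≤ M * Real.exp (w * t))
    (hSb : ∀ t : ℝ≥0, ‖S.toFun t‖ ≤ M' * Real.exp (w' * t))
    (hS : ∀ (t : ℝ≥0) x, S.toFun t x = T.toFun t x +
        ∫ s in (0 : ℝ)..t, T.toFun ((t : ℝ) - s).toNNReal (K (S.toFun s.toNNReal x)))
    (hK : IsCompactOperator K) : IsCompactOperator (S.toFun 1 - T.toFun 1) := by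
  have hM' : 0 ≤ M' := by
    have := (norm_nonneg _).trans (hSb 0)
    simpa using this
  set B := M' * Real.exp |w'|
  obtain ⟨C, hC, hKC⟩ := hK.image_closedBall_subset_compact (f := (K : X →ₗ[ℂ] X)) B
  set D := (fun p : ℝ≥0 × X => T.toFun p.1 p.2) '' (Icc 0 1 ×ˢ C)
  have hD : IsCompact D := (isCompact_Icc.prod hC).image (T.continuous_uncurry hT)
  have hH : IsCompact (closedConvexHull ℝ D) := by
    rw [closedConvexHull_eq_closure_convexHull]
    exact hD.totallyBounded.convexHull.closure.isCompact_of_isClosed isClosed_closure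
  refine (isCompactOperator_iff_image_closedBall_subset_compact
    ((S.toFun 1 - T.toFun 1 : X →L[ℂ] X) : X →ₗ[ℂ] X) zero_lt_one).2 ⟨_, hH, ?_⟩
  rintro _ ⟨x, hx, rfl⟩
  have h := hS 1 x
  have h' : (S.toFun 1 - T.toFun 1) x = ∫ s in (0 : ℝ)..1,
      T.toFun ((1 : ℝ) - s).toNNReal (K (S.toFun s.toNNReal x)) := by
    rw [sub_apply, h]
    simp
  change (S.toFun 1 - T.toFun 1) x ∈ _
  rw [h']
  refine integral_unit_mem_closedConvexHull ((T.continuous_duhamel hT K (S.continuous_orbit x)).comp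
    (by fun_prop : Continuous fun s : ℝ => ((1 : ℝ), s))) fun s hs => ?_
  refine ⟨((1 - s).toNNReal, K (S.toFun s.toNNReal x)), ⟨⟨bot_le, ?_⟩, hKC ⟨_, ?_, rfl⟩⟩, rfl⟩
  · rw [Real.toNNReal_le_one]
    linarith [hs.1]
  · rw [mem_closedBall_zero_iff] at hx ⊢
    calc _ ≤ ‖S.toFun s.toNNReal‖ * ‖x‖ := (S.toFun _).le_opNorm x
      _ ≤ ‖S.toFun s.toNNReal‖ * 1 := by gcongr
      _ ≤ M' * Real.exp (w' * s.toNNReal) := by rw [mul_one]; exact hSb _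
      _ ≤ B := by
        simp only [B]
        gcongr
        rw [Real.coe_toNNReal _ hs.1]
        calc w' * s ≤ |w'| * s := by gcongr; exacts [hs.1, le_abs_self _]
          _ ≤ |w'| * 1 := by gcongr; exact hs.2
          _ = |w'| := mul_one _

/-- A nonzero finite-dimensional subspace that is invariant under a semigroup contains a common
eigenvector of the semigroup. -/
theorem C0Semigroup.exists_common_eigenvector (S : C0Semigroup X) (F : Submodule ℂ X)
    [hfin : FiniteDimensional ℂ F] (hF : F ≠ ⊥) (hinv : ∀ t, ∀ x ∈ F, S.toFun t x ∈ F) :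
    ∃ v ∈ F, v ≠ 0 ∧ ∃ χ : ℝ≥0 → ℂ, ∀ t, S.toFun t v = χ t • v := by
  induction hn : Module.finrank ℂ F using Nat.strong_induction_on generalizing F with
  | _ n ih =>
  by_cases hsc : ∀ t, ∃ μ : ℂ, ∀ x ∈ F, S.toFun t x = μ • x
  · choose χ hχ using hsc
    obtain ⟨v, hv, hv0⟩ := (Submodule.ne_bot_iff F).1 hF
    exact ⟨v, hv, hv0, χ, fun t => hχ t v hv⟩
  push Not at hsc
  obtain ⟨t, ht⟩ := hsc
  have : Nontrivial F := Submodule.nontrivial_iff_ne_bot.2 hF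
  let f : Module.End ℂ F := ((S.toFun t : X →ₗ[ℂ] X)).restrict (hinv t)
  obtain ⟨μ, hμ⟩ := Module.End.exists_eigenvalue f
  obtain ⟨v, hv⟩ := hμ.exists_hasEigenvector
  let G : Submodule ℂ X := F ⊓ LinearMap.ker ((S.toFun t : X →ₗ[ℂ] X) - μ • LinearMap.id)
  have hGmem : ∀ x, x ∈ G ↔ x ∈ F ∧ S.toFun t x = μ • x := by
    intro x
    simp [G, sub_eq_zero]
  have hGF : G < F := by
    refine lt_of_le_of_ne inf_le_left fun h => ?_
    obtain ⟨x, hx, hne⟩ := ht μ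
    rw [← h] at hx
    exact hne ((hGmem x).1 hx).2
  have : FiniteDimensional ℂ G := Submodule.finiteDimensional_of_le hGF.le
  have hG0 : G ≠ ⊥ := by
    rw [Submodule.ne_bot_iff]
    refine ⟨v, (hGmem _).2 ⟨v.2, ?_⟩, fun h => hv.2 (Subtype.ext h)⟩
    exact congrArg Subtype.val hv.apply_eq_smul
  obtain ⟨u, hu, hu0, χ, hχ⟩ := ih (Module.finrank ℂ G)
    (hn ▸ Submodule.finrank_lt_finrank_of_lt hGF) G hG0 (fun s x hx => by
      rw [hGmem] at hx ⊢
      refine ⟨hinv s x hx.1, ?_⟩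
      rw [S.toFun_comm_apply, hx.2, map_smul]) rfl
  exact ⟨u, hGF.le hu, hu0, χ, hχ⟩

/-- A common eigenvector of a semigroup is an eigenvector of its generator. -/
theorem C0Semigroup.exists_exponent (S : C0Semigroup X) {v : X} (hv : v ≠ 0) {χ : ℝ≥0 → ℂ}
    (h : ∀ t, S.toFun t v = χ t • v) :
    ∃ z : ℂ, (∀ t : ℝ≥0, χ t = Complex.exp (z * ((t : ℝ) : ℂ))) ∧ S.HasGen v (z • v) := by
  obtain ⟨f, hf⟩ := SeparatingDual.exists_eq_one (R := ℂ) hv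
  have hχf : ∀ t, χ t = f (S.toFun t v) := fun t => by rw [h t, map_smul, hf, smul_eq_mul, mul_one]
  have hχc : Continuous χ := by
    rw [show χ = fun t => f (S.toFun t v) from funext hχf]
    exact f.continuous.comp (S.continuous_orbit v)
  have hχ0 : χ 0 = 1 := by rw [hχf, S.toFun_zero_apply, hf]
  have hχa : ∀ s t, χ (s + t) = χ s * χ t := fun s t => by
    rw [hχf, S.toFun_add_apply, h t, map_smul, h s, smul_smul, map_smul, hf, smul_eq_mul, mul_one,
      mul_comm]
  have hχr : Continuous fun s : ℝ => χ s.toNNReal := hχc.comp continuous_real_toNNReal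
  -- `χ` has a nonzero average over a short interval, which makes it differentiable
  obtain ⟨ε, hε⟩ : ∃ ε : ℝ≥0, ∫ s in (0 : ℝ)..ε, χ s.toNNReal ≠ 0 := by
    have h1 := tendsto_average_zero (F := fun p : ℝ × ℝ => χ p.2.toNNReal)
      (hχr.comp continuous_snd)
    simp only [Real.toNNReal_zero, hχ0] at h1
    obtain ⟨ε, hε⟩ := (h1.eventually_ne one_ne_zero).exists
    exact ⟨ε, fun h0 => hε (by rw [h0, smul_zero])⟩
  set c := ∫ s in (0 : ℝ)..ε, χ s.toNNReal
  set P : ℝ → ℂ := fun x => ∫ s in (0 : ℝ)..x, χ s.toNNReal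
  have hP : ∀ x, HasDerivAt P (χ x.toNNReal) x := fun x =>
    (hχr.integral_hasStrictDerivAt 0 x).hasDerivAt
  set p : ℝ → ℂ := fun t => (P (t + ε) - P t) / c
  have hp : ∀ t : ℝ, 0 ≤ t → p t = χ t.toNNReal := by
    intro t ht
    simp only [p]
    rw [div_eq_iff hε]
    have h1 : P (t + ε) - P t = ∫ s in t..(t + ε), χ s.toNNReal :=
      intervalIntegral.integral_interval_sub_left (hχr.intervalIntegrable _ _)
        (hχr.intervalIntegrable _ _)
    have h2 := intervalIntegral.integral_comp_add_left (a := (0 : ℝ)) (b := ε)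
      (fun s : ℝ => χ s.toNNReal) t
    rw [add_zero] at h2
    rw [h1, ← h2, ← intervalIntegral.integral_const_mul]
    refine intervalIntegral.integral_congr fun s hs => ?_
    rw [uIcc_of_le ε.coe_nonneg] at hs
    rw [Real.toNNReal_add ht hs.1, hχa]
  set z := (χ ε - 1) / c
  have hp' : ∀ t : ℝ, 0 ≤ t → HasDerivAt p (z * p t) t := by
    intro t ht
    have h1 : HasDerivAt p ((χ (t + ε).toNNReal - χ t.toNNReal) / c) t :=
      (((hP (t + ε)).comp_add_const t ε).sub (hP t)).div_const c
    refine h1.congr_deriv ?_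
    rw [hp t ht, Real.toNNReal_add ht ε.coe_nonneg, Real.toNNReal_coe, hχa]
    simp only [z]
    ring
  have hexp : ∀ t : ℝ≥0, χ t = Complex.exp (z * ((t : ℝ) : ℂ)) := by
    intro t
    set q : ℝ → ℂ := fun s => p s * Complex.exp (-z * (s : ℂ))
    have hq : ∀ s : ℝ, 0 ≤ s → HasDerivAt q 0 s := by
      intro s hs
      have h2 : HasDerivAt (fun s : ℝ => Complex.exp (-z * (s : ℂ)))
          (Complex.exp (-z * (s : ℂ)) * (-z * 1)) s :=
        (((hasDerivAt_id (s : ℂ)).const_mul (-z)).cexp).comp_ofReal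
      refine ((hp' s hs).mul h2).congr_deriv ?_
      ring
    have hconst := constant_of_has_deriv_right_zero (f := q) (a := 0) (b := t)
      (fun s hs => (hq s hs.1).continuousAt.continuousWithinAt)
      (fun s hs => (hq s hs.1).hasDerivWithinAt) t ⟨t.coe_nonneg, le_rfl⟩
    simp only [q] at hconst
    rw [hp t t.coe_nonneg, hp 0 le_rfl, Real.toNNReal_coe, Real.toNNReal_zero, hχ0] at hconst
    simp only [Complex.ofReal_zero, mul_zero, Complex.exp_zero, mul_one] at hconst
    rw [neg_mul, Complex.exp_neg] at hconst
    field_simp [Complex.exp_ne_zero] at hconst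
    exact hconst
  refine ⟨z, hexp, ?_⟩
  refine ((tendsto_inv_smul_cexp_sub_one z).smul_const v).congr fun t => ?_
  rw [h t, hexp t]
  module

/-- Spectral mapping outside the essential spectrum: a spectral value of `S(1)` outside the disc of
radius `e ^ w₀` is an eigenvalue of finite multiplicity by the Fredholm alternative, hence comes
from an eigenvalue of the generator. -/
theorem norm_le_of_mem_spectrum [CompleteSpace X] {T S : C0Semigroup X} {A : X → X → Prop}
    (hA : IsGenerator A S) {w₀ a₀ : ℝ} (hT : ∀ t : ℝ≥0, ‖T.toFun t‖ ≤ Real.exp (w₀ * t))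
    (hC : IsCompactOperator (S.toFun 1 - T.toFun 1)) (hw : w₀ ≤ a₀)
    (ha : ∀ z ∈ spec A, z.re ≤ a₀) {μ : ℂ} (hμ : μ ∈ spectrum ℂ (S.toFun 1)) :
    ‖μ‖ ≤ Real.exp a₀ := by
  by_contra! hlt
  have hTμ : ‖T.toFun 1‖ < ‖μ‖ := by
    refine (hT 1).trans_lt (lt_of_le_of_lt ?_ hlt)
    simpa using hw
  have hμ0 : μ ≠ 0 := norm_pos_iff.1 ((norm_nonneg _).trans_lt hTμ)
  obtain ⟨x₀, hx₀⟩ : ∃ x : X, x ≠ 0 := by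
    by_contra! h
    have : Subsingleton X := ⟨fun a b => by rw [h a, h b]⟩
    have : Subsingleton (X →L[ℂ] X) := ⟨fun f g => by ext x; exact Subsingleton.elim _ _⟩
    exact hμ (isUnit_of_subsingleton _)
  have : Nontrivial X := ⟨x₀, 0, hx₀⟩
  have hres : IsUnit (algebraMap ℂ (X →L[ℂ] X) μ - T.toFun 1) :=
    spectrum.mem_resolventSet_of_norm_lt hTμ
  obtain ⟨U, hU⟩ := hres
  set J : X →L[ℂ] X := ↑(U⁻¹)
  set C : X →L[ℂ] X := S.toFun 1 - T.toFun 1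
  have hJC : IsCompactOperator (J * C) := hC.clm_comp J
  -- `μ - S(1) = (μ - T(1)) (1 - (μ - T(1))⁻¹ C)` with `C = S(1) - T(1)` compact
  have hfac : algebraMap ℂ (X →L[ℂ] X) μ - S.toFun 1 = U * (1 - J * C) := by
    rw [mul_sub, mul_one, ← mul_assoc, Units.mul_inv, one_mul, hU]
    simp [C]
  have hker : ∀ x, S.toFun 1 x = μ • x ↔ (J * C) x = x := by
    intro x
    have h1 : ((algebraMap ℂ (X →L[ℂ] X) μ - S.toFun 1) x = 0) ↔ S.toFun 1 x = μ • x := by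
      rw [sub_apply, sub_eq_zero, eq_comm]
      rfl
    rw [← h1, hfac]
    constructor
    · intro h
      have h2 := congrArg J h
      have h3 : J ((U : X →L[ℂ] X) ((1 - J * C) x)) = (1 - J * C) x := by
        change (J * U) ((1 - J * C) x) = _
        simp only [J, Units.inv_mul]
        rfl
      rw [map_zero] at h2
      have h4 : (1 - J * C) x = 0 := h3 ▸ h2
      rw [sub_apply, sub_eq_zero] at h4
      exact h4.symm
    · intro h
      change (U : X →L[ℂ] X) ((1 - J * C) x) = 0
      rw [sub_apply, h]
      simp
  rcases hJC.hasEigenvalue_or_mem_resolventSet one_ne_zero with he | hr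
  · set F : Submodule ℂ X := Module.End.eigenspace ((J * C : X →L[ℂ] X) : Module.End ℂ X) 1
    have hF : F ≠ ⊥ := he
    have hFmem : ∀ x, x ∈ F ↔ S.toFun 1 x = μ • x := by
      intro x
      rw [Module.End.mem_eigenspace_iff, hker, one_smul]
      rfl
    have : FiniteDimensional ℂ F := by
      refine FiniteDimensional.of_isCompactOperator_id ?_
      have hcl : IsClosed (F : Set X) := by
        have : (F : Set X) = {x | S.toFun 1 x = μ • x} := by ext x; exact hFmem x
        rw [this]
        exact isClosed_eq (S.toFun 1).continuous (by fun_prop)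
      have hmaps : ∀ x ∈ F, (((J * C : X →L[ℂ] X)) : X →ₗ[ℂ] X) x ∈ F := fun x hx => by
        have : (J * C) x = x := (hker x).1 ((hFmem x).1 hx)
        change (J * C) x ∈ F
        rwa [this]
      have h := hJC.restrict (f := ((J * C : X →L[ℂ] X) : X →ₗ[ℂ] X)) hmaps hcl
      convert! h using 1
      ext x
      exact ((hker x).1 ((hFmem x).1 x.2)).symm
    obtain ⟨v, hvF, hv0, χ, hχ⟩ := S.exists_common_eigenvector F hF fun t x hx => by
      rw [hFmem] at hx ⊢
      rw [S.toFun_comm_apply, hx, map_smul]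
    obtain ⟨z, hz, hgen⟩ := S.exists_exponent hv0 hχ
    have hzs := ha z (mem_spec_of_eigenvector hv0 ((hA _ _).2 hgen))
    have hμz : μ = Complex.exp z := by
      have h1 := (hFmem v).1 hvF
      rw [hχ 1, hz 1] at h1
      have := smul_left_injective ℂ hv0 h1
      simpa using this.symm
    rw [hμz, Complex.norm_exp] at hlt
    exact absurd (Real.exp_le_exp.2 hzs) (not_le.2 hlt)
  · refine hμ ?_
    change IsUnit (algebraMap ℂ (X →L[ℂ] X) μ - S.toFun 1)
    rw [hfac]
    refine U.isUnit.mul ?_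
    have hr' : IsUnit (algebraMap ℂ (X →L[ℂ] X) 1 - J * C) := hr
    simpa using hr'

/-- A bound of the spectral radius of `S(1)` bounds the growth of the semigroup. -/
theorem exists_growth_of_spectrum_le [CompleteSpace X] {S : C0Semigroup X} {M' w' : ℝ}
    (hSb : ∀ t : ℝ≥0, ‖S.toFun t‖ ≤ M' * Real.exp (w' * t)) {a₀ : ℝ}
    (h : ∀ μ ∈ spectrum ℂ (S.toFun 1), ‖μ‖ ≤ Real.exp a₀) {δ : ℝ} (hδ : 0 < δ) :
    ∃ M : ℝ, 1 ≤ M ∧ ∀ t : ℝ≥0, ‖S.toFun t‖ ≤ M * Real.exp ((a₀ + δ) * t) := by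
  have hM' : 0 ≤ M' := by
    have := (norm_nonneg _).trans (hSb 0)
    simpa using this
  have hpow : ∀ n : ℕ, S.toFun n = S.toFun 1 ^ n := by
    intro n
    induction n with
    | zero => simp [S.map_zero]; rfl
    | succ n ih => rw [Nat.cast_succ, S.map_add, ih, pow_succ]; rfl
  -- Gelfand's formula bounds `‖S(n)‖` for large integers `n`
  have hrad : spectralRadius ℂ (S.toFun 1) < ENNReal.ofReal (Real.exp (a₀ + δ)) := by
    refine lt_of_le_of_lt (b := ENNReal.ofReal (Real.exp a₀)) ?_ ?_
    · refine iSup₂_le fun μ hμ => ?_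
      rw [← enorm_eq_nnnorm, ← ofReal_norm]
      exact ENNReal.ofReal_le_ofReal (h μ hμ)
    · exact (ENNReal.ofReal_lt_ofReal_iff (Real.exp_pos _)).2 (Real.exp_lt_exp.2 (by linarith))
  have hev := (spectrum.pow_norm_pow_one_div_tendsto_nhds_spectralRadius
    (S.toFun 1)).eventually_lt_const hrad
  obtain ⟨N, hN⟩ := (hev.and (eventually_ge_atTop 1)).exists_forall_of_atTop
  set a := a₀ + δ
  obtain ⟨C, hC⟩ : ∃ C : ℝ, ∀ n : ℕ, ‖S.toFun n‖ ≤ C * Real.exp (a * n) := by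
    have hb : IsBoundedUnder (· ≤ ·) atTop fun n : ℕ => ‖S.toFun n‖ * Real.exp (-(a * n)) := by
      refine ⟨1, ?_⟩
      rw [eventually_map]
      filter_upwards [eventually_ge_atTop N] with n hn
      obtain ⟨h1, h2⟩ := hN n hn
      have h3 := (ENNReal.ofReal_lt_ofReal_iff (Real.exp_pos _)).1 h1
      have hn0 : (0 : ℝ) < n := by exact_mod_cast h2
      have h4 : ‖S.toFun n‖ ≤ Real.exp (a * n) := by
        rw [hpow]
        have h5 := Real.rpow_le_rpow (by positivity) h3.le hn0.le
        rwa [← Real.rpow_mul (norm_nonneg _), one_div, inv_mul_cancel₀ hn0.ne', Real.rpow_one,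
          ← Real.exp_mul] at h5
      rw [Real.exp_neg, ← div_eq_mul_inv]
      exact (div_le_one (Real.exp_pos _)).2 h4
    obtain ⟨C, hC⟩ := hb.bddAbove_range
    refine ⟨C, fun n => ?_⟩
    have := hC ⟨n, rfl⟩
    simp only [Real.exp_neg] at this
    rwa [← div_eq_mul_inv, div_le_iff₀ (Real.exp_pos _)] at this
  have hC0 : 0 ≤ C := by
    have := (norm_nonneg _).trans (hC 0)
    simpa using this
  refine ⟨max 1 (C * Real.exp |a| * (M' * Real.exp |w'|)), le_max_left _ _, fun t => ?_⟩
  -- a real time is an integer plus a remainder in `[0, 1]`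
  set n := ⌊t⌋₊
  have hnt : (n : ℝ≥0) ≤ t := Nat.floor_le bot_le
  set r := t - n
  have ht : t = n + r := (add_tsub_cancel_of_le hnt).symm
  have hr1 : (r : ℝ) ≤ 1 := by
    have h1 : t < n + 1 := Nat.lt_floor_add_one t
    have h2 : r ≤ 1 := by
      rw [ht] at h1
      exact (lt_of_add_lt_add_left h1).le
    exact_mod_cast h2
  have htr : (t : ℝ) = n + r := by rw [ht]; push_cast; rfl
  have key : ∀ b : ℝ, b * r ≤ |b| := fun b => by
    calc b * r ≤ |b| * r := by gcongr; exact le_abs_self b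
      _ ≤ |b| * 1 := by gcongr
      _ = |b| := mul_one _
  have hstep : ‖S.toFun t‖ ≤ ‖S.toFun n‖ * ‖S.toFun r‖ := by
    conv_lhs => rw [ht, S.map_add]
    exact ContinuousLinearMap.opNorm_comp_le _ _
  calc ‖S.toFun t‖ ≤ ‖S.toFun n‖ * ‖S.toFun r‖ := hstep
    _ ≤ (C * Real.exp (a * n)) * (M' * Real.exp |w'|) := by
      gcongr
      · exact hC n
      · exact (hSb r).trans (by gcongr; exact key w')
    _ ≤ (C * (Real.exp |a| * Real.exp (a * t))) * (M' * Real.exp |w'|) := by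
      gcongr
      rw [← Real.exp_add]
      refine Real.exp_le_exp.2 ?_
      have := key (-a)
      rw [abs_neg] at this
      rw [htr]
      linarith
    _ = (C * Real.exp |a| * (M' * Real.exp |w'|)) * Real.exp (a * t) := by ring
    _ ≤ _ := by gcongr; exact le_max_right _ _

/-- Growth bound of a compactly perturbed semigroup: if `T` is a semigroup with
`‖T(t)‖ ≤ e ^ (w₀ t)` and `K` is compact, the operator `A` given by the generator of `T` plus `K`
generates a semigroup whose growth bound is the spectral bound of `A`, as soon as the latter is at
least `w₀`. -/
theorem exists_semigroup_growthBound_eq [CompleteSpace X] {T : C0Semigroup X} {K : X →L[ℂ] X}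
    {A : X → X → Prop} {w₀ : ℝ} (hT : ∀ t : ℝ≥0, ‖T.toFun t‖ ≤ Real.exp (w₀ * t))
    (hK : IsCompactOperator K) (hA : ∀ x y, A x y ↔ T.HasGen x (y - K x)) :
    ∃ S : C0Semigroup X, IsGenerator A S ∧ BddAbove (Complex.re '' spec A) ∧
      ∀ a₀ : ℝ, IsLUB (Complex.re '' spec A) a₀ → w₀ ≤ a₀ →
        growthBound S = (a₀ : EReal) ∧
        ∀ δ : ℝ, 0 < δ → ∃ M : ℝ, ∀ (τ : ℝ≥0) (x : X),
          ‖S.toFun τ x‖ ≤ M * Real.exp ((a₀ + δ) * τ) * ‖x‖ := by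
  have hT' : ∀ t : ℝ≥0, ‖T.toFun t‖ ≤ 1 * Real.exp (w₀ * t) := by simpa using hT
  obtain ⟨S, ⟨M, w, hM, hSb⟩, hS⟩ := exists_perturbation T K hT
  have hgen : IsGenerator A S := fun x y => (hA x y).trans (hasGen_perturbation_iff hT' hS x y).symm
  have hspec : ∀ {M w : ℝ}, (∀ t : ℝ≥0, ‖S.toFun t‖ ≤ M * Real.exp (w * t)) →
      w ∈ upperBounds (Complex.re '' spec A) := by
    rintro M w hb _ ⟨z, hz, rfl⟩
    by_contra! hlt
    exact hz (mem_resolventSet_of_growth hgen hb hlt)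
  refine ⟨S, hgen, ⟨w, hspec hSb⟩, fun a₀ ha hw => ?_⟩
  have hC := isCompactOperator_sub hT' hSb hS hK
  have hbound : ∀ δ : ℝ, 0 < δ →
      ∃ M : ℝ, 1 ≤ M ∧ ∀ t : ℝ≥0, ‖S.toFun t‖ ≤ M * Real.exp ((a₀ + δ) * t) := fun δ hδ =>
    exists_growth_of_spectrum_le hSb (fun μ hμ => norm_le_of_mem_spectrum hgen hT hC hw
      (fun z hz => ha.1 ⟨z, hz, rfl⟩) hμ) hδ
  refine ⟨le_antisymm ?_ ?_, fun δ hδ => ?_⟩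
  · refine EReal.le_of_forall_lt_iff_le.1 fun b hb => ?_
    have hab : a₀ < b := by exact_mod_cast hb
    have h := hbound (b - a₀) (sub_pos.2 hab)
    rw [add_sub_cancel] at h
    exact sInf_le ⟨b, rfl, h⟩
  · refine le_sInf ?_
    rintro _ ⟨b, rfl, N, -, hb⟩
    exact_mod_cast ha.2 (hspec hb)
  · obtain ⟨N, -, hN⟩ := hbound δ hδ
    exact ⟨N, fun τ x => ((S.toFun τ).le_opNorm x).trans (by gcongr; exact hN τ)⟩

end GrowthBound

/-! ### The radial profile -/

section RadialProfile

/-- A smooth function that is divisible by `s` near the origin is divisible by `s` globally. -/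
theorem exists_contDiff_eq_mul {F q : ℝ → ℝ} (hF : ContDiff ℝ ∞ F) (hq : ContDiff ℝ ∞ q)
    (h : ∀ᶠ s in 𝓝 0, F s = s * q s) :
    ∃ W : ℝ → ℝ, ContDiff ℝ ∞ W ∧ (∀ s, F s = s * W s) ∧ W =ᶠ[𝓝 0] q := by
  have hW : (fun s => if s = 0 then q 0 else F s / s) =ᶠ[𝓝 0] q := by
    filter_upwards [h] with s hs
    by_cases h0 : s = 0
    · simp [h0]
    · simp [h0, hs]
  refine ⟨fun s => if s = 0 then q 0 else F s / s, ?_, fun s => ?_, hW⟩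
  · rw [contDiff_iff_contDiffAt]
    intro s
    by_cases h0 : s = 0
    · subst h0
      exact hq.contDiffAt.congr_of_eventuallyEq hW
    · refine (hF.contDiffAt.div contDiffAt_id h0).congr_of_eventuallyEq ?_
      filter_upwards [isOpen_ne.mem_nhds h0] with r hr
      simp [show r ≠ 0 from hr]
  · by_cases h0 : s = 0
    · simp [h0, h.self_of_nhds]
    · simp [h0, mul_div_cancel₀]

theorem contDiff_integral {F : ℝ → ℝ} (hF : ContDiff ℝ ∞ F) :
    ContDiff ℝ ∞ (fun s => ∫ τ in (0 : ℝ)..s, F τ) := by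
  have hd : ∀ s, HasDerivAt (fun s => ∫ τ in (0 : ℝ)..s, F τ) (F s) s := fun s =>
    (hF.continuous.integral_hasStrictDerivAt 0 s).hasDerivAt
  rw [contDiff_infty_iff_deriv]
  refine ⟨fun s => (hd s).differentiableAt, ?_⟩
  rwa [show deriv (fun s => ∫ τ in (0 : ℝ)..s, F τ) = F from funext fun s => (hd s).deriv]

/-- In terms of `s = r²`, the profile `g(r) = G(r²)` and the angular velocity `ζ(r) = Z(r²)` are
smooth on the whole real line, and `Z - Z(0)` is smoothly divisible by `s`. The affine form of the
profile near the origin gives the smoothness at `s = 0`. -/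
theorem IsProfile.exists_radial {abar : ℝ} {g : ℝ → ℝ} (hg : IsProfile abar g) (ha : 0 < abar) :
    ∃ G Z W : ℝ → ℝ, ContDiff ℝ ∞ G ∧ ContDiff ℝ ∞ Z ∧ ContDiff ℝ ∞ W ∧
      (∀ r, 0 ≤ r → g r = G (r ^ 2)) ∧ (∀ r, r ≠ 0 → 0 ≤ r → zeta g r = Z (r ^ 2)) ∧
      (∀ s, Z s = Z 0 + s * W s) ∧ (∃ C, ∀ s, 0 ≤ s → |Z s| ≤ C) ∧
      ∃ C, ∀ s, 0 ≤ s → |deriv G s| ≤ C * (1 + s) ^ (-(abar / 2) - 1) := by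
  set c := iteratedDerivWithin 2 g (Ici 0) 0 / 2
  obtain ⟨ε, hε, hnear⟩ : ∃ ε > 0, ∀ r, 0 ≤ r → r < ε → g r = g 0 + c * r ^ 2 := by
    have h := hg.near_zero
    rw [eventually_nhdsWithin_iff, Metric.eventually_nhds_iff] at h
    obtain ⟨ε, hε, h⟩ := h
    exact ⟨ε, hε, fun r h0 h1 => h (by simpa [abs_of_nonneg h0] using h1) h0⟩
  -- `G(s) = g(√s)`, continued to negative `s` by its affine germ at the origin
  set G : ℝ → ℝ := fun s => if s ≤ 0 then g 0 + c * s else g (Real.sqrt s) with hGdef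
  have hG0 : ∀ s, s < ε ^ 2 → G s = g 0 + c * s := by
    intro s hs
    by_cases h0 : s ≤ 0
    · simp [G, h0]
    · push Not at h0
      have h1 : Real.sqrt s < ε := (Real.sqrt_lt' hε).2 hs
      simp [G, not_le.2 h0, hnear _ (Real.sqrt_nonneg s) h1, Real.sq_sqrt h0.le]
  have hGev : G =ᶠ[𝓝 0] fun s => g 0 + c * s := by
    filter_upwards [Iio_mem_nhds (show (0 : ℝ) < ε ^ 2 by positivity)] with s hs using hG0 s hs
  have hGs : ContDiff ℝ ∞ G := by
    rw [contDiff_iff_contDiffAt]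
    intro s
    rcases lt_or_ge s (ε ^ 2) with hs | hs
    · refine ContDiffAt.congr_of_eventuallyEq (f := fun s => g 0 + c * s) (by fun_prop) ?_
      filter_upwards [Iio_mem_nhds hs] with r hr using hG0 r hr
    · have hs0 : 0 < s := lt_of_lt_of_le (by positivity) hs
      have h1 : ContDiffAt ℝ ∞ g (Real.sqrt s) :=
        hg.smooth.contDiffAt (Ici_mem_nhds (Real.sqrt_pos.2 hs0))
      refine (h1.comp s (Real.contDiffAt_sqrt hs0.ne')).congr_of_eventuallyEq ?_
      filter_upwards [Ioi_mem_nhds hs0] with r hr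
      simp [G, not_le.2 (show 0 < r from hr)]
  have hgG : ∀ r, 0 ≤ r → g r = G (r ^ 2) := by
    intro r hr
    rcases hr.eq_or_lt with h0 | h0
    · subst h0
      simp [G]
    · simp [G, not_le.2 (pow_pos h0 2), Real.sqrt_sq hr]
  have hGlarge : ∀ s, 4 ≤ s → G s = s ^ (-(abar / 2)) := by
    intro s hs
    have hs0 : 0 < s := by linarith
    have h2 : 2 ≤ Real.sqrt s := by
      rw [show (2 : ℝ) = Real.sqrt (2 ^ 2) by simp]
      exact Real.sqrt_le_sqrt (by norm_num; exact hs)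
    simp only [G, not_le.2 hs0, if_false]
    rw [hg.decay _ h2, Real.sqrt_eq_rpow, ← Real.rpow_mul hs0.le]
    congr 1
    ring
  -- `Q(s) = s⁻¹ ∫₀ˢ G`, and the substitution `s = r²` gives `ζ(r) = Q(r²) / 2`
  obtain ⟨Q, hQs, hQ, hQev⟩ := exists_contDiff_eq_mul
    (F := fun s => ∫ τ in (0 : ℝ)..s, G τ) (q := fun s => g 0 + c / 2 * s)
    (contDiff_integral hGs) (by fun_prop) (by
      obtain ⟨η, hη, hh⟩ := Metric.eventually_nhds_iff.1 hGev
      rw [Metric.eventually_nhds_iff]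
      refine ⟨η, hη, fun s hs => ?_⟩
      have : ∫ τ in (0 : ℝ)..s, G τ = ∫ τ in (0 : ℝ)..s, (g 0 + c * τ) := by
        refine intervalIntegral.integral_congr fun τ hτ => hh ?_
        rw [Real.dist_eq, sub_zero] at hs ⊢
        exact lt_of_le_of_lt (by simpa using abs_sub_left_of_mem_uIcc hτ) hs
      rw [this, intervalIntegral.integral_add (by simp)
          (Continuous.intervalIntegrable (by fun_prop) _ _),
        intervalIntegral.integral_const_mul]
      simp only [intervalIntegral.integral_const, integral_id, smul_eq_mul]
      ring)
  obtain ⟨W, hWs, hW, -⟩ := exists_contDiff_eq_mul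
    (F := fun s => Q s / 2 - Q 0 / 2) (q := fun _ => c / 4) (by fun_prop) (by fun_prop) (by
      have h0 := hQev.self_of_nhds
      filter_upwards [hQev] with s hs
      rw [hs, h0]
      ring)
  obtain ⟨CG, hCG⟩ : ∃ C, ∀ s, 0 ≤ s → |G s| ≤ C := by
    obtain ⟨C, hC⟩ := isCompact_Icc.exists_bound_of_continuousOn
      (hGs.continuous.continuousOn (s := Icc 0 4))
    refine ⟨max C 1, fun s hs => ?_⟩
    rcases le_total s 4 with h | h
    · exact (hC s ⟨hs, h⟩).trans (le_max_left _ _)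
    · refine le_trans ?_ (le_max_right _ _)
      rw [hGlarge s h, abs_of_nonneg (by positivity)]
      exact Real.rpow_le_one_of_one_le_of_nonpos (by linarith) (by linarith)
  refine ⟨G, fun s => Q s / 2, W, hGs, by fun_prop, hWs, hgG, ?_, ?_, ⟨CG / 2 + |Q 0|, ?_⟩, ?_⟩
  · intro r hr hr0
    have h1 : ∫ ρ in (0 : ℝ)..r, ρ * g ρ = (∫ s in (0 : ℝ)..r ^ 2, G s) / 2 := by
      have h2 := intervalIntegral.integral_comp_mul_deriv (a := 0) (b := r)
        (f := fun ρ : ℝ => ρ ^ 2) (f' := fun ρ => 2 * ρ) (g := G) (fun x _ => by simpa using hasDerivAt_pow 2 x)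
        (by fun_prop) hGs.continuous
      simp only [Function.comp_apply] at h2
      rw [zero_pow two_ne_zero] at h2
      rw [← h2, ← intervalIntegral.integral_div]
      refine intervalIntegral.integral_congr fun ρ hρ => ?_
      rw [uIcc_of_le hr0] at hρ
      rw [hgG ρ hρ.1]
      ring
    rw [zeta, h1, hQ]
    field_simp
  · intro s
    have := hW s
    linarith
  · intro s hs
    rcases hs.eq_or_lt with h0 | h0
    · subst h0
      have := abs_nonneg (G 0)
      have := hCG 0 le_rfl
      rw [abs_div, abs_two]
      linarith [abs_nonneg (Q 0)]
    · have h1 : |∫ τ in (0 : ℝ)..s, G τ| ≤ CG * |s - 0| := by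
        refine intervalIntegral.norm_integral_le_of_norm_le_const (f := G) fun τ hτ => ?_
        rw [uIoc_of_le hs] at hτ
        exact hCG τ hτ.1.le
      have h2 := hQ s
      rw [h2, sub_zero, abs_mul, abs_of_pos h0, mul_comm] at h1
      have h3 := le_of_mul_le_mul_right h1 h0
      rw [abs_div, abs_two]
      linarith [abs_nonneg (Q 0)]
  · have hdc : Continuous (deriv G) := hGs.continuous_deriv (by simp)
    -- the power law holds near every `s ≥ 5`, and compactness covers `[0, 5]`
    obtain ⟨C, hC⟩ := isCompact_Icc.exists_bound_of_continuousOn (hdc.continuousOn (s := Icc 0 5))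
    have hC0 : 0 ≤ C := (norm_nonneg _).trans (hC 0 (by simp))
    refine ⟨C * (6 : ℝ) ^ (abar / 2 + 1) + abar * 2 ^ (abar / 2 + 1), fun s hs => ?_⟩
    have hpos : 0 < (1 + s) ^ (abar / 2 + 1) := by positivity
    rw [show -(abar / 2) - 1 = -(abar / 2 + 1) by ring, Real.rpow_neg (by positivity),
      ← div_eq_mul_inv, le_div_iff₀ hpos]
    rcases le_total s 5 with h | h
    · calc _ ≤ C * (6 : ℝ) ^ (abar / 2 + 1) := by
            gcongr
            · exact hC s ⟨hs, h⟩
            · linarith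
        _ ≤ _ := by
          have : (0 : ℝ) ≤ abar * 2 ^ (abar / 2 + 1) := by positivity
          linarith
    · have hs0 : 0 < s := by linarith
      have hd : deriv G s = -(abar / 2) * s ^ (-(abar / 2) - 1) := by
        have h1 : G =ᶠ[𝓝 s] fun s => s ^ (-(abar / 2)) := by
          filter_upwards [Ioi_mem_nhds (show (4 : ℝ) < s by linarith)] with r hr
            using hGlarge r (le_of_lt hr)
        rw [h1.deriv_eq]
        exact (Real.hasDerivAt_rpow_const (Or.inl hs0.ne')).deriv
      have h2 : |deriv G s| = abar / 2 * (s ^ (abar / 2 + 1))⁻¹ := by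
        rw [hd, show -(abar / 2) - 1 = -(abar / 2 + 1) by ring, Real.rpow_neg hs0.le, abs_mul,
          abs_neg, abs_of_pos (by positivity : 0 < abar / 2), abs_of_pos (by positivity)]
      have h3 : (1 + s) ^ (abar / 2 + 1) ≤ 2 ^ (abar / 2 + 1) * s ^ (abar / 2 + 1) := by
        rw [← Real.mul_rpow (by norm_num) hs0.le]
        gcongr
        linarith
      calc _ ≤ |deriv G s| * (2 ^ (abar / 2 + 1) * s ^ (abar / 2 + 1)) := by gcongr
        _ = abar / 2 * 2 ^ (abar / 2 + 1) := by
          rw [h2]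
          have : s ^ (abar / 2 + 1) ≠ 0 := by positivity
          field_simp
        _ ≤ _ := by
          have h4 : (0 : ℝ) ≤ abar / 2 * 2 ^ (abar / 2 + 1) := by positivity
          have h5 : (0 : ℝ) ≤ C * (6 : ℝ) ^ (abar / 2 + 1) := by positivity
          linarith

end RadialProfile

/-! ### Rotations of the plane -/

section Rotation

@[simp] theorem rot_apply_zero (θ : ℝ) (x : Plane) :
    rot θ x 0 = Real.cos θ * x 0 - Real.sin θ * x 1 := rfl

@[simp] theorem rot_apply_one (θ : ℝ) (x : Plane) :
    rot θ x 1 = Real.sin θ * x 0 + Real.cos θ * x 1 := rfl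

@[simp] theorem perp_apply_zero (x : Plane) : perp x 0 = -x 1 := rfl

@[simp] theorem perp_apply_one (x : Plane) : perp x 1 = x 0 := rfl

theorem Plane.ext' {x y : Plane} (h0 : x 0 = y 0) (h1 : x 1 = y 1) : x = y := by
  ext i
  fin_cases i
  · exact h0
  · exact h1

theorem rot_zero (x : Plane) : rot 0 x = x := by
  apply Plane.ext' <;> simp

theorem rot_rot (θ φ : ℝ) (x : Plane) : rot θ (rot φ x) = rot (θ + φ) x := by
  apply Plane.ext' <;> simp [Real.cos_add, Real.sin_add] <;> ring

theorem rot_smul (θ c : ℝ) (x : Plane) : rot θ (c • x) = c • rot θ x :=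
  (rotIsometry θ).map_smul c x

theorem rot_add_vec (θ : ℝ) (x y : Plane) : rot θ (x + y) = rot θ x + rot θ y :=
  (rotIsometry θ).map_add x y

theorem rot_sub_vec (θ : ℝ) (x y : Plane) : rot θ (x - y) = rot θ x - rot θ y :=
  (rotIsometry θ).map_sub x y

theorem norm_rot (θ : ℝ) (x : Plane) : ‖rot θ x‖ = ‖x‖ := (rotIsometry θ).norm_map x

theorem perp_rot (θ : ℝ) (x : Plane) : perp (rot θ x) = rot θ (perp x) := by
  apply Plane.ext' <;> simp <;> ring

theorem perp_smul (c : ℝ) (x : Plane) : perp (c • x) = c • perp x := by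
  apply Plane.ext' <;> simp

theorem norm_sq_plane (x : Plane) : ‖x‖ ^ 2 = x 0 ^ 2 + x 1 ^ 2 := by
  simp [EuclideanSpace.norm_sq_eq, Fin.sum_univ_two]

theorem norm_perp (x : Plane) : ‖perp x‖ = ‖x‖ := by
  have h : ‖perp x‖ ^ 2 = ‖x‖ ^ 2 := by
    rw [norm_sq_plane, norm_sq_plane]
    simp
    ring
  exact (sq_eq_sq₀ (norm_nonneg _) (norm_nonneg _)).1 h

theorem continuous_perp : Continuous perp := by
  unfold perp
  fun_prop

theorem rot_periodic (x : Plane) : Function.Periodic (fun θ => rot θ x) (2 * Real.pi) := by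
  intro θ
  apply Plane.ext' <;> simp

theorem measurable_rot_uncurry : Measurable fun p : ℝ × Plane => rot p.1 p.2 := by
  refine Continuous.measurable ?_
  unfold rot
  fun_prop

theorem lintegral_rot {f : Plane → ℝ≥0∞} (hf : Measurable f) (θ : ℝ) :
    ∫⁻ x, f (rot θ x) = ∫⁻ x, f x :=
  (measurePreserving_rot θ).lintegral_comp hf

/-- Averages over rotations do not see a rotation of the argument. -/
theorem lintegral_rot_angle (f : Plane → ℝ≥0∞) (a : ℝ) (x : Plane) :
    ∫⁻ θ in Ioc 0 (2 * Real.pi), f (rot θ (rot a x)) =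
      ∫⁻ θ in Ioc 0 (2 * Real.pi), f (rot θ x) := by
  have hper : Function.Periodic (fun θ => f (rot θ x)) (2 * Real.pi) := fun θ => by
    simp only [rot_periodic x θ]
  have h1 : ∫⁻ θ in Ioc 0 (2 * Real.pi), f (rot θ (rot a x)) =
      ∫⁻ θ in Ioc a (a + 2 * Real.pi), f (rot θ x) := by
    have h := (measurePreserving_add_right volume a).setLIntegral_comp_preimage_emb
      (measurableEmbedding_addRight a) (fun θ => f (rot θ x)) (Ioc a (a + 2 * Real.pi))
    have hpre : (fun θ : ℝ => θ + a) ⁻¹' Ioc a (a + 2 * Real.pi) = Ioc 0 (2 * Real.pi) := by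
      ext θ
      simp only [mem_preimage, mem_Ioc]
      constructor <;> rintro ⟨h1, h2⟩ <;> constructor <;> linarith
    rw [hpre] at h
    rw [← h]
    simp only [rot_rot]
  rw [h1]
  have : VAddInvariantMeasure (AddSubgroup.zmultiples (2 * Real.pi)) ℝ volume :=
    ⟨fun c s _ => measure_preimage_add _ _ _⟩
  have h2 := (isAddFundamentalDomain_Ioc Real.two_pi_pos a).setLIntegral_eq
    (isAddFundamentalDomain_Ioc Real.two_pi_pos 0) (fun θ => f (rot θ x))
    hper.map_vadd_zmultiples
  rwa [zero_add] at h2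

/-- A differential rotation, whose angle depends on the modulus only, preserves Lebesgue measure.
Averaging over all rigid rotations, which commute with it, reduces this to the invariance of the
average under rotations. -/
theorem measurePreserving_differential_rotation {h : ℝ → ℝ} (hh : Measurable h) :
    MeasurePreserving (fun x : Plane => rot (h ‖x‖) x) volume volume := by
  set F : Plane → Plane := fun x => rot (h ‖x‖) x
  have hF : Measurable F :=
    measurable_rot_uncurry.comp (f := fun x : Plane => (h ‖x‖, x))
      ((hh.comp measurable_norm).prodMk measurable_id)
  have hFrot : ∀ θ x, F (rot θ x) = rot θ (F x) := fun θ x => by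
    simp only [F, norm_rot, rot_rot, add_comm]
  refine ⟨hF, Measure.ext_of_lintegral _ fun f hf => ?_⟩
  rw [lintegral_map hf hF]
  have key : ∀ E : Plane → Plane, Measurable E → (∀ θ x, E (rot θ x) = rot θ (E x)) →
      ENNReal.ofReal (2 * Real.pi) * ∫⁻ x, f (E x) =
        ∫⁻ x, ∫⁻ θ in Ioc 0 (2 * Real.pi), f (rot θ (E x)) := by
    intro E hE hcomm
    have hm : Measurable fun p : Plane × ℝ => f (rot p.2 (E p.1)) :=
      hf.comp (measurable_rot_uncurry.comp (f := fun p : Plane × ℝ => (p.2, E p.1))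
        (measurable_snd.prodMk (hE.comp measurable_fst)))
    rw [lintegral_lintegral_swap hm.aemeasurable]
    have : ∀ θ, ∫⁻ x, f (rot θ (E x)) = ∫⁻ x, f (E x) := fun θ => by
      simp only [← hcomm]
      exact lintegral_rot (f := fun x => f (E x)) (hf.comp hE) θ
    simp only [this, lintegral_const, Measure.restrict_apply_univ, Real.volume_Ioc, sub_zero]
    rw [mul_comm]
  have h1 := key F hF hFrot
  have h2 := key id measurable_id (fun _ _ => rfl)
  have h3 : ∀ x, ∫⁻ θ in Ioc 0 (2 * Real.pi), f (rot θ (F x)) =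
      ∫⁻ θ in Ioc 0 (2 * Real.pi), f (rot θ (id x)) := fun x => lintegral_rot_angle f _ x
  simp only [h3] at h1
  rw [← h2] at h1
  exact (ENNReal.mul_right_inj (by simp [Real.pi_pos]) ENNReal.ofReal_ne_top).1 h1

theorem contDiff_rot_uncurry : ContDiff ℝ ∞ fun p : ℝ × Plane => rot p.1 p.2 := by
  rw [contDiff_euclidean]
  intro i
  fin_cases i
  · simp only [Fin.zero_eta, rot_apply_zero]
    fun_prop
  · simp only [Fin.mk_one, rot_apply_one]
    fun_prop

theorem hasDerivAt_rot (θ : ℝ) (x : Plane) :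
    HasDerivAt (fun θ => rot θ x) (perp (rot θ x)) θ := by
  have h : ∀ θ, rot θ x = Real.cos θ • x + Real.sin θ • perp x := fun θ => by
    apply Plane.ext' <;> simp <;> ring
  have h' : perp (rot θ x) = -Real.sin θ • x + Real.cos θ • perp x := by
    apply Plane.ext' <;> simp <;> ring
  rw [funext h, h']
  exact ((Real.hasDerivAt_cos θ).smul_const x).add ((Real.hasDerivAt_sin θ).smul_const (perp x))

end Rotation

/-! ### The flow of the transport part -/

/-- Coefficients of the transport equation in radial form: the rate `γ` of the dilation, the
strength `β` of the rotation, and the angular velocity `Z(s) = Z 0 + s W(s)` as a function of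
`s = |x|²`. -/
structure FlowData where
  γ : ℝ
  β : ℝ
  Z : ℝ → ℝ
  W : ℝ → ℝ
  γ_pos : 0 < γ
  Z_eq : ∀ s, Z s = Z 0 + s * W s
  smooth_Z : ContDiff ℝ ∞ Z
  smooth_W : ContDiff ℝ ∞ W
  bdd_Z : ∃ C, ∀ s, 0 ≤ s → |Z s| ≤ C

namespace FlowData

variable (D : FlowData)

/-- The vector field `γ x - β Z(|x|²) x^⊥`. -/
def field (x : Plane) : Plane := D.γ • x - (D.β * D.Z (‖x‖ ^ 2)) • perp x

/-- The angle by which the flow turns a point with `|x|² = s` in time `t`: the integral of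
`-β Z(e ^ (2 γ τ) s)` over `0 ≤ τ ≤ t`, written so that its smoothness in `(t, s)` is apparent. -/
def angle (t s : ℝ) : ℝ :=
  -D.β * ((2 * D.γ)⁻¹ * ((∫ τ in (0 : ℝ)..Real.exp (2 * D.γ * t) * s, D.W τ) -
    ∫ τ in (0 : ℝ)..s, D.W τ) + D.Z 0 * t)

/-- The flow of `D.field`: a dilation composed with a differential rotation. -/
def flow (t : ℝ) (x : Plane) : Plane := Real.exp (D.γ * t) • rot (D.angle t (‖x‖ ^ 2)) x

theorem norm_flow (t : ℝ) (x : Plane) : ‖D.flow t x‖ = Real.exp (D.γ * t) * ‖x‖ := by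
  rw [flow, norm_smul, norm_rot, Real.norm_eq_abs, Real.abs_exp]

theorem norm_flow_sq (t : ℝ) (x : Plane) :
    ‖D.flow t x‖ ^ 2 = Real.exp (2 * D.γ * t) * ‖x‖ ^ 2 := by
  rw [norm_flow, mul_pow, ← Real.exp_nat_mul]
  congr 2
  push_cast
  ring

theorem angle_zero (s : ℝ) : D.angle 0 s = 0 := by simp [angle]

theorem angle_add (s t r : ℝ) :
    D.angle (s + t) r = D.angle s (Real.exp (2 * D.γ * t) * r) + D.angle t r := by
  simp only [angle, ← mul_assoc, ← Real.exp_add, mul_add]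
  ring

theorem flow_zero (x : Plane) : D.flow 0 x = x := by
  simp [flow, angle_zero, rot_zero]

theorem flow_add (s t : ℝ) (x : Plane) : D.flow (s + t) x = D.flow s (D.flow t x) := by
  conv_rhs => rw [flow, norm_flow_sq, flow, rot_smul, rot_rot, ← angle_add, smul_smul,
    ← Real.exp_add, ← mul_add]
  rfl

theorem flow_neg_flow (t : ℝ) (x : Plane) : D.flow (-t) (D.flow t x) = x := by
  rw [← flow_add, neg_add_cancel, flow_zero]

theorem flow_flow_neg (t : ℝ) (x : Plane) : D.flow t (D.flow (-t) x) = x := by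
  rw [← flow_add, add_neg_cancel, flow_zero]

theorem flow_rot (t θ : ℝ) (x : Plane) : D.flow t (rot θ x) = rot θ (D.flow t x) := by
  simp only [flow, norm_rot, rot_rot, rot_smul, add_comm]

theorem contDiff_primitive : ContDiff ℝ ∞ fun s => ∫ τ in (0 : ℝ)..s, D.W τ :=
  contDiff_integral D.smooth_W

theorem contDiff_angle : ContDiff ℝ ∞ fun p : ℝ × ℝ => D.angle p.1 p.2 := by
  unfold angle
  have h := D.contDiff_primitive
  have h1 : ContDiff ℝ ∞ fun p : ℝ × ℝ => Real.exp (2 * D.γ * p.1) * p.2 := by fun_prop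
  have h2 := h.comp h1
  have h3 := h.comp (contDiff_snd (𝕜 := ℝ) (E := ℝ) (F := ℝ) (n := ∞))
  simp only [Function.comp_def] at h2 h3
  fun_prop

theorem contDiff_flow_uncurry : ContDiff ℝ ∞ fun p : ℝ × Plane => D.flow p.1 p.2 := by
  unfold flow
  have h1 : ContDiff ℝ ∞ fun p : ℝ × Plane => (p.1, ‖p.2‖ ^ 2) :=
    contDiff_fst.prodMk (contDiff_snd.norm_sq ℝ)
  have h2 : ContDiff ℝ ∞ fun p : ℝ × Plane => (D.angle p.1 (‖p.2‖ ^ 2), p.2) :=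
    (D.contDiff_angle.comp h1).prodMk contDiff_snd
  have h3 := contDiff_rot_uncurry.comp h2
  simp only [Function.comp_def] at h3
  fun_prop

theorem contDiff_flow (t : ℝ) : ContDiff ℝ ∞ (D.flow t) :=
  D.contDiff_flow_uncurry.comp (contDiff_prodMk_right t)

/-- The flow as a homeomorphism of the plane. -/
def flowHomeomorph (t : ℝ) : Plane ≃ₜ Plane where
  toFun := D.flow t
  invFun := D.flow (-t)
  left_inv := D.flow_neg_flow t
  right_inv := D.flow_flow_neg t
  continuous_toFun := (D.contDiff_flow t).continuous
  continuous_invFun := (D.contDiff_flow (-t)).continuous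

theorem hasDerivAt_angle (t s : ℝ) :
    HasDerivAt (fun t => D.angle t s) (-D.β * D.Z (Real.exp (2 * D.γ * t) * s)) t := by
  have h1 : HasDerivAt (fun t => Real.exp (2 * D.γ * t) * s)
      (Real.exp (2 * D.γ * t) * (2 * D.γ * 1) * s) t :=
    (((hasDerivAt_id t).const_mul (2 * D.γ)).exp).mul_const s
  have h2 : HasDerivAt (fun r => ∫ τ in (0 : ℝ)..r, D.W τ) (D.W (Real.exp (2 * D.γ * t) * s))
      (Real.exp (2 * D.γ * t) * s) :=
    (D.smooth_W.continuous.integral_hasStrictDerivAt 0 _).hasDerivAt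
  have h3 := ((((h2.comp t h1).sub_const (∫ τ in (0 : ℝ)..s, D.W τ)).const_mul (2 * D.γ)⁻¹).add
    ((hasDerivAt_id t).const_mul (D.Z 0))).const_mul (-D.β)
  refine h3.congr_deriv ?_
  rw [D.Z_eq (Real.exp (2 * D.γ * t) * s)]
  have := D.γ_pos.ne'
  field_simp
  ring

theorem hasDerivAt_flow (t : ℝ) (x : Plane) :
    HasDerivAt (fun t => D.flow t x) (D.field (D.flow t x)) t := by
  have h1 : HasDerivAt (fun t => Real.exp (D.γ * t)) (Real.exp (D.γ * t) * (D.γ * 1)) t :=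
    ((hasDerivAt_id t).const_mul D.γ).exp
  have h2 := (hasDerivAt_rot (D.angle t (‖x‖ ^ 2)) x).scomp t (D.hasDerivAt_angle t (‖x‖ ^ 2))
  refine (h1.smul h2).congr_deriv ?_
  simp only [field, norm_flow_sq]
  simp only [flow, perp_smul, Function.comp_apply]
  module

/-- The flow multiplies areas by `e ^ (2 γ t)`, so the push-forward has the inverse density. -/
theorem map_flow_volume (t : ℝ) :
    Measure.map (D.flow t) volume = ENNReal.ofReal (Real.exp (-(2 * D.γ * t))) • volume := by
  have hc : Continuous fun r : ℝ => D.angle t (r ^ 2) :=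
    Continuous.comp (g := fun p : ℝ × ℝ => D.angle p.1 p.2) (f := fun r : ℝ => (t, r ^ 2))
      D.contDiff_angle.continuous (by fun_prop)
  have h := measurePreserving_differential_rotation hc.measurable
  have h2 := Measure.map_addHaar_smul (volume : Measure Plane) (Real.exp_pos (D.γ * t)).ne'
  have h3 : D.flow t = (fun x : Plane => Real.exp (D.γ * t) • x) ∘
      fun x : Plane => rot (D.angle t (‖x‖ ^ 2)) x := rfl
  rw [h3, ← Measure.map_map (by fun_prop) h.measurable, h.map_eq]
  refine h2.trans ?_
  congr 2
  rw [finrank_euclideanSpace, Fintype.card_fin, ← Real.exp_nat_mul, abs_inv, Real.abs_exp,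
    ← Real.exp_neg]
  congr 1
  push_cast
  ring

end FlowData

/-! ### The transport semigroup on symmetric functions -/

section Pairing

theorem memLp_decay {r : ℝ} (hr : 1 < r) :
    MemLp (fun y : Plane => (1 + ‖y‖) ^ (-r)) 2 volume := by
  have hm : AEStronglyMeasurable (fun y : Plane => (1 + ‖y‖) ^ (-r)) volume :=
    Measurable.aestronglyMeasurable (by fun_prop)
  rw [memLp_two_iff_integrable_sq hm]
  have h := integrable_one_add_norm (E := Plane) (μ := volume) (r := 2 * r) (by simp; linarith)
  refine h.congr (ae_of_all _ fun y => ?_)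
  simp only
  rw [← Real.rpow_natCast, ← Real.rpow_mul (by positivity)]
  congr 1
  push_cast
  ring

/-- The bilinear pairing `Ω ↦ ∫ Ω φ` with a square integrable function. -/
def pairing {φ : Plane → ℂ} (hφ : MemLp φ 2 volume) : L2 →L[ℂ] ℂ :=
  innerSL ℂ (hφ.star.toLp : L2)

theorem pairing_apply {φ : Plane → ℂ} (hφ : MemLp φ 2 volume) (f : L2) :
    pairing hφ f = ∫ x, f x * φ x := by
  rw [pairing, innerSL_apply_apply, L2.inner_def]
  refine integral_congr_ae ?_
  filter_upwards [hφ.star.coeFn_toLp] with x hx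
  rw [hx]
  simp [mul_comm]

theorem memLp_schwartz (φ : 𝓢(Plane, ℂ)) : MemLp φ 2 (volume : Measure Plane) := φ.memLp 2 volume

theorem isClosed_L2m (m : ℕ) : IsClosed (L2m m : Set L2) := by
  have h : (L2m m : Set L2) = {f : L2 | Lp.compMeasurePreserving (rot (2 * Real.pi / m))
      (measurePreserving_rot _) f = f} := by
    ext f
    change (f : Plane → ℂ) ∘ rot (2 * Real.pi / m) =ᵐ[volume] f ↔ _
    rw [mem_ofPred_eq, Lp.ext_iff]
    have h1 := Lp.coeFn_compMeasurePreserving f (measurePreserving_rot (2 * Real.pi / m))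
    exact ⟨fun h => h1.trans h, fun h => h1.symm.trans h⟩
  rw [h]
  exact isClosed_eq (Lp.isometry_compMeasurePreserving (measurePreserving_rot _)).continuous
    continuous_id

instance (m : ℕ) : CompleteSpace (L2m m) := (isClosed_L2m m).completeSpace_coe

theorem mem_L2m {m : ℕ} {f : L2} :
    f ∈ L2m m ↔ (fun x => f (rot (2 * Real.pi / m) x)) =ᵐ[volume] f := Iff.rfl

end Pairing

namespace FlowData

variable (D : FlowData)

theorem quasiMeasurePreserving_flow (t : ℝ) : Measure.QuasiMeasurePreserving (D.flow t) := by
  refine ⟨(D.contDiff_flow t).continuous.measurable, ?_⟩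
  rw [D.map_flow_volume]
  exact Measure.smul_absolutelyContinuous

theorem integral_comp_flow (t : ℝ) (H : Plane → ℂ) :
    ∫ x, H (D.flow t x) = Real.exp (-(2 * D.γ * t)) • ∫ x, H x := by
  have h := (D.flowHomeomorph t).measurableEmbedding.integral_map (μ := volume) H
  change ∫ y, H y ∂(Measure.map (D.flow t) volume) = ∫ x, H (D.flow t x) at h
  rw [← h, D.map_flow_volume, integral_smul_measure, ENNReal.toReal_ofReal (Real.exp_nonneg _)]

theorem eLpNorm_comp_flow (t : ℝ) (f : L2) :
    eLpNorm (fun x => ((Real.exp (D.γ * t) : ℝ) : ℂ) * f (D.flow t x)) 2 volume =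
      eLpNorm f 2 volume := by
  have h1 : eLpNorm (fun x => f (D.flow t x)) 2 volume =
      ENNReal.ofReal (Real.exp (-(D.γ * t))) * eLpNorm f 2 volume := by
    have h := eLpNorm_map_measure (p := 2) (μ := volume) (f := D.flow t) (g := (f : Plane → ℂ))
      (by
        rw [D.map_flow_volume]
        exact (Lp.aestronglyMeasurable f).smul_measure _)
      (D.contDiff_flow t).continuous.aemeasurable
    simp only [Function.comp_def] at h
    rw [← h, D.map_flow_volume, eLpNorm_smul_measure_of_ne_zero (by simp [Real.exp_pos]),
      smul_eq_mul, ENNReal.ofReal_rpow_of_pos (Real.exp_pos _), ← Real.exp_mul]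
    congr 3
    simp
    ring
  have h2 : (fun x => ((Real.exp (D.γ * t) : ℝ) : ℂ) * f (D.flow t x)) =
      ((Real.exp (D.γ * t) : ℝ) : ℂ) • fun x => f (D.flow t x) := rfl
  rw [h2, eLpNorm_const_smul, h1, ← mul_assoc, ← ofReal_norm, Complex.norm_real,
    Real.norm_eq_abs, Real.abs_exp, ← ENNReal.ofReal_mul (Real.exp_nonneg _), ← Real.exp_add,
    add_neg_cancel, Real.exp_zero, ENNReal.ofReal_one, one_mul]

theorem memLp_comp_flow (t : ℝ) (f : L2) :
    MemLp (fun x => ((Real.exp (D.γ * t) : ℝ) : ℂ) * f (D.flow t x)) 2 volume := by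
  refine ⟨?_, ?_⟩
  · exact ((Lp.aestronglyMeasurable f).comp_quasiMeasurePreserving
      (D.quasiMeasurePreserving_flow t)).const_mul _
  · rw [D.eLpNorm_comp_flow]
    exact (Lp.memLp f).2

/-- The unitary group `f ↦ e ^ (γ t) f ∘ Φ_t` on `L²`. -/
def koopman (t : ℝ) : L2 →ₗᵢ[ℂ] L2 where
  toFun f := (D.memLp_comp_flow t f).toLp
  map_add' f g := by
    apply Lp.ext
    filter_upwards [(D.memLp_comp_flow t (f + g)).coeFn_toLp, (D.memLp_comp_flow t f).coeFn_toLp,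
      (D.memLp_comp_flow t g).coeFn_toLp,
      Lp.coeFn_add (D.memLp_comp_flow t f).toLp (D.memLp_comp_flow t g).toLp,
      (D.quasiMeasurePreserving_flow t).ae_eq_comp (Lp.coeFn_add f g)] with x h1 h2 h3 h4 h5
    simp only [Function.comp_apply, Pi.add_apply] at h5 h4
    rw [h1, h4, h2, h3, h5, mul_add]
  map_smul' c f := by
    apply Lp.ext
    filter_upwards [(D.memLp_comp_flow t (c • f)).coeFn_toLp, (D.memLp_comp_flow t f).coeFn_toLp,
      Lp.coeFn_smul c (D.memLp_comp_flow t f).toLp,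
      (D.quasiMeasurePreserving_flow t).ae_eq_comp (Lp.coeFn_smul c f)] with x h1 h2 h4 h5
    simp only [Function.comp_apply, Pi.smul_apply, smul_eq_mul] at h5 h4
    simp only [RingHom.id_apply]
    rw [h1, h4, h2, h5]
    ring
  norm_map' f := by
    change ‖(D.memLp_comp_flow t f).toLp‖ = _
    rw [Lp.norm_toLp, D.eLpNorm_comp_flow, Lp.norm_def]

theorem coeFn_koopman (t : ℝ) (f : L2) :
    D.koopman t f =ᵐ[volume] fun x => ((Real.exp (D.γ * t) : ℝ) : ℂ) * f (D.flow t x) :=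
  (D.memLp_comp_flow t f).coeFn_toLp

theorem koopman_zero (f : L2) : D.koopman 0 f = f := by
  apply Lp.ext
  filter_upwards [D.coeFn_koopman 0 f] with x hx
  rw [hx, D.flow_zero]
  simp

theorem koopman_add (s t : ℝ) (f : L2) : D.koopman (s + t) f = D.koopman s (D.koopman t f) := by
  apply Lp.ext
  filter_upwards [D.coeFn_koopman (s + t) f, D.coeFn_koopman s (D.koopman t f),
    (D.quasiMeasurePreserving_flow s).ae_eq_comp (D.coeFn_koopman t f)] with x h1 h2 h3
  simp only [Function.comp_apply] at h3
  rw [h1, h2, h3, ← mul_assoc, ← Complex.ofReal_mul, ← Real.exp_add, ← D.flow_add, ← mul_add,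
    add_comm t s]

theorem koopman_mem_L2m {m : ℕ} (t : ℝ) {f : L2} (hf : f ∈ L2m m) : D.koopman t f ∈ L2m m := by
  rw [mem_L2m] at hf ⊢
  filter_upwards [D.coeFn_koopman t f, (measurePreserving_rot
    (2 * Real.pi / m)).quasiMeasurePreserving.ae_eq_comp (D.coeFn_koopman t f),
    (D.quasiMeasurePreserving_flow t).ae_eq_comp hf] with x h1 h2 h3
  simp only [Function.comp_apply] at h2 h3
  rw [h1, h2, D.flow_rot, h3]

theorem continuous_field : Continuous D.field := by
  have h := D.smooth_Z.continuous
  have h2 := continuous_perp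
  unfold field
  fun_prop

theorem exists_norm_field_le : ∃ B, 0 ≤ B ∧ ∀ x, ‖D.field x‖ ≤ B * ‖x‖ := by
  obtain ⟨C, hC⟩ := D.bdd_Z
  have hC0 : 0 ≤ C := (abs_nonneg _).trans (hC 0 le_rfl)
  refine ⟨D.γ + |D.β| * C, by have := D.γ_pos; positivity, fun x => ?_⟩
  calc ‖D.field x‖ ≤ ‖D.γ • x‖ + ‖(D.β * D.Z (‖x‖ ^ 2)) • perp x‖ := norm_sub_le _ _
    _ = D.γ * ‖x‖ + |D.β| * |D.Z (‖x‖ ^ 2)| * ‖x‖ := by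
      rw [norm_smul, norm_smul, norm_perp, Real.norm_eq_abs, abs_of_pos D.γ_pos, Real.norm_eq_abs,
        abs_mul]
    _ ≤ D.γ * ‖x‖ + |D.β| * C * ‖x‖ := by
      gcongr
      exact hC _ (by positivity)
    _ = _ := by ring

/-- The derivative of a Schwartz function along the flow decays quadratically. -/
theorem exists_norm_fderiv_field_le (φ : 𝓢(Plane, ℂ)) :
    ∃ C, 0 ≤ C ∧ ∀ x, ‖fderiv ℝ φ x (D.field x)‖ ≤ C * (1 + ‖x‖) ^ (-2 : ℝ) := by
  obtain ⟨B, hB0, hB⟩ := D.exists_norm_field_le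
  set C' := 2 ^ 3 * ((Finset.Iic (3, 1)).sup fun m => SchwartzMap.seminorm ℝ m.1 m.2) φ
  have hC' : ∀ x, (1 + ‖x‖) ^ 3 * ‖fderiv ℝ φ x‖ ≤ C' := fun x => by
    have h := SchwartzMap.one_add_le_sup_seminorm_apply (𝕜 := ℝ) (m := (3, 1)) le_rfl le_rfl φ x
    rwa [norm_iteratedFDeriv_one] at h
  have hC0 : 0 ≤ C' := le_trans (by positivity) (hC' 0)
  refine ⟨B * C', by positivity, fun x => ?_⟩
  have hx : 0 < 1 + ‖x‖ := by positivity
  rw [Real.rpow_neg hx.le, ← div_eq_mul_inv, le_div_iff₀ (by positivity)]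
  have h2 : (1 + ‖x‖) ^ (2 : ℝ) = (1 + ‖x‖) ^ 2 := Real.rpow_natCast _ 2
  rw [h2]
  calc _ ≤ ‖fderiv ℝ φ x‖ * (B * ‖x‖) * (1 + ‖x‖) ^ 2 := by
        gcongr
        exact ((fderiv ℝ φ x).le_opNorm _).trans (by gcongr; exact hB x)
    _ ≤ ‖fderiv ℝ φ x‖ * (B * (1 + ‖x‖)) * (1 + ‖x‖) ^ 2 := by
        gcongr
        linarith
    _ = B * ((1 + ‖x‖) ^ 3 * ‖fderiv ℝ φ x‖) := by ring
    _ ≤ B * C' := by gcongr; exact hC' x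

theorem memLp_schwartz_comp_flow (φ : 𝓢(Plane, ℂ)) (t : ℝ) :
    MemLp (fun y => φ (D.flow t y)) 2 volume := by
  have h := D.memLp_comp_flow t ((memLp_schwartz φ).toLp)
  have h2 := h.const_mul ((Real.exp (D.γ * t) : ℝ) : ℂ)⁻¹
  refine (memLp_congr_ae ?_).1 h2
  filter_upwards [(D.quasiMeasurePreserving_flow t).ae_eq_comp
    ((memLp_schwartz φ).coeFn_toLp)] with x hx
  simp only [Function.comp_apply] at hx
  rw [hx, ← mul_assoc, inv_mul_cancel₀ (by simp), one_mul]

theorem continuous_fderiv_field (φ : 𝓢(Plane, ℂ)) :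
    Continuous fun x => fderiv ℝ φ x (D.field x) :=
  ((φ.smooth 1).continuous_fderiv one_ne_zero).clm_apply D.continuous_field

/-- Differentiation of the pairing of `f` with a Schwartz function carried by the flow. -/
theorem hasDerivAt_pairing (f : L2) (φ : 𝓢(Plane, ℂ)) (t₀ : ℝ) :
    HasDerivAt (fun t => ∫ y, f y * φ (D.flow (-t) y))
      (-∫ y, f y * fderiv ℝ φ (D.flow (-t₀) y) (D.field (D.flow (-t₀) y))) t₀ := by
  obtain ⟨C, hC0, hC⟩ := D.exists_norm_fderiv_field_le φ
  set c := Real.exp (-(D.γ * (|t₀| + 1)))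
  have hc0 : 0 < c := Real.exp_pos _
  have hc1 : c ≤ 1 := Real.exp_le_one_iff.2 (by
    have := D.γ_pos
    have : 0 ≤ D.γ * (|t₀| + 1) := by positivity
    linarith)
  rw [← integral_neg]
  refine (hasDerivAt_integral_of_dominated_loc_of_deriv_le (s := Metric.ball t₀ 1)
    (bound := fun y => ‖f y‖ * (C * c ^ (-2 : ℝ) * (1 + ‖y‖) ^ (-2 : ℝ)))
    (F := fun t y => f y * φ (D.flow (-t) y))
    (F' := fun t y => -(f y * fderiv ℝ φ (D.flow (-t) y) (D.field (D.flow (-t) y))))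
    (Metric.ball_mem_nhds _ one_pos) ?_ ?_ ?_ ?_ ?_ ?_).2
  · refine Eventually.of_forall fun t => (Lp.aestronglyMeasurable f).mul ?_
    exact (φ.continuous.comp (D.contDiff_flow _).continuous).aestronglyMeasurable
  · exact (Lp.memLp f).integrable_mul (D.memLp_schwartz_comp_flow φ (-t₀))
  · refine ((Lp.aestronglyMeasurable f).mul ?_).neg
    exact ((D.continuous_fderiv_field φ).comp (D.contDiff_flow _).continuous).aestronglyMeasurable
  · refine ae_of_all _ fun y t ht => ?_
    rw [norm_neg, norm_mul]
    gcongr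
    refine (hC _).trans ?_
    rw [mul_assoc, ← Real.mul_rpow hc0.le (by positivity)]
    refine mul_le_mul_of_nonneg_left ?_ hC0
    refine Real.rpow_le_rpow_of_nonpos (by positivity) ?_ (by norm_num)
    rw [D.norm_flow]
    have h1 : c ≤ Real.exp (D.γ * -t) := by
      refine Real.exp_le_exp.2 ?_
      have h2 : |t - t₀| < 1 := by simpa [Real.dist_eq] using ht
      have h3 : t ≤ |t₀| + 1 := by
        have := (abs_lt.1 h2).2
        linarith [le_abs_self t₀]
      have := mul_le_mul_of_nonneg_left h3 D.γ_pos.le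
      linarith
    calc c * (1 + ‖y‖) = c + c * ‖y‖ := by ring
      _ ≤ 1 + Real.exp (D.γ * -t) * ‖y‖ := by gcongr
  · have h := ((memLp_decay (r := 2) (by norm_num)).const_mul (C * c ^ (-2 : ℝ)))
    exact (Lp.memLp f).norm.integrable_mul h
  · refine ae_of_all _ fun y t _ => ?_
    have h1 : HasDerivAt (fun t => D.flow (-t) y) (-D.field (D.flow (-t) y)) t :=
      HasDerivAt.congr_deriv ((D.hasDerivAt_flow (-t) y).scomp t (hasDerivAt_neg t)) (by simp)
    have h2 :=
      ((φ.differentiable (D.flow (-t) y)).hasFDerivAt.comp_hasDerivAt t h1).const_mul (f y)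
    simpa using h2

theorem integral_koopman_mul (t : ℝ) (f : L2) (φ : Plane → ℂ) :
    ∫ x, D.koopman t f x * φ x =
      ((Real.exp (-(D.γ * t)) : ℝ) : ℂ) * ∫ y, f y * φ (D.flow (-t) y) := by
  have h1 : ∫ x, D.koopman t f x * φ x =
      ∫ x, (fun y => ((Real.exp (D.γ * t) : ℝ) : ℂ) * (f y * φ (D.flow (-t) y))) (D.flow t x) := by
    refine integral_congr_ae ?_
    filter_upwards [D.coeFn_koopman t f] with x hx
    rw [hx, D.flow_neg_flow, mul_assoc]
  rw [h1]
  refine (D.integral_comp_flow t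
    (fun y => ((Real.exp (D.γ * t) : ℝ) : ℂ) * (f y * φ (D.flow (-t) y)))).trans ?_
  rw [integral_const_mul, Complex.real_smul, ← mul_assoc,
    ← Complex.ofReal_mul, ← Real.exp_add]
  congr 4
  ring

/-- The unitary group is strongly continuous: it is weakly continuous by duality with Schwartz
functions, and weak convergence with conservation of norms is strong convergence. -/
theorem continuous_koopman (f : L2) : Continuous fun t => D.koopman t f := by
  have hweak : ∀ g : L2, Continuous fun t => inner ℂ g (D.koopman t f) := by
    intro g
    refine (SchwartzMap.denseRange_toLpCLM (F := ℂ) (μ := (volume : Measure Plane)) (p := 2)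
      ENNReal.ofNat_ne_top).induction_on (p := fun g : L2 => Continuous fun t =>
        inner ℂ g (D.koopman t f)) g ?_ ?_
    · rw [← isSeqClosed_iff_isClosed]
      intro u v hu huv
      have hlim : TendstoUniformly (fun n t => inner ℂ (u n) (D.koopman t f))
          (fun t => inner ℂ v (D.koopman t f)) atTop := by
        rw [Metric.tendstoUniformly_iff]
        intro ε hε
        have h1 : Tendsto (fun n => ‖v - u n‖ * ‖f‖) atTop (𝓝 0) := by
          have := (tendsto_const_nhds (x := v)).sub huv
          rw [sub_self] at this
          simpa using this.norm.mul_const ‖f‖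
        filter_upwards [h1.eventually_lt_const hε] with n hn t
        rw [dist_eq_norm, ← inner_sub_left]
        refine lt_of_le_of_lt (norm_inner_le_norm _ _) ?_
        rwa [(D.koopman t).norm_map]
      exact hlim.continuous (Eventually.of_forall hu).frequently
    · intro φ
      have h1 : ∀ t, inner ℂ (SchwartzMap.toLpCLM ℝ ℂ 2 volume φ : L2) (D.koopman t f) =
          (starRingEnd ℂ) (((Real.exp (-(D.γ * t)) : ℝ) : ℂ) *
            ∫ y, (star f : L2) y * φ (D.flow (-t) y)) := by
        intro t
        rw [← D.integral_koopman_mul, ← integral_conj, L2.inner_def]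
        refine integral_congr_ae ?_
        filter_upwards [φ.coeFn_toLp 2 volume, D.coeFn_koopman t (star f), D.coeFn_koopman t f,
          (D.quasiMeasurePreserving_flow t).ae_eq_comp (Lp.coeFn_star f)] with x h1 h2 h3 h4
        simp only [Function.comp_apply, Pi.star_apply] at h4
        simp only [SchwartzMap.toLpCLM_apply]
        rw [h1, h2, h3, h4]
        simp only [RCLike.inner_apply, map_mul, Complex.conj_ofReal, Complex.star_def,
          Complex.conj_conj]
      simp only [h1]
      refine Complex.continuous_conj.comp (Continuous.mul (by fun_prop) ?_)
      exact continuous_iff_continuousAt.2 fun t => (D.hasDerivAt_pairing _ φ t).continuousAt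
  rw [continuous_iff_continuousAt]
  intro t
  rw [ContinuousAt, tendsto_iff_norm_sub_tendsto_zero]
  have h1 : ∀ s, ‖D.koopman s f - D.koopman t f‖ ^ 2 =
      2 * ‖f‖ ^ 2 - 2 * RCLike.re (inner ℂ (D.koopman t f) (D.koopman s f)) := by
    intro s
    rw [@norm_sub_sq ℂ, (D.koopman s).norm_map, (D.koopman t).norm_map,
      ← inner_re_symm (𝕜 := ℂ) (D.koopman t f)]
    ring
  have h2 : Tendsto (fun s => ‖D.koopman s f - D.koopman t f‖ ^ 2) (𝓝 t) (𝓝 0) := by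
    simp only [h1]
    have h3 := ((RCLike.continuous_re (K := ℂ)).comp (hweak (D.koopman t f))).tendsto t
    have h4 := (h3.const_mul 2).const_sub (2 * ‖f‖ ^ 2)
    simp only [Function.comp_apply] at h4
    refine h4.trans (le_of_eq ?_)
    rw [inner_self_eq_norm_sq, (D.koopman t).norm_map, sub_self]
  have h5 := h2.sqrt
  simpa using h5

/-- The restriction of the unitary group to `L²_m`. -/
def koopmanSym (m : ℕ) (t : ℝ) : L2m m →L[ℂ] L2m m :=
  (((D.koopman t).toContinuousLinearMap).comp (L2m m).subtypeL).codRestrict (L2m m)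
    fun f => D.koopman_mem_L2m t f.2

theorem coe_koopmanSym (m : ℕ) (t : ℝ) (f : L2m m) :
    (D.koopmanSym m t f : L2) = D.koopman t f := rfl

/-- The semigroup `f ↦ e ^ t f ∘ Φ_t` on `L²_m`, a scalar multiple of the unitary group. -/
def transport (m : ℕ) : C0Semigroup (L2m m) where
  toFun t := ((Real.exp ((1 - D.γ) * t) : ℝ) : ℂ) • D.koopmanSym m t
  map_zero := by
    ext1 f
    apply Subtype.ext
    simp [coe_koopmanSym, koopman_zero]
  map_add s t := by
    ext1 f
    apply Subtype.ext
    simp only [smul_apply, ContinuousLinearMap.comp_apply, map_smul, Submodule.coe_smul,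
      coe_koopmanSym, smul_smul, ← Complex.ofReal_mul, ← Real.exp_add, NNReal.coe_add, koopman_add]
    congr 3
    ring
  continuous_orbit f := by
    have h : Continuous fun t : ℝ≥0 => D.koopmanSym m t f :=
      Continuous.subtype_mk ((D.continuous_koopman f).comp NNReal.continuous_coe) _
    simp only [smul_apply]
    fun_prop

theorem coe_transport (m : ℕ) (t : ℝ≥0) (f : L2m m) :
    (((D.transport m).toFun t f : L2m m) : L2) =
      ((Real.exp ((1 - D.γ) * t) : ℝ) : ℂ) • D.koopman t f := rfl

theorem norm_transport_le (m : ℕ) (t : ℝ≥0) :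
    ‖(D.transport m).toFun t‖ ≤ Real.exp ((1 - D.γ) * t) := by
  refine ContinuousLinearMap.opNorm_le_bound _ (Real.exp_nonneg _) fun f => le_of_eq ?_
  change ‖(((D.transport m).toFun t f : L2m m) : L2)‖ = _ * ‖(f : L2)‖
  rw [coe_transport, norm_smul, (D.koopman t).norm_map, Complex.norm_real, Real.norm_eq_abs,
    Real.abs_exp]

end FlowData

/-! ### The generator of the transport semigroup -/

theorem tendsto_slope_nnreal {F : ℝ → ℂ} {F' : ℂ} (h : HasDerivAt F F' 0) :
    Tendsto (fun t : ℝ≥0 => ((t : ℝ) : ℂ)⁻¹ * (F t - F 0)) (𝓝[>] 0) (𝓝 F') := by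
  have h2 := h.tendsto_slope_zero
  simp only [zero_add] at h2
  have h3 : Tendsto (fun t : ℝ≥0 => (t : ℝ)) (𝓝[>] 0) (𝓝[≠] 0) :=
    tendsto_nhdsWithin_iff.2 ⟨?_, ?_⟩
  · refine (h2.comp h3).congr fun t => ?_
    simp only [Function.comp_apply, ← Complex.ofReal_inv, Complex.real_smul]
  · simpa using (NNReal.continuous_coe.tendsto 0).mono_left nhdsWithin_le_nhds
  · filter_upwards [self_mem_nhdsWithin] with t ht
    simpa using (ne_of_gt ht)

/-- If `⟨T(t) f, P⟩' = ⟨T(t) y, P⟩` for all `P` in a separating family of functionals, then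
`T(t) f - f = ∫₀ᵗ T(s) y ds`, so that `f` lies in the domain of the generator, with value `y`. -/
theorem C0Semigroup.hasGen_of_weak {X : Type*} [NormedAddCommGroup X] [NormedSpace ℂ X]
    [CompleteSpace X] (T : C0Semigroup X) {ι : Type*} (P : ι → X →L[ℂ] ℂ)
    (hsep : ∀ u, (∀ i, P i u = 0) → u = 0) (f y : X)
    (h : ∀ i, ∃ N : ℝ → ℂ, (∀ s : ℝ, 0 ≤ s → HasDerivAt N (P i (T.toFun s.toNNReal y)) s) ∧
      ∀ t : ℝ≥0, P i (T.toFun t f) = N t) : T.HasGen f y := by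
  have hint : ∀ t : ℝ≥0, T.toFun t f - f = ∫ s in (0 : ℝ)..t, T.toFun s.toNNReal y := by
    intro t
    refine sub_eq_zero.1 (hsep _ fun i => ?_)
    obtain ⟨N, hN, hN0⟩ := h i
    have hcont : Continuous fun s : ℝ => P i (T.toFun s.toNNReal y) :=
      (P i).continuous.comp (T.continuous_orbit_real y)
    have h0 := hN0 0
    rw [T.toFun_zero_apply] at h0
    rw [map_sub, map_sub, hN0, h0, ← ContinuousLinearMap.intervalIntegral_comp_comm _
      ((T.continuous_orbit_real y).intervalIntegrable _ _),
      intervalIntegral.integral_eq_sub_of_hasDerivAt (f := N) (fun s hs => hN s ?_)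
        (hcont.intervalIntegrable _ _), NNReal.coe_zero, sub_self]
    rw [uIcc_of_le t.coe_nonneg] at hs
    exact hs.1
  have h := tendsto_average_zero (F := fun p : ℝ × ℝ => T.toFun p.2.toNNReal y)
    ((T.continuous_orbit_real y).comp continuous_snd)
  simp only [Real.toNNReal_zero, T.toFun_zero_apply] at h
  exact h.congr fun t => by rw [hint]

theorem Lp_ext_of_integral_smooth {f g : L2}
    (h : ∀ φ : 𝓢(Plane, ℂ), HasCompactSupport φ → ∫ x, f x * φ x = ∫ x, g x * φ x) : f = g := by
  apply Lp.ext
  refine ae_eq_of_integral_contDiff_smul_eq ((Lp.memLp f).locallyIntegrable (by norm_num))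
    ((Lp.memLp g).locallyIntegrable (by norm_num)) fun k hk hks => ?_
  have h1 : ContDiff ℝ ∞ fun x => (k x : ℂ) := Complex.ofRealCLM.contDiff.comp hk
  have h2 : HasCompactSupport fun x => (k x : ℂ) := hks.comp_left Complex.ofReal_zero
  have h3 := h (h2.toSchwartzMap h1) h2
  simpa [Complex.real_smul, mul_comm] using h3

namespace FlowData

variable (D : FlowData)

/-- The derivative along the flow commutes with composition with the flow. -/
theorem fderiv_comp_flow {φ : Plane → ℂ} (hφ : Differentiable ℝ φ) (t : ℝ) (x : Plane) :
    fderiv ℝ (fun y => φ (D.flow t y)) x (D.field x) =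
      fderiv ℝ φ (D.flow t x) (D.field (D.flow t x)) := by
  have hd : Differentiable ℝ fun y => φ (D.flow t y) :=
    hφ.comp ((D.contDiff_flow t).differentiable (by simp))
  have h0 : ∀ y, HasDerivAt (fun s => D.flow s y) (D.field y) 0 := fun y => by
    simpa [D.flow_zero] using D.hasDerivAt_flow 0 y
  have key : ∀ {ψ : Plane → ℂ}, Differentiable ℝ ψ → ∀ y,
      HasDerivAt (fun s => ψ (D.flow s y)) (fderiv ℝ ψ y (D.field y)) 0 := by
    intro ψ hψ y
    have h1 : HasFDerivAt ψ (fderiv ℝ ψ y) (D.flow 0 y) := by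
      rw [D.flow_zero]
      exact (hψ y).hasFDerivAt
    exact h1.comp_hasDerivAt 0 (h0 y)
  have h1 := key hd x
  have h2 := key hφ (D.flow t x)
  have h3 : (fun s => φ (D.flow t (D.flow s x))) = fun s => φ (D.flow s (D.flow t x)) := by
    funext s
    rw [← D.flow_add, ← D.flow_add, add_comm]
  rw [h3] at h1
  exact h1.unique h2

/-- The distribution `f + field · ∇f = (1 - 2 γ) f + div (f field)`, evaluated at `φ`. The
divergence of the field is `2 γ`. -/
def weakTransport (f : L2) (φ : Plane → ℂ) : ℂ :=
  ((1 - 2 * D.γ : ℝ) : ℂ) * (∫ x, f x * φ x) - ∫ x, f x * fderiv ℝ φ x (D.field x)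

theorem integral_transport_mul (m : ℕ) (t : ℝ≥0) (f : L2m m) (φ : 𝓢(Plane, ℂ)) :
    ∫ x, (((D.transport m).toFun t f : L2m m) : L2) x * φ x =
      ((Real.exp ((1 - 2 * D.γ) * t) : ℝ) : ℂ) * ∫ y, (f : L2) y * φ (D.flow (-t) y) := by
  rw [← pairing_apply (memLp_schwartz φ), coe_transport, map_smul, pairing_apply,
    D.integral_koopman_mul, smul_eq_mul, ← mul_assoc, ← Complex.ofReal_mul, ← Real.exp_add]
  congr 4
  ring

theorem hasDerivAt_integral_transport (f : L2) (φ : 𝓢(Plane, ℂ)) (t : ℝ) :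
    HasDerivAt (fun t : ℝ => ((Real.exp ((1 - 2 * D.γ) * t) : ℝ) : ℂ) *
        ∫ y, f y * φ (D.flow (-t) y))
      (((Real.exp ((1 - 2 * D.γ) * t) : ℝ) : ℂ) *
        D.weakTransport f (fun y => φ (D.flow (-t) y))) t := by
  have h1 : HasDerivAt (fun t : ℝ => ((Real.exp ((1 - 2 * D.γ) * t) : ℝ) : ℂ))
      ((Real.exp ((1 - 2 * D.γ) * t) * ((1 - 2 * D.γ) * 1) : ℝ) : ℂ) t :=
    ((((hasDerivAt_id t).const_mul (1 - 2 * D.γ)).exp)).ofReal_comp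
  refine (h1.mul (D.hasDerivAt_pairing f φ t)).congr_deriv ?_
  simp only [weakTransport, D.fderiv_comp_flow φ.differentiable]
  push_cast
  ring

/-- The generator of the transport semigroup is the weak transport operator with its maximal
domain. Test functions can be carried along by the flow, which turns the weak equation at time `0`
into a differential equation for the pairing at all times. -/
theorem hasGen_transport_iff (m : ℕ) (f y : L2m m) :
    (D.transport m).HasGen f y ↔
      ∀ φ : 𝓢(Plane, ℂ), D.weakTransport f φ = ∫ x, (y : L2) x * φ x := by
  set T := D.transport m
  let P : 𝓢(Plane, ℂ) → (L2m m →L[ℂ] ℂ) := fun φ =>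
    (pairing (memLp_schwartz φ)).comp (L2m m).subtypeL
  have hP : ∀ φ (f : L2m m), P φ f = ∫ x, (f : L2) x * φ x := fun φ f =>
    pairing_apply (memLp_schwartz φ) _
  have hPT : ∀ φ (t : ℝ≥0) (f : L2m m), P φ (T.toFun t f) =
      ((Real.exp ((1 - 2 * D.γ) * t) : ℝ) : ℂ) * ∫ y, (f : L2) y * φ (D.flow (-t) y) :=
    fun φ t f => by rw [hP, D.integral_transport_mul]
  constructor
  · intro h φ
    have h1 := ((P φ).continuous.tendsto y).comp h
    have h2 := tendsto_slope_nnreal (D.hasDerivAt_integral_transport f φ 0)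
    simp only [mul_zero, Real.exp_zero, Complex.ofReal_one, one_mul, neg_zero, D.flow_zero] at h2
    rw [← hP]
    refine tendsto_nhds_unique h2 (h1.congr fun t => ?_)
    simp only [Function.comp_apply, map_smul, map_sub, hPT, smul_eq_mul]
    rw [hP]
  · intro h
    refine T.hasGen_of_weak (ι := {φ : 𝓢(Plane, ℂ) // HasCompactSupport φ}) (fun φ => P φ)
      (fun u hu => ?_) f y fun ⟨φ, hφ⟩ =>
        ⟨fun t : ℝ => ((Real.exp ((1 - 2 * D.γ) * t) : ℝ) : ℂ) *
          ∫ z, (f : L2) z * φ (D.flow (-t) z), fun s hs => ?_, fun t => hPT φ t f⟩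
    · refine Subtype.ext (Lp_ext_of_integral_smooth fun φ hφ => ?_)
      rw [← hP, ← hP, hu ⟨φ, hφ⟩, map_zero]
    · refine (D.hasDerivAt_integral_transport f φ s).congr_deriv ?_
      -- the class of smooth compactly supported functions is invariant under the flow
      have hc : HasCompactSupport fun y => φ (D.flow (-s) y) :=
        hφ.comp_homeomorph (D.flowHomeomorph (-s))
      have hsm : ContDiff ℝ ∞ fun y => φ (D.flow (-s) y) :=
        ContDiff.comp φ.smooth' (D.contDiff_flow (-s))
      have h2 : D.weakTransport f (fun y => φ (D.flow (-s) y)) =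
          ∫ x, (y : L2) x * φ (D.flow (-s) x) := h (hc.toSchwartzMap hsm)
      simp only
      rw [hPT, Real.coe_toNNReal _ hs, h2]

end FlowData

/-! ### Compactness of integral operators -/

section HilbertSchmidt

/-- **Hilbert–Schmidt criterion**: a bounded operator for which `∑ ‖T bᵢ‖²` is bounded along an
orthonormal basis is compact. -/
theorem isCompactOperator_of_summable {H : Type*} [NormedAddCommGroup H] [InnerProductSpace ℂ H]
    [CompleteSpace H] {ι : Type*} (b : HilbertBasis ι ℂ H) (T : H →L[ℂ] H)
    (hT : Summable fun i => ‖T (b i)‖ ^ 2) : IsCompactOperator T := by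
  let R : ι → H →L[ℂ] H := fun i => (innerSL ℂ (b i)).smulRight (T (b i))
  have hR : ∀ i, IsCompactOperator (R i) := fun i =>
    (isCompactOperator_of_locallyCompactSpace_dom (innerSL ℂ (b i))).clm_comp
      ((1 : ℂ →L[ℂ] ℂ).smulRight (T (b i)))
  have hsum : ∀ s : Finset ι, IsCompactOperator (∑ i ∈ s, R i : H →L[ℂ] H) := fun s =>
    Submodule.sum_mem (compactOperator (RingHom.id ℂ) H H) fun i _ => hR i
  refine isCompactOperator_of_tendsto (l := atTop) (F := fun s : Finset ι => ∑ i ∈ s, R i) ?_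
    (Eventually.of_forall hsum)
  rw [Metric.tendsto_nhds]
  intro ε hε
  obtain ⟨s, hs⟩ := summable_iff_vanishing_norm.1 hT ((ε / 2) ^ 2) (by positivity)
  filter_upwards [eventually_ge_atTop s] with u hu
  rw [dist_comm, dist_eq_norm]
  refine lt_of_le_of_lt (ContinuousLinearMap.opNorm_le_bound _ (half_pos hε).le fun f => ?_)
    (half_lt_self hε)
  have h1 : HasSum (fun i => R i f) (T f) := by
    have h := (b.hasSum_repr f).mapL T
    simpa [R, b.repr_apply_apply] using h
  have h2 : Tendsto (fun v : Finset ι => ‖∑ i ∈ v, R i f - ∑ i ∈ u, R i f‖) atTop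
      (𝓝 ‖T f - ∑ i ∈ u, R i f‖) := (Tendsto.sub_const h1 _).norm
  have h3 : (T - ∑ i ∈ u, R i) f = T f - ∑ i ∈ u, R i f := by simp
  rw [h3]
  refine le_of_tendsto h2 ?_
  classical
  filter_upwards [eventually_ge_atTop u] with v hv
  rw [← Finset.sum_sdiff_eq_sub hv]
  have hvs : Disjoint (v \ u) s := Finset.disjoint_of_subset_right hu Finset.sdiff_disjoint
  have h4 := hs _ hvs
  rw [Real.norm_eq_abs, abs_of_nonneg (Finset.sum_nonneg fun i _ => by positivity)] at h4
  calc ‖∑ i ∈ v \ u, R i f‖ ≤ ∑ i ∈ v \ u, ‖inner ℂ (b i) f‖ * ‖T (b i)‖ := by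
        refine (norm_sum_le _ _).trans (Finset.sum_le_sum fun i _ => ?_)
        simp [R, norm_smul]
    _ ≤ √(∑ i ∈ v \ u, ‖inner ℂ (b i) f‖ ^ 2) * √(∑ i ∈ v \ u, ‖T (b i)‖ ^ 2) :=
        Real.sum_mul_le_sqrt_mul_sqrt _ _ _
    _ ≤ ‖f‖ * (ε / 2) := by
        gcongr
        · exact Real.sqrt_le_iff.2 ⟨norm_nonneg _, b.orthonormal.sum_inner_products_le f⟩
        · exact Real.sqrt_le_iff.2 ⟨(half_pos hε).le, h4.le⟩
    _ = ε / 2 * ‖f‖ := mul_comm _ _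

theorem eLpNorm_two_sq {g : Plane → ℂ} : eLpNorm g 2 volume ^ 2 = ∫⁻ x, ‖g x‖ₑ ^ 2 := by
  have h := eLpNorm_nnreal_pow_eq_lintegral (μ := (volume : Measure Plane)) (f := g) (p := 2)
    two_ne_zero
  simpa using h

theorem enorm_L2_sq (f : L2) : ‖f‖ₑ ^ 2 = ∫⁻ x, ‖f x‖ₑ ^ 2 := by
  rw [← eLpNorm_two_sq, Lp.enorm_def]

/-- An operator into `L²` given pointwise by inner products with vectors of square integrable norm
is Hilbert–Schmidt, hence compact. -/
theorem isCompactOperator_of_inner (T : L2 →L[ℂ] L2) (κ : Plane → L2)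
    (hκ : ∫⁻ x, ‖κ x‖ₑ ^ 2 ≠ ⊤) (hT : ∀ f, ∀ᵐ x, T f x = inner ℂ (κ x) f) :
    IsCompactOperator T := by
  obtain ⟨w, b, -⟩ := exists_hilbertBasis ℂ L2
  refine isCompactOperator_of_summable b T ?_
  refine summable_of_sum_le (c := (∫⁻ x, ‖κ x‖ₑ ^ 2).toReal) (fun i => by positivity) fun s => ?_
  rw [← ENNReal.ofReal_le_iff_le_toReal hκ, ENNReal.ofReal_sum_of_nonneg fun i _ => by positivity]
  have h1 : ∀ i, ENNReal.ofReal (‖T (b i)‖ ^ 2) = ∫⁻ x, ‖T (b i) x‖ₑ ^ 2 := fun i => by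
    rw [ENNReal.ofReal_pow (norm_nonneg _), ofReal_norm, enorm_L2_sq]
  simp only [h1]
  rw [← lintegral_finsetSum' _ fun i _ => (Lp.aestronglyMeasurable _).enorm.pow_const 2]
  refine lintegral_mono_ae ?_
  filter_upwards [(Finset.eventually_all s (l := ae volume)
    (p := fun i x => T (b i) x = inner ℂ (κ x) (b i))).2 fun i _ => hT (b i)] with x hx
  have h2 := b.orthonormal.sum_inner_products_le (s := s) (κ x)
  have h3 : ∑ i ∈ s, ‖T (b i) x‖ₑ ^ 2 = ENNReal.ofReal (∑ i ∈ s, ‖inner ℂ (b i) (κ x)‖ ^ 2) := by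
    rw [ENNReal.ofReal_sum_of_nonneg fun i _ => by positivity]
    refine Finset.sum_congr rfl fun i hi => ?_
    rw [hx i hi, ENNReal.ofReal_pow (norm_nonneg _), ofReal_norm, ← ofReal_norm,
      norm_inner_symm, ofReal_norm]
  rw [h3, ← ofReal_norm, ← ENNReal.ofReal_pow (norm_nonneg _)]
  exact ENNReal.ofReal_le_ofReal h2

end HilbertSchmidt

section IntegralOperator

/-- The kernel `k` defines an absolutely convergent integral operator on `L²` of norm at most
`C`. -/
structure KernelBound (k : Plane → Plane → ℂ) (C : ℝ≥0) : Prop where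
  meas : Measurable (Function.uncurry k)
  bound : ∀ f : L2, ∫⁻ x, (∫⁻ y, ‖k x y‖ₑ * ‖f y‖ₑ) ^ 2 ≤ (C * ‖f‖ₑ) ^ 2

namespace KernelBound

variable {k : Plane → Plane → ℂ} {C : ℝ≥0}

theorem aemeasurable_lintegral (hk : KernelBound k C) (f : L2) :
    AEMeasurable (fun x => ∫⁻ y, ‖k x y‖ₑ * ‖f y‖ₑ) volume := by
  refine AEMeasurable.lintegral_prod_right'
    (f := fun p : Plane × Plane => ‖k p.1 p.2‖ₑ * ‖f p.2‖ₑ) ?_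
  exact hk.meas.enorm.aemeasurable.mul (Lp.aestronglyMeasurable f).enorm.comp_snd

theorem ae_integrable (hk : KernelBound k C) (f : L2) :
    ∀ᵐ x, Integrable (fun y => k x y * f y) := by
  have h1 : ∫⁻ x, (∫⁻ y, ‖k x y‖ₑ * ‖f y‖ₑ) ^ 2 ≠ ⊤ :=
    ne_top_of_le_ne_top (by finiteness) (hk.bound f)
  filter_upwards [ae_lt_top' ((hk.aemeasurable_lintegral f).pow_const 2) h1] with x hx
  refine ⟨?_, ?_⟩
  · exact (hk.meas.comp measurable_prodMk_left).aestronglyMeasurable.mul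
      (Lp.aestronglyMeasurable f)
  · rw [hasFiniteIntegral_iff_enorm]
    simp only [enorm_mul]
    exact ((ENNReal.pow_lt_top_iff (n := 2)).1 hx).resolve_right (by norm_num)

theorem memLp (hk : KernelBound k C) (f : L2) :
    MemLp (fun x => ∫ y, k x y * f y) 2 volume ∧
      eLpNorm (fun x => ∫ y, k x y * f y) 2 volume ≤ C * ‖f‖ₑ := by
  have h1 : eLpNorm (fun x => ∫ y, k x y * f y) 2 volume ≤ C * ‖f‖ₑ := by
    rw [← ENNReal.pow_le_pow_left_iff two_ne_zero, eLpNorm_two_sq]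
    refine le_trans (lintegral_mono fun x => ?_) (hk.bound f)
    gcongr
    refine (enorm_integral_le_lintegral_enorm _).trans (le_of_eq ?_)
    simp only [enorm_mul]
  refine ⟨⟨?_, lt_of_le_of_lt h1 (by finiteness)⟩, h1⟩
  refine AEStronglyMeasurable.integral_prod_right'
    (f := fun p : Plane × Plane => k p.1 p.2 * f p.2) ?_
  exact hk.meas.aestronglyMeasurable.mul (Lp.aestronglyMeasurable f).comp_snd

/-- The integral operator with kernel `k`. -/
def op (hk : KernelBound k C) : L2 →L[ℂ] L2 :=
  LinearMap.mkContinuous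
    { toFun := fun f => (hk.memLp f).1.toLp
      map_add' := fun f g => by
        apply Lp.ext
        filter_upwards [(hk.memLp (f + g)).1.coeFn_toLp, (hk.memLp f).1.coeFn_toLp,
          (hk.memLp g).1.coeFn_toLp, Lp.coeFn_add (hk.memLp f).1.toLp (hk.memLp g).1.toLp,
          hk.ae_integrable f, hk.ae_integrable g] with x h1 h2 h3 h4 h5 h6
        simp only [Pi.add_apply] at h4
        rw [h1, h4, h2, h3, ← integral_add h5 h6]
        refine integral_congr_ae ?_
        filter_upwards [Lp.coeFn_add f g] with y hy
        rw [hy, Pi.add_apply, mul_add]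
      map_smul' := fun c f => by
        apply Lp.ext
        filter_upwards [(hk.memLp (c • f)).1.coeFn_toLp, (hk.memLp f).1.coeFn_toLp,
          Lp.coeFn_smul c (hk.memLp f).1.toLp] with x h1 h2 h4
        simp only [Pi.smul_apply] at h4
        simp only [RingHom.id_apply]
        rw [h1, h4, h2, smul_eq_mul, ← integral_const_mul]
        refine integral_congr_ae ?_
        filter_upwards [Lp.coeFn_smul c f] with y hy
        rw [hy, Pi.smul_apply, smul_eq_mul]
        ring } C fun f => by
    change ‖(hk.memLp f).1.toLp‖ ≤ C * ‖f‖
    rw [Lp.norm_toLp]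
    refine ENNReal.toReal_le_of_le_ofReal (by positivity) ((hk.memLp f).2.trans (le_of_eq ?_))
    rw [ENNReal.ofReal_mul C.coe_nonneg, ofReal_norm, ENNReal.ofReal_coe_nnreal]

theorem coeFn_op (hk : KernelBound k C) (f : L2) :
    hk.op f =ᵐ[volume] fun x => ∫ y, k x y * f y := (hk.memLp f).1.coeFn_toLp

theorem norm_op_le (hk : KernelBound k C) : ‖hk.op‖ ≤ C :=
  LinearMap.mkContinuous_norm_le _ C.coe_nonneg _

end KernelBound

theorem lintegral_mul_sq_le {f g : Plane → ℝ≥0∞} (hf : AEMeasurable f) (hg : AEMeasurable g) :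
    (∫⁻ y, f y * g y) ^ 2 ≤ (∫⁻ y, f y ^ 2) * ∫⁻ y, g y ^ 2 := by
  have h := ENNReal.lintegral_mul_le_Lp_mul_Lq volume Real.HolderConjugate.two_two hf hg
  simp only [Pi.mul_apply, ENNReal.rpow_two] at h
  calc (∫⁻ y, f y * g y) ^ 2
      ≤ ((∫⁻ y, f y ^ 2) ^ (1 / 2 : ℝ) * (∫⁻ y, g y ^ 2) ^ (1 / 2 : ℝ)) ^ 2 := by gcongr
    _ = _ := by
      rw [mul_pow, ← ENNReal.rpow_natCast, ← ENNReal.rpow_natCast, ← ENNReal.rpow_mul,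
        ← ENNReal.rpow_mul]
      norm_num

/-- **Young's inequality** `L¹ * L² ⊆ L²` for kernels dominated by a convolution kernel. -/
theorem kernelBound_of_le_convolution {k : Plane → Plane → ℂ}
    (hk : Measurable (Function.uncurry k)) {h : Plane → ℝ≥0∞} (hh : Measurable h) {C : ℝ≥0}
    (hC : ∫⁻ z, h z ≤ C) (hkh : ∀ x y, ‖k x y‖ₑ ≤ h (x - y)) : KernelBound k C := by
  refine ⟨hk, fun f => ?_⟩
  have hF : AEMeasurable (fun y => ‖f y‖ₑ) volume := (Lp.aestronglyMeasurable f).enorm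
  have hshift : ∀ x, ∫⁻ y, h (x - y) = ∫⁻ z, h z := fun x => lintegral_sub_left_eq_self h x
  have hm : ∀ x, Measurable fun y => h (x - y) := fun x => hh.comp (by fun_prop)
  have h1 : ∀ x, (∫⁻ y, ‖k x y‖ₑ * ‖f y‖ₑ) ^ 2 ≤ C * ∫⁻ y, h (x - y) * ‖f y‖ₑ ^ 2 := by
    intro x
    have hr : Measurable fun y => h (x - y) ^ (1 / 2 : ℝ) := (hm x).pow_const _
    have hsq : ∀ a : ℝ≥0∞, a ^ (1 / 2 : ℝ) * a ^ (1 / 2 : ℝ) = a := fun a => by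
      rw [← ENNReal.rpow_add_of_nonneg _ _ (by norm_num) (by norm_num)]
      norm_num
    calc (∫⁻ y, ‖k x y‖ₑ * ‖f y‖ₑ) ^ 2
        ≤ (∫⁻ y, h (x - y) ^ (1 / 2 : ℝ) * (h (x - y) ^ (1 / 2 : ℝ) * ‖f y‖ₑ)) ^ 2 := by
          refine pow_le_pow_left' (lintegral_mono fun y => ?_) 2
          simp only
          rw [← mul_assoc, hsq]
          gcongr
          exact hkh x y
      _ ≤ (∫⁻ y, (h (x - y) ^ (1 / 2 : ℝ)) ^ 2) *
            ∫⁻ y, (h (x - y) ^ (1 / 2 : ℝ) * ‖f y‖ₑ) ^ 2 :=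
          lintegral_mul_sq_le hr.aemeasurable (hr.aemeasurable.mul hF)
      _ = (∫⁻ z, h z) * ∫⁻ y, h (x - y) * ‖f y‖ₑ ^ 2 := by
          simp only [mul_pow, sq (h _ ^ (1 / 2 : ℝ)), hsq, hshift]
      _ ≤ _ := by gcongr
  have hm2 : AEMeasurable (Function.uncurry fun x y => h (x - y) * ‖f y‖ₑ ^ 2)
      ((volume : Measure Plane).prod volume) :=
    (hh.comp (measurable_fst.sub measurable_snd)).aemeasurable.mul
      ((hF.pow_const 2).comp_snd)
  calc ∫⁻ x, (∫⁻ y, ‖k x y‖ₑ * ‖f y‖ₑ) ^ 2 ≤ ∫⁻ x, C * ∫⁻ y, h (x - y) * ‖f y‖ₑ ^ 2 :=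
        lintegral_mono h1
    _ = C * ∫⁻ y, ∫⁻ x, h (x - y) * ‖f y‖ₑ ^ 2 := by
        rw [lintegral_const_mul' _ _ ENNReal.coe_ne_top, lintegral_lintegral_swap hm2]
    _ = C * ∫⁻ y, (∫⁻ z, h z) * ‖f y‖ₑ ^ 2 := by
        congr 1
        refine lintegral_congr fun y => ?_
        rw [lintegral_mul_const' _ _ (by finiteness), lintegral_sub_right_eq_self h y]
    _ ≤ C * ∫⁻ y, C * ‖f y‖ₑ ^ 2 := by gcongr
    _ = (C * ‖f‖ₑ) ^ 2 := by
        rw [lintegral_const_mul' _ _ ENNReal.coe_ne_top, ← enorm_L2_sq]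
        ring

/-- A kernel with square integrable sections, whose norms are square integrable, defines a compact
operator. -/
theorem exists_kernelBound_isCompactOperator {k : Plane → Plane → ℂ}
    (hk : Measurable (Function.uncurry k)) (hfin : ∫⁻ x, ∫⁻ y, ‖k x y‖ₑ ^ 2 ≠ ⊤)
    (hsec : ∀ x, MemLp (k x) 2 volume) :
    ∃ C, ∃ h : KernelBound k C, IsCompactOperator h.op := by
  set M := ∫⁻ x, ∫⁻ y, ‖k x y‖ₑ ^ 2
  set C : ℝ≥0 := (M ^ (1 / 2 : ℝ)).toNNReal
  have hC : (C : ℝ≥0∞) ^ 2 = M := by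
    rw [ENNReal.coe_toNNReal (by finiteness), ← ENNReal.rpow_natCast, ← ENNReal.rpow_mul]
    norm_num
  have hb : KernelBound k C := by
    refine ⟨hk, fun f => ?_⟩
    calc ∫⁻ x, (∫⁻ y, ‖k x y‖ₑ * ‖f y‖ₑ) ^ 2
        ≤ ∫⁻ x, (∫⁻ y, ‖k x y‖ₑ ^ 2) * ‖f‖ₑ ^ 2 := by
          refine lintegral_mono fun x => ?_
          simp only
          rw [enorm_L2_sq]
          exact lintegral_mul_sq_le (hsec x).1.enorm (Lp.aestronglyMeasurable f).enorm
      _ = M * ‖f‖ₑ ^ 2 := lintegral_mul_const' _ _ (by finiteness)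
      _ = _ := by rw [mul_pow, hC]
  refine ⟨C, hb, isCompactOperator_of_inner _ (fun x => (hsec x).star.toLp) ?_ fun f => ?_⟩
  · convert hfin using 3 with x
    rw [Lp.enorm_toLp, eLpNorm_two_sq]
    simp
  · filter_upwards [hb.coeFn_op f] with x hx
    rw [hx, L2.inner_def]
    refine integral_congr_ae ?_
    filter_upwards [(hsec x).star.coeFn_toLp] with y hy
    rw [hy]
    simp [mul_comm]

end IntegralOperator

/-! ### The modified Biot–Savart operator -/

section BiotSavartKernel

theorem measurable_biotSavartKernel : Measurable biotSavartKernel := by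
  unfold biotSavartKernel
  have := continuous_perp.measurable
  fun_prop

/-- Valid also at the origin, where both sides vanish. -/
theorem norm_biotSavartKernel (x : Plane) : ‖biotSavartKernel x‖ = (2 * Real.pi * ‖x‖)⁻¹ := by
  rw [biotSavartKernel, norm_smul, norm_perp, norm_inv, Real.norm_eq_abs,
    abs_of_nonneg (by positivity)]
  by_cases h : ‖x‖ = 0
  · simp [h]
  · field_simp

theorem norm_biotSavartKernel_le (x : Plane) : ‖biotSavartKernel x‖ ≤ ‖x‖⁻¹ := by
  rw [norm_biotSavartKernel, mul_inv]
  refine mul_le_of_le_one_left (by positivity) (inv_le_one_of_one_le₀ ?_)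
  linarith [Real.pi_gt_three]

theorem perp_sub (x y : Plane) : perp (x - y) = perp x - perp y := by
  apply Plane.ext' <;> simp
  ring

theorem biotSavartKernel_neg (x : Plane) : biotSavartKernel (-x) = -biotSavartKernel x := by
  have h : perp (-x) = -perp x := by apply Plane.ext' <;> simp
  simp [biotSavartKernel, h]

theorem biotSavartKernel_rot (θ : ℝ) (x : Plane) :
    biotSavartKernel (rot θ x) = rot θ (biotSavartKernel x) := by
  simp only [biotSavartKernel, norm_rot, perp_rot, rot_smul]

/-- The Biot–Savart kernel is a rotated inversion, so that its differences are explicit. -/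
theorem norm_biotSavartKernel_sub_le {x y : Plane} (hx : x ≠ 0) (hy : y ≠ 0) :
    ‖biotSavartKernel x - biotSavartKernel y‖ ≤ ‖x - y‖ * (‖x‖⁻¹ * ‖y‖⁻¹) := by
  have h1 : ∀ z : Plane, biotSavartKernel z = (2 * Real.pi)⁻¹ • perp ((1 / ‖z‖) ^ 2 • z) := by
    intro z
    rw [perp_smul, smul_smul, biotSavartKernel]
    congr 1
    rw [mul_inv, one_div, inv_pow]
  have h2 := dist_div_norm_sq_smul hx hy 1
  rw [dist_eq_norm, dist_eq_norm] at h2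
  rw [h1 x, h1 y, ← smul_sub, ← perp_sub, norm_smul, norm_perp, h2, Real.norm_eq_abs,
    abs_of_pos (by positivity)]
  have h3 : (2 * Real.pi)⁻¹ ≤ 1 := inv_le_one_of_one_le₀ (by linarith [Real.pi_gt_three])
  calc _ ≤ 1 * (1 ^ 2 / (‖x‖ * ‖y‖) * ‖x - y‖) := by gcongr
    _ = _ := by
      rw [← mul_inv]
      ring

/-- An elementary inequality behind the decay of the modified kernel: the larger of `p` and `q` is
at least `X / 2`. -/
theorem div_le_mul_rpow_add {X p q δ : ℝ} (hX : 1 ≤ X) (hp : 1 ≤ p) (hq : 1 ≤ q) (h : X ≤ p + q)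
    (hδ : 0 < δ) (hδ1 : δ ≤ 1) :
    X / (p * q) ≤ 2 * (X ^ δ * (p ^ (-(1 + δ)) + q ^ (-(1 + δ)))) := by
  wlog hpq : p ≤ q generalizing p q
  · have := this hq hp (by linarith) (le_of_not_ge hpq)
    rwa [mul_comm q p, add_comm (q ^ _)] at this
  have hX0 : 0 < X := by linarith
  have hp0 : 0 < p := by linarith
  have hq0 : 0 < q := by linarith
  have h1 : X ≤ X ^ δ * (2 * q ^ (1 - δ)) := by
    calc X = X ^ δ * X ^ (1 - δ) := by rw [← Real.rpow_add hX0, add_sub_cancel, Real.rpow_one]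
      _ ≤ X ^ δ * (2 * q) ^ (1 - δ) := by
        gcongr
        linarith
      _ = X ^ δ * (2 ^ (1 - δ) * q ^ (1 - δ)) := by rw [Real.mul_rpow two_pos.le hq0.le]
      _ ≤ X ^ δ * (2 ^ (1 : ℝ) * q ^ (1 - δ)) := by
        gcongr
        · norm_num
        · linarith
      _ = _ := by rw [Real.rpow_one]
  have h2 : q ^ (1 - δ) / (p * q) ≤ p ^ (-(1 + δ)) := by
    have h3 : q ^ (1 - δ) / (p * q) = p⁻¹ * q ^ (-δ) := by
      rw [Real.rpow_sub hq0, Real.rpow_one, Real.rpow_neg hq0.le]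
      field_simp
    rw [h3, neg_add, Real.rpow_add hp0, Real.rpow_neg_one]
    gcongr p⁻¹ * ?_
    exact Real.rpow_le_rpow_of_nonpos hp0 hpq (by linarith)
  calc X / (p * q) ≤ X ^ δ * (2 * q ^ (1 - δ)) / (p * q) := by gcongr
    _ = 2 * (X ^ δ * (q ^ (1 - δ) / (p * q))) := by ring
    _ ≤ 2 * (X ^ δ * p ^ (-(1 + δ))) := by gcongr
    _ ≤ _ := by
      gcongr
      linarith [Real.rpow_pos_of_pos hq0 (-(1 + δ))]

theorem inv_le_mul_rpow {X p δ : ℝ} (hX : 1 ≤ X) (hp : 1 ≤ p) (h : p ≤ 2 * X)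
    (hδ : 0 < δ) (hδ1 : δ ≤ 1) : p⁻¹ ≤ 2 * (X ^ δ * p ^ (-(1 + δ))) := by
  have hX0 : 0 < X := by linarith
  have hp0 : 0 < p := by linarith
  have h1 : p ^ δ ≤ 2 * X ^ δ := by
    calc p ^ δ ≤ (2 * X) ^ δ := by gcongr
      _ = 2 ^ δ * X ^ δ := Real.mul_rpow two_pos.le hX0.le
      _ ≤ 2 ^ (1 : ℝ) * X ^ δ := by
        gcongr
        norm_num
      _ = _ := by rw [Real.rpow_one]
  calc p⁻¹ = p ^ δ * p ^ (-(1 + δ)) := by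
        rw [← Real.rpow_add hp0, ← Real.rpow_neg_one]
        congr 1
        ring
    _ ≤ 2 * X ^ δ * p ^ (-(1 + δ)) := by gcongr
    _ = _ := by ring

/-- The part of the kernel `K₂` at distance at least `ε` from the singularity. -/
def farKernel (ε : ℝ) (z : Plane) : Plane := if ε ≤ ‖z‖ then biotSavartKernel z else 0

/-- The part of the kernel `K₂` at distance less than `ε` from the singularity. -/
def nearKernel (ε : ℝ) (z : Plane) : Plane := if ‖z‖ < ε then biotSavartKernel z else 0

theorem near_add_far (ε : ℝ) (z : Plane) : nearKernel ε z + farKernel ε z = biotSavartKernel z := by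
  by_cases h : ‖z‖ < ε
  · simp [nearKernel, farKernel, h, not_le.2 h]
  · simp [nearKernel, farKernel, h, not_lt.1 h]

theorem measurable_farKernel (ε : ℝ) : Measurable (farKernel ε) :=
  Measurable.ite (measurableSet_le measurable_const measurable_norm) measurable_biotSavartKernel
    measurable_const

theorem measurable_nearKernel (ε : ℝ) : Measurable (nearKernel ε) :=
  Measurable.ite (measurableSet_lt measurable_norm measurable_const) measurable_biotSavartKernel
    measurable_const

/-- The modified far kernel `K₂(x - y) 1_{|x - y| ≥ ε} + K₂(y) 1_{|y| ≥ 1}` gains decay in `y` from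
the cancellation at infinity, at the price of a small power of `|x|`. -/
theorem norm_farKernel_add_le {ε δ : ℝ} (hε : 0 < ε) (hε1 : ε ≤ 1) (hδ : 0 < δ) (hδ1 : δ ≤ 1)
    (x y : Plane) :
    ‖farKernel ε (x - y) + farKernel 1 y‖ ≤
      8 / ε * ((1 + ‖x‖) ^ δ * ((1 + ‖x - y‖) ^ (-(1 + δ)) + (1 + ‖y‖) ^ (-(1 + δ)))) := by
  set X := 1 + ‖x‖
  set p := 1 + ‖x - y‖ with hp
  set q := 1 + ‖y‖ with hq
  have hX1 : 1 ≤ X := by simp [X]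
  have hp1 : 1 ≤ p := by simp [p]
  have hq1 : 1 ≤ q := by simp [q]
  have hXpq : X ≤ p + q := by
    have := norm_add_le (x - y) y
    rw [sub_add_cancel] at this
    simp only [X, p, q]
    linarith
  have hP : 0 ≤ p ^ (-(1 + δ)) := by positivity
  have hQ : 0 ≤ q ^ (-(1 + δ)) := by positivity
  have hXδ : 0 ≤ X ^ δ := by positivity
  have hε8 : 4 ≤ 4 / ε := by
    rw [le_div_iff₀ hε]
    linarith
  -- comparison of the distances with their regularized versions
  have hinvp : ε ≤ ‖x - y‖ → ‖x - y‖⁻¹ ≤ 2 / ε * p⁻¹ := fun h => by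
    have h0 : 0 < ‖x - y‖ := hε.trans_le h
    have : p * ε ≤ 2 * ‖x - y‖ := by
      rw [hp]
      nlinarith
    rw [inv_eq_one_div, ← div_eq_mul_inv, div_div, div_le_div_iff₀ h0 (by positivity)]
    linarith
  have hinvq : 1 ≤ ‖y‖ → ‖y‖⁻¹ ≤ 2 * q⁻¹ := fun h => by
    have h0 : 0 < ‖y‖ := one_pos.trans_le h
    rw [inv_eq_one_div, ← div_eq_mul_inv, div_le_div_iff₀ h0 (by positivity)]
    linarith
  have hS : 0 ≤ X ^ δ * (p ^ (-(1 + δ)) + q ^ (-(1 + δ))) := by positivity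
  have h84 : 8 / ε = 2 * (4 / ε) := by ring
  by_cases h1 : ε ≤ ‖x - y‖ <;> by_cases h2 : 1 ≤ ‖y‖
  · have hx0 : x - y ≠ 0 := norm_pos_iff.1 (hε.trans_le h1)
    have hy0 : -y ≠ 0 := neg_ne_zero.2 (norm_pos_iff.1 (one_pos.trans_le h2))
    have h3 := norm_biotSavartKernel_sub_le hx0 hy0
    rw [biotSavartKernel_neg, sub_neg_eq_add, norm_neg, sub_neg_eq_add, sub_add_cancel] at h3
    simp only [farKernel, h1, h2, if_true]
    calc _ ≤ ‖x‖ * (‖x - y‖⁻¹ * ‖y‖⁻¹) := h3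
      _ ≤ X * ((2 / ε * p⁻¹) * (2 * q⁻¹)) := by
        gcongr
        · simp [X]
        · exact hinvp h1
        · exact hinvq h2
      _ = 4 / ε * (X / (p * q)) := by
        field_simp
        ring
      _ ≤ 4 / ε * (2 * (X ^ δ * (p ^ (-(1 + δ)) + q ^ (-(1 + δ))))) := by
        gcongr
        exact div_le_mul_rpow_add hX1 hp1 hq1 hXpq hδ hδ1
      _ = _ := by ring
  · simp only [farKernel, h1, h2, if_true, if_false, add_zero]
    have h3 : p ≤ 2 * X := by
      have := norm_sub_le x y
      simp only [p, X]
      push Not at h2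
      linarith [norm_nonneg x]
    calc _ ≤ ‖x - y‖⁻¹ := norm_biotSavartKernel_le _
      _ ≤ 2 / ε * p⁻¹ := hinvp h1
      _ ≤ 2 / ε * (2 * (X ^ δ * p ^ (-(1 + δ)))) := by
        gcongr
        exact inv_le_mul_rpow hX1 hp1 h3 hδ hδ1
      _ = 4 / ε * (X ^ δ * p ^ (-(1 + δ))) := by ring
      _ ≤ 8 / ε * (X ^ δ * (p ^ (-(1 + δ)) + q ^ (-(1 + δ)))) := by
        gcongr
        · norm_num
        · linarith
  · simp only [farKernel, h1, h2, if_true, if_false, zero_add]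
    have h3 : q ≤ 2 * X := by
      have h4 := norm_sub_le x (x - y)
      rw [sub_sub_cancel] at h4
      simp only [q, X]
      push Not at h1
      linarith [norm_nonneg x]
    calc _ ≤ ‖y‖⁻¹ := norm_biotSavartKernel_le _
      _ ≤ 2 * q⁻¹ := hinvq h2
      _ ≤ 2 * (2 * (X ^ δ * q ^ (-(1 + δ)))) := by
        gcongr
        exact inv_le_mul_rpow hX1 hq1 h3 hδ hδ1
      _ = 4 * (X ^ δ * q ^ (-(1 + δ))) := by ring
      _ ≤ 8 / ε * (X ^ δ * (p ^ (-(1 + δ)) + q ^ (-(1 + δ)))) := by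
        gcongr
        · linarith
        · linarith
  · simp only [farKernel, h1, h2, if_false, add_zero, norm_zero]
    positivity

/-- The near kernel has integral proportional to `ε`. -/
theorem exists_lintegral_nearKernel_le :
    ∃ c : ℝ≥0, ∀ ε : ℝ, 0 < ε → ∫⁻ z, ‖nearKernel ε z‖ₑ ≤ c * ENNReal.ofReal ε := by
  set c := 2 * (volume : Measure Plane).real (Metric.ball 0 1) * (2 * Real.pi)⁻¹
  have hc : 0 ≤ c := by positivity
  refine ⟨c.toNNReal, fun ε hε => ?_⟩
  set f : ℝ → ℝ := fun r => if r < ε then (2 * Real.pi * r)⁻¹ else 0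
  have h1 : ∀ z : Plane, ‖nearKernel ε z‖ₑ = ENNReal.ofReal (f ‖z‖) := by
    intro z
    rw [← ofReal_norm]
    congr 1
    by_cases h : ‖z‖ < ε
    · simp only [nearKernel, f, h, if_true, norm_biotSavartKernel]
    · simp [nearKernel, f, h]
  have h2 : EqOn (fun r : ℝ => r ^ (Module.finrank ℝ Plane - 1) • f r)
      ((Iio ε).indicator fun _ => (2 * Real.pi)⁻¹) (Ioi 0) := by
    intro r hr
    have hr0 : r ≠ 0 := (ne_of_gt hr)
    by_cases h : r < ε
    · simp only [finrank_euclideanSpace, Fintype.card_fin, f, h, if_true, smul_eq_mul,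
        indicator_of_mem (mem_Iio.2 h)]
      field_simp
      norm_num
    · simp [f, h]
  have hfin : IntegrableOn ((Iio ε).indicator fun _ => (2 * Real.pi)⁻¹) (Ioi 0) := by
    rw [IntegrableOn, integrable_indicator_iff measurableSet_Iio, IntegrableOn,
      Measure.restrict_restrict measurableSet_Iio]
    refine integrableOn_const (hs := ?_)
    rw [inter_comm, Ioi_inter_Iio]
    simp
  have h3 : Integrable (fun z : Plane => f ‖z‖) :=
    (integrable_fun_norm_addHaar volume).2 ((integrableOn_congr_fun h2 measurableSet_Ioi).2 hfin)
  have h4 : ∫ z : Plane, f ‖z‖ = c * ε := by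
    rw [integral_fun_norm_addHaar volume, setIntegral_congr_fun measurableSet_Ioi h2,
      setIntegral_indicator measurableSet_Iio, Ioi_inter_Iio, setIntegral_const]
    simp only [finrank_euclideanSpace, Fintype.card_fin, c]
    simp [Real.volume_real_Ioo_of_le hε.le]
    ring
  simp only [h1]
  rw [← ofReal_integral_eq_lintegral_ofReal h3 (ae_of_all _ fun z => ?_), h4,
    ENNReal.ofReal_mul hc]
  · rfl
  · simp only [f, Pi.zero_apply]
    split_ifs <;> positivity

/-- The scalar kernel `v(x) · (K₂(x - y) + K₂(y) 1_{|y| ≥ 1})`. -/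
def advectionKernel (v : Plane → Plane) (x y : Plane) : ℂ :=
  ((inner ℝ (v x) (biotSavartKernel (x - y) + farKernel 1 y) : ℝ) : ℂ)

/-- If `v` decays like `|x| ^ (-1 - a)`, the modified Biot–Savart operator
`f ↦ ∫ v(x) · (K₂(x - y) + K₂(y) 1_{|y| ≥ 1}) f(y) dy` is compact on `L²`: up to a part near the
diagonal that is small in norm, it is Hilbert–Schmidt. -/
theorem exists_advection_op {v : Plane → Plane} (hv : Measurable v) {A a : ℝ} (ha : 0 < a)
    (ha1 : a ≤ 1) (hvA : ∀ x, ‖v x‖ ≤ A * (1 + ‖x‖) ^ (-(1 + a))) :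
    ∃ K : L2 →L[ℂ] L2, IsCompactOperator K ∧ ∀ f : L2,
      (∀ᵐ x, Integrable fun y => advectionKernel v x y * f y) ∧
      K f =ᵐ[volume] fun x => ∫ y, advectionKernel v x y * f y := by
  have hA : 0 ≤ A := by
    have h := (norm_nonneg _).trans (hvA 0)
    simpa using h
  have hvle : ∀ x, ‖v x‖ ≤ A := fun x => (hvA x).trans (mul_le_of_le_one_right hA
    (Real.rpow_le_one_of_one_le_of_nonpos (by simp) (by linarith)))
  -- the part of the kernel near the diagonal
  let n : ℝ → Plane → Plane → ℂ := fun ε x y => ((inner ℝ (v x) (nearKernel ε (x - y)) : ℝ) : ℂ)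
  let k : ℝ → Plane → Plane → ℂ := fun ε x y =>
    ((inner ℝ (v x) (farKernel ε (x - y) + farKernel 1 y) : ℝ) : ℂ)
  have hnk : ∀ ε x y, advectionKernel v x y = n ε x y + k ε x y := fun ε x y => by
    simp only [n, k, advectionKernel, ← Complex.ofReal_add, ← inner_add_right, ← add_assoc,
      near_add_far]
  have hnm : ∀ ε, Measurable (Function.uncurry (n ε)) := fun ε => by
    have h1 : Measurable fun p : Plane × Plane => nearKernel ε (p.1 - p.2) :=
      (measurable_nearKernel ε).comp (measurable_fst.sub measurable_snd)
    exact Complex.measurable_ofReal.comp ((hv.comp measurable_fst).inner h1)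
  have hkm : ∀ ε, Measurable (Function.uncurry (k ε)) := fun ε => by
    have h1 : Measurable fun p : Plane × Plane => farKernel ε (p.1 - p.2) + farKernel 1 p.2 :=
      ((measurable_farKernel ε).comp (measurable_fst.sub measurable_snd)).add
        ((measurable_farKernel 1).comp measurable_snd)
    exact Complex.measurable_ofReal.comp ((hv.comp measurable_fst).inner h1)
  obtain ⟨c, hc⟩ := exists_lintegral_nearKernel_le
  have hN : ∀ ε : ℝ, 0 < ε → KernelBound (n ε) (A.toNNReal * c * ε.toNNReal) := fun ε hε => by
    refine kernelBound_of_le_convolution (hnm ε)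
      (h := fun z => A.toNNReal * ‖nearKernel ε z‖ₑ)
      ((measurable_nearKernel ε).enorm.const_mul _) ?_ fun x y => ?_
    · rw [lintegral_const_mul _ (measurable_nearKernel ε).enorm, ENNReal.coe_mul, ENNReal.coe_mul,
        mul_assoc]
      exact mul_le_mul_right (hc ε hε) _
    · rw [← ofReal_norm, ← ofReal_norm]
      change _ ≤ ENNReal.ofReal A * _
      rw [← ENNReal.ofReal_mul hA]
      refine ENNReal.ofReal_le_ofReal ?_
      simp only [n, Complex.norm_real]
      exact (norm_inner_le_norm _ _).trans (by gcongr; exact hvle x)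
  -- half of the surplus decay of `v` absorbs the growth of the far kernel in `x`, the other half
  -- makes the kernel square integrable in `x`
  set δ := a / 2 with hδdef
  have hδ : 0 < δ := by positivity
  have hδ1 : δ ≤ 1 := by linarith
  have hF : ∀ ε : ℝ, 0 < ε → ε ≤ 1 → ∃ C, ∃ h : KernelBound (k ε) C, IsCompactOperator h.op := by
    intro ε hε hε1
    set P : Plane → ℝ≥0∞ := fun z => ENNReal.ofReal ((1 + ‖z‖) ^ (-(1 + δ)))
    have hPm : Measurable P := by fun_prop
    have hPI : ∀ z, P z = ‖(((1 + ‖z‖) ^ (-(1 + δ)) : ℝ) : ℂ)‖ₑ := fun z => by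
      rw [← ofReal_norm, Complex.norm_real, Real.norm_eq_abs, abs_of_nonneg (by positivity)]
    have hPfin : ∫⁻ z, P z ^ 2 ≠ ⊤ := by
      have h := (memLp_decay (r := 1 + δ) (by linarith)).ofReal (K := ℂ)
      simp only [hPI]
      have h2 : eLpNorm (fun z : Plane => (((1 + ‖z‖) ^ (-(1 + δ)) : ℝ) : ℂ)) 2 volume ^ 2 ≠ ⊤ :=
        ENNReal.pow_ne_top h.2.ne
      rwa [eLpNorm_two_sq] at h2
    set I := ∫⁻ z, P z ^ 2
    set D : ℝ≥0∞ := ENNReal.ofReal (A * (8 / ε))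
    have hb : ∀ x y, ‖k ε x y‖ₑ ≤ D * P x * (P (x - y) + P y) := by
      intro x y
      simp only [D, P]
      rw [← ofReal_norm, ← ENNReal.ofReal_mul (by positivity),
        ← ENNReal.ofReal_add (by positivity) (by positivity), ← ENNReal.ofReal_mul (by positivity)]
      refine ENNReal.ofReal_le_ofReal ?_
      simp only [k, Complex.norm_real]
      calc _ ≤ ‖v x‖ * ‖farKernel ε (x - y) + farKernel 1 y‖ := norm_inner_le_norm _ _
        _ ≤ (A * (1 + ‖x‖) ^ (-(1 + a))) * (8 / ε * ((1 + ‖x‖) ^ δ *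
              ((1 + ‖x - y‖) ^ (-(1 + δ)) + (1 + ‖y‖) ^ (-(1 + δ))))) := by
            gcongr
            · exact hvA x
            · exact norm_farKernel_add_le hε hε1 hδ hδ1 x y
        _ = A * (8 / ε) * ((1 + ‖x‖) ^ (-(1 + a)) * (1 + ‖x‖) ^ δ) *
              ((1 + ‖x - y‖) ^ (-(1 + δ)) + (1 + ‖y‖) ^ (-(1 + δ))) := by ring
        _ = _ := by
            rw [← Real.rpow_add (by positivity)]
            congr 4
            rw [hδdef]
            ring
    have hy : ∀ x, ∫⁻ y, ‖k ε x y‖ₑ ^ 2 ≤ (D * P x) ^ 2 * (2 * (I + I)) := by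
      intro x
      have hm : Measurable fun y => P (x - y) ^ 2 := (hPm.comp (by fun_prop)).pow_const 2
      calc ∫⁻ y, ‖k ε x y‖ₑ ^ 2 ≤ ∫⁻ y, (D * P x) ^ 2 * (2 * (P (x - y) ^ 2 + P y ^ 2)) := by
            refine lintegral_mono fun y => ?_
            refine (pow_le_pow_left' (hb x y) 2).trans ?_
            rw [mul_pow]
            gcongr
            have h := ENNReal.rpow_add_le_mul_rpow_add_rpow (P (x - y)) (P y) (p := 2) (by norm_num)
            norm_num at h
            exact h
        _ = (D * P x) ^ 2 * (2 * (I + I)) := by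
            rw [lintegral_const_mul' _ _ (by finiteness), lintegral_const_mul' _ _ (by finiteness),
              lintegral_add_left hm, lintegral_sub_left_eq_self (fun z => P z ^ 2) x]
    refine exists_kernelBound_isCompactOperator (hkm ε) ?_ fun x => ⟨?_, ?_⟩
    · refine ne_top_of_le_ne_top ?_ (lintegral_mono hy)
      simp only [mul_pow]
      rw [lintegral_mul_const' _ _ (by finiteness), lintegral_const_mul' _ _ (by finiteness)]
      finiteness
    · exact ((hkm ε).comp measurable_prodMk_left).aestronglyMeasurable
    · have h : eLpNorm (k ε x) 2 volume ^ 2 < ⊤ := by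
        rw [eLpNorm_two_sq]
        exact lt_of_le_of_lt (hy x) (by finiteness)
      exact ((ENNReal.pow_lt_top_iff (n := 2)).1 h).resolve_right (by norm_num)
  choose! C hC hcomp using hF
  have hsum : ∀ ε (h0 : 0 < ε) (h1 : ε ≤ 1) (f : L2),
      (∀ᵐ x, Integrable fun y => advectionKernel v x y * f y) ∧
      ((hN ε h0).op + (hC ε h0 h1).op) f =ᵐ[volume]
        fun x => ∫ y, advectionKernel v x y * f y := by
    intro ε h0 h1 f
    simp only [hnk ε, add_mul]
    refine ⟨?_, ?_⟩
    · filter_upwards [(hN ε h0).ae_integrable f, (hC ε h0 h1).ae_integrable f] with x hx1 hx2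
      exact hx1.add hx2
    · filter_upwards [(hN ε h0).ae_integrable f, (hC ε h0 h1).ae_integrable f,
        (hN ε h0).coeFn_op f, (hC ε h0 h1).coeFn_op f,
        Lp.coeFn_add ((hN ε h0).op f) ((hC ε h0 h1).op f)] with x hx1 hx2 hx3 hx4 hx5
      rw [add_apply, hx5, Pi.add_apply, hx3, hx4, integral_add hx1 hx2]
  -- all the decompositions give the same operator
  set K := (hN 1 one_pos).op + (hC 1 one_pos le_rfl).op with hK
  refine ⟨K, ?_, hsum 1 one_pos le_rfl⟩
  have hε0 : ∀ j : ℕ, 0 < 1 / ((j : ℝ) + 1) := fun j => by positivity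
  have hε1 : ∀ j : ℕ, 1 / ((j : ℝ) + 1) ≤ 1 := fun j => by
    rw [div_le_one (by positivity)]
    simp
  have hKε : ∀ j : ℕ, K = (hN _ (hε0 j)).op + (hC _ (hε0 j) (hε1 j)).op := fun j => by
    ext1 f
    exact Lp.ext ((hsum 1 one_pos le_rfl f).2.trans (hsum _ (hε0 j) (hε1 j) f).2.symm)
  refine isCompactOperator_of_tendsto (l := atTop)
    (F := fun j : ℕ => (hC _ (hε0 j) (hε1 j)).op) ?_
    (Eventually.of_forall fun j => hcomp _ (hε0 j) (hε1 j))
  rw [tendsto_iff_norm_sub_tendsto_zero]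
  have hlim : Tendsto (fun j : ℕ => A * c * (1 / ((j : ℝ) + 1))) atTop (𝓝 0) := by
    simpa using tendsto_one_div_add_atTop_nhds_zero_nat.const_mul (A * (c : ℝ))
  refine squeeze_zero (fun j => norm_nonneg _) (fun j => ?_) hlim
  rw [hKε j, norm_sub_rev, add_sub_cancel_right]
  refine (hN _ (hε0 j)).norm_op_le.trans (le_of_eq ?_)
  simp only [NNReal.coe_mul, Real.coe_toNNReal _ hA, Real.coe_toNNReal _ (hε0 j).le]

end BiotSavartKernel

/-! ### The Biot–Savart operator on symmetric functions -/

section Symmetrization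

/-- Composition of a Schwartz function with a rotation. -/
def schwartzRot (θ : ℝ) : 𝓢(Plane, ℂ) →L[ℂ] 𝓢(Plane, ℂ) :=
  SchwartzMap.compCLMOfContinuousLinearEquiv ℂ
    ((rotIsometry θ).toLinearIsometryEquiv rfl).toContinuousLinearEquiv

theorem schwartzRot_apply (θ : ℝ) (φ : 𝓢(Plane, ℂ)) (x : Plane) :
    schwartzRot θ φ x = φ (rot θ x) := rfl

/-- The average of a Schwartz function over the rotations of order `m`. -/
def symmetrize (m : ℕ) (φ : 𝓢(Plane, ℂ)) : 𝓢(Plane, ℂ) :=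
  (m : ℂ)⁻¹ • ∑ k ∈ Finset.range m, schwartzRot (k * (2 * Real.pi / m)) φ

theorem symmetrize_apply (m : ℕ) (φ : 𝓢(Plane, ℂ)) (x : Plane) :
    symmetrize m φ x =
      (m : ℂ)⁻¹ * ∑ k ∈ Finset.range m, φ (rot (k * (2 * Real.pi / m)) x) := by
  simp [symmetrize, schwartzRot_apply]

theorem symmetrize_rot {m : ℕ} (hm : m ≠ 0) (φ : 𝓢(Plane, ℂ)) (x : Plane) :
    symmetrize m φ (rot (2 * Real.pi / m) x) = symmetrize m φ x := by
  have hm' : (m : ℝ) ≠ 0 := by exact_mod_cast hm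
  set F : ℕ → ℂ := fun k => φ (rot (k * (2 * Real.pi / m)) x) with hF
  have h1 : ∀ k : ℕ, φ (rot (k * (2 * Real.pi / m)) (rot (2 * Real.pi / m) x)) = F (k + 1) := by
    intro k
    simp only [hF, rot_rot]
    congr 2
    push_cast
    ring
  have h2 : F m = F 0 := by
    simp only [hF]
    rw [mul_div_cancel₀ _ hm']
    have h := rot_periodic x 0
    simp only [zero_add] at h
    simp [h]
  rw [symmetrize_apply, symmetrize_apply]
  congr 1
  rw [Finset.sum_congr rfl fun k _ => h1 k]
  have h3 := Finset.sum_range_succ F m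
  rw [Finset.sum_range_succ', h2] at h3
  exact add_right_cancel h3

/-- Symmetric Schwartz functions are dense in `L²_m`. -/
theorem schwartzApprox_neBot {m : ℕ} (hm : m ≠ 0) (Ω : L2m m) : (schwartzApprox m Ω).NeBot := by
  set R : ℕ → L2 → L2 := fun k => Lp.compMeasurePreserving (rot (k * (2 * Real.pi / m)))
    (measurePreserving_rot _) with hR
  set Q : L2 → L2 := fun f => (m : ℂ)⁻¹ • ∑ k ∈ Finset.range m, R k f with hQ
  have hRc : ∀ k, Continuous (R k) := fun k =>
    (Lp.isometry_compMeasurePreserving (measurePreserving_rot _)).continuous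
  have hQc : Continuous Q := by
    have h : Continuous fun f => ∑ k ∈ Finset.range m, R k f :=
      continuous_finsetSum _ fun k _ => hRc k
    exact (continuous_const_smul (m : ℂ)⁻¹).comp h
  have hRΩ : ∀ k, R k (Ω : L2) = Ω := by
    intro k
    refine Lp.ext ((Lp.coeFn_compMeasurePreserving _ _).trans ?_)
    induction k with
    | zero => exact Eventually.of_forall fun x => by simp [rot_zero]
    | succ k ih =>
      have h1 := (measurePreserving_rot (2 * Real.pi / m)).quasiMeasurePreserving.ae_eq_comp ih
      refine EventuallyEq.trans ?_ (h1.trans (mem_L2m.1 Ω.2))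
      refine Eventually.of_forall fun x => ?_
      simp only [Function.comp_apply, rot_rot]
      congr 2
      push_cast
      ring
  have hQΩ : Q (Ω : L2) = Ω := by
    have hm' : (m : ℂ) ≠ 0 := by exact_mod_cast hm
    simp only [hQ, hRΩ, Finset.sum_const, Finset.card_range, ← Nat.cast_smul_eq_nsmul ℂ]
    rw [inv_smul_smul₀ hm']
  have hQs : ∀ φ : 𝓢(Plane, ℂ), ((symmetrize m φ).toLp 2 : L2) = Q (φ.toLp 2) := by
    intro φ
    have h : ∀ ψ : 𝓢(Plane, ℂ), (ψ.toLp 2 : L2) = SchwartzMap.toLpCLM ℂ ℂ 2 volume ψ :=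
      fun _ => rfl
    rw [h, symmetrize, map_smul, map_sum]
    rfl
  rw [schwartzApprox, inf_principal_neBot_iff]
  rintro U ⟨V, hV, hVU⟩
  have hV' : Q ⁻¹' V ∈ 𝓝 (Ω : L2) := hQc.continuousAt (by rwa [hQΩ])
  obtain ⟨_, hφ, φ, rfl⟩ := mem_closure_iff_nhds.1
    (SchwartzMap.denseRange_toLpCLM (F := ℂ) (μ := (volume : Measure Plane))
      (p := 2) (by norm_num) (Ω : L2)) _ hV'
  refine ⟨symmetrize m φ, hVU ?_, fun x => symmetrize_rot hm φ x⟩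
  change ((symmetrize m φ).toLp 2 : L2) ∈ V
  rw [hQs]
  exact hφ

end Symmetrization

section Equivariance

theorem inner_rot (θ : ℝ) (x y : Plane) : inner ℝ (rot θ x) (rot θ y) = inner ℝ x y :=
  (rotIsometry θ).inner_map_map x y

theorem farKernel_rot (ε θ : ℝ) (x : Plane) : farKernel ε (rot θ x) = rot θ (farKernel ε x) := by
  simp only [farKernel, norm_rot, biotSavartKernel_rot]
  split_ifs
  · rfl
  · exact ((rotIsometry θ).map_zero).symm

theorem advectionKernel_rot {v : Plane → Plane} {θ : ℝ} (hv : ∀ x, v (rot θ x) = rot θ (v x))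
    (x y : Plane) : advectionKernel v (rot θ x) (rot θ y) = advectionKernel v x y := by
  rw [advectionKernel, hv, ← rot_sub_vec, biotSavartKernel_rot, farKernel_rot, ← rot_add_vec,
    inner_rot, advectionKernel]

theorem measurableEmbedding_rot (θ : ℝ) : MeasurableEmbedding (rot θ) :=
  ((rotIsometry θ).toLinearIsometryEquiv rfl).toHomeomorph.measurableEmbedding

/-- An advection operator with equivariant weight preserves the `m`-fold symmetry. -/
theorem advection_op_mem_L2m {v : Plane → Plane} {m : ℕ}
    (hv : ∀ x, v (rot (2 * Real.pi / m) x) = rot (2 * Real.pi / m) (v x)) {f h : L2}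
    (hh : h =ᵐ[volume] fun x => ∫ y, advectionKernel v x y * f y) (hf : f ∈ L2m m) :
    h ∈ L2m m := by
  rw [mem_L2m] at hf ⊢
  set θ := 2 * Real.pi / m
  have h1 := (measurePreserving_rot θ).quasiMeasurePreserving.ae_eq_comp hh
  refine h1.trans (EventuallyEq.trans (Eventually.of_forall fun x => ?_) hh.symm)
  simp only [Function.comp_apply]
  rw [← (measurePreserving_rot θ).integral_comp (measurableEmbedding_rot θ)]
  refine integral_congr_ae ?_
  filter_upwards [hf] with y hy
  rw [advectionKernel_rot hv, hy]

/-- The integral of an `m`-fold symmetric function against an equivariant vector field vanishes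
if `m ≥ 2`. -/
theorem integral_mul_eq_zero_of_equivariant {m : ℕ} (hm : 2 ≤ m) {u : Plane → Plane}
    (hu : ∀ x, u (rot (2 * Real.pi / m) x) = rot (2 * Real.pi / m) (u x)) {f : Plane → ℂ}
    (hf : ∀ x, f (rot (2 * Real.pi / m) x) = f x)
    (hint : ∀ j, Integrable fun y => ((u y j : ℝ) : ℂ) * f y) (j : Fin 2) :
    ∫ y, ((u y j : ℝ) : ℂ) * f y = 0 := by
  set θ := 2 * Real.pi / m
  set I : Fin 2 → ℂ := fun j => ∫ y, ((u y j : ℝ) : ℂ) * f y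
  have hrot : ∀ j, I j = ∫ y, ((rot θ (u y) j : ℝ) : ℂ) * f y := fun j => by
    simp only [I]
    rw [← (measurePreserving_rot θ).integral_comp (measurableEmbedding_rot θ)]
    simp only [hu, hf]
  have h0 : I 0 = Real.cos θ * I 0 - Real.sin θ * I 1 := by
    refine (hrot 0).trans ?_
    simp only [I]
    rw [← integral_const_mul, ← integral_const_mul,
      ← integral_sub ((hint 0).const_mul _) ((hint 1).const_mul _)]
    refine integral_congr_ae (ae_of_all _ fun y => ?_)
    simp only [rot_apply_zero]
    push_cast
    ring
  have h1 : I 1 = Real.sin θ * I 0 + Real.cos θ * I 1 := by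
    refine (hrot 1).trans ?_
    simp only [I]
    rw [← integral_const_mul, ← integral_const_mul,
      ← integral_add ((hint 0).const_mul _) ((hint 1).const_mul _)]
    refine integral_congr_ae (ae_of_all _ fun y => ?_)
    simp only [rot_apply_one]
    push_cast
    ring
  have hcos : Real.cos θ ≠ 1 := by
    have hm' : (2 : ℝ) ≤ m := by exact_mod_cast hm
    have hθ : 0 < θ := by positivity
    have hθ2 : θ ≤ Real.pi := by
      rw [div_le_iff₀ (by linarith), mul_comm]
      exact mul_le_mul_of_nonneg_left hm' Real.pi_pos.le
    intro h
    rw [Real.cos_eq_one_iff_of_lt_of_lt (by linarith) (by linarith [Real.pi_pos])] at h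
    exact hθ.ne' h
  have hsc : (Real.sin θ : ℂ) ^ 2 + (Real.cos θ : ℂ) ^ 2 = 1 := by
    exact_mod_cast Real.sin_sq_add_cos_sq θ
  -- the determinant of `1 - R_θ` is `2 (1 - cos θ)`
  have hdet : (2 * (1 - Real.cos θ) : ℂ) ≠ 0 := by
    have : (1 - Real.cos θ : ℂ) ≠ 0 := by
      rw [sub_ne_zero]
      exact_mod_cast hcos.symm
    simpa using this
  have key : ∀ j, 2 * (1 - Real.cos θ : ℂ) * I j = 0 := by
    intro j
    fin_cases j
    · simp only [Fin.zero_eta]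
      linear_combination (1 - Real.cos θ : ℂ) * h0 - (Real.sin θ : ℂ) * h1 - I 0 * hsc
    · simp only [Fin.mk_one]
      linear_combination (1 - Real.cos θ : ℂ) * h1 + (Real.sin θ : ℂ) * h0 - I 1 * hsc
  exact (mul_eq_zero.1 (key j)).resolve_left hdet

end Equivariance

section BiotSavart

theorem integrable_farKernel_mul (φ : 𝓢(Plane, ℂ)) (j : Fin 2) :
    Integrable fun y => ((farKernel 1 y j : ℝ) : ℂ) * φ y := by
  have hm : Measurable fun y => ((farKernel 1 y j : ℝ) : ℂ) :=
    Complex.measurable_ofReal.comp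
      ((EuclideanSpace.proj (𝕜 := ℝ) j).continuous.measurable.comp (measurable_farKernel 1))
  refine φ.integrable.bdd_mul (c := 1) hm.aestronglyMeasurable (ae_of_all _ fun y => ?_)
  rw [Complex.norm_real]
  refine (PiLp.norm_apply_le _ j).trans ?_
  simp only [farKernel]
  split_ifs with h
  · exact (norm_biotSavartKernel_le y).trans (inv_le_one_of_one_le₀ h)
  · simp

/-- The Biot–Savart integral of a Schwartz function converges absolutely almost everywhere. -/
theorem ae_integrable_biotSavartKernel (φ : 𝓢(Plane, ℂ)) (j : Fin 2) :
    ∀ᵐ x : Plane, Integrable fun y => ((biotSavartKernel (x - y) j : ℝ) : ℂ) * φ y := by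
  -- the statement follows from the boundedness of the operator with weight `(1 + |x|)⁻² e_j`
  set v : Plane → Plane := fun x => ((1 + ‖x‖) ^ (-(1 + 1) : ℝ)) • EuclideanSpace.single j 1
  have hv : Measurable v := by
    have : Measurable fun x : Plane => (1 + ‖x‖) ^ (-(1 + 1) : ℝ) := by fun_prop
    exact this.smul_const _
  obtain ⟨K, -, hK⟩ := exists_advection_op (v := v) hv (A := 1) (a := 1) one_pos le_rfl fun x => by
    simp only [v, norm_smul, PiLp.norm_single, norm_one, mul_one, one_mul]
    rw [Real.norm_eq_abs, abs_of_nonneg (by positivity)]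
  filter_upwards [(hK (φ.toLp 2)).1] with x hx
  have hx' : Integrable fun y => advectionKernel v x y * φ y :=
    hx.congr ((φ.coeFn_toLp 2 volume).mono fun y hy => by simp only [hy])
  set c : ℝ := (1 + ‖x‖) ^ (-(1 + 1) : ℝ)
  have hc : (c : ℂ) ≠ 0 := by
    have : 0 < c := by positivity
    exact_mod_cast this.ne'
  refine ((hx'.const_mul (c : ℂ)⁻¹).sub (integrable_farKernel_mul φ j)).congr
    (ae_of_all _ fun y => ?_)
  have h : advectionKernel v x y =
      c * (((biotSavartKernel (x - y) j : ℝ) : ℂ) + ((farKernel 1 y j : ℝ) : ℂ)) := by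
    simp only [advectionKernel, v, inner_smul_left, EuclideanSpace.inner_single_left]
    simp [c]
  simp only [Pi.sub_apply, h]
  field_simp
  ring

/-- For a symmetric Schwartz function the modified Biot–Savart operator is the original one:
the correction term integrates to zero. -/
theorem ae_sum_biotSavartConv {m : ℕ} (hm : 2 ≤ m) (v : Plane → Plane) {ϑ : 𝓢(Plane, ℂ)}
    (hϑ : ∀ x, ϑ (rot (2 * Real.pi / m) x) = ϑ x) :
    ∀ᵐ x : Plane, ∑ j, biotSavartConv ϑ x j * ((v x j : ℝ) : ℂ) =
      ∫ y, advectionKernel v x y * ϑ y := by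
  have h0 : ∀ j, ∫ y, ((farKernel 1 y j : ℝ) : ℂ) * ϑ y = 0 :=
    integral_mul_eq_zero_of_equivariant hm (farKernel_rot 1 _) hϑ (integrable_farKernel_mul ϑ)
  filter_upwards [ae_integrable_biotSavartKernel ϑ 0, ae_integrable_biotSavartKernel ϑ 1]
    with x hx0 hx1
  have hx : ∀ j, Integrable fun y => ((biotSavartKernel (x - y) j : ℝ) : ℂ) * ϑ y := fun j => by
    fin_cases j
    · exact hx0
    · exact hx1
  have h1 : ∀ y, advectionKernel v x y * ϑ y =
      ∑ j, (((biotSavartKernel (x - y) j : ℝ) : ℂ) * ϑ y + ((farKernel 1 y j : ℝ) : ℂ) * ϑ y) *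
        ((v x j : ℝ) : ℂ) := by
    intro y
    simp only [advectionKernel, PiLp.inner_apply, Fin.sum_univ_two]
    simp
    ring
  have h2 : ∀ j ∈ Finset.univ, Integrable fun y => (((biotSavartKernel (x - y) j : ℝ) : ℂ) * ϑ y +
      ((farKernel 1 y j : ℝ) : ℂ) * ϑ y) * ((v x j : ℝ) : ℂ) := fun j _ =>
    ((hx j).add (integrable_farKernel_mul ϑ j)).mul_const _
  simp only [h1]
  rw [integral_finsetSum _ h2]
  refine Finset.sum_congr rfl fun j _ => ?_
  rw [integral_mul_const, integral_add (hx j) (integrable_farKernel_mul ϑ j), h0, add_zero,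
    biotSavartConv]

/-- The advection of a decaying equivariant field by the Biot–Savart velocity is a compact operator
on `L²_m`. -/
theorem exists_advection_op_L2m {m : ℕ} (hm : 2 ≤ m) {v : Plane → Plane} (hv : Measurable v)
    {A a : ℝ} (ha : 0 < a) (ha1 : a ≤ 1) (hvA : ∀ x, ‖v x‖ ≤ A * (1 + ‖x‖) ^ (-(1 + a)))
    (hvr : ∀ x, v (rot (2 * Real.pi / m) x) = rot (2 * Real.pi / m) (v x)) :
    ∃ K : L2m m →L[ℂ] L2m m, IsCompactOperator K ∧ ∀ (Ω : L2m m) (φ : 𝓢(Plane, ℂ)),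
      biotSavart m Ω (fun x j => φ x * ((v x j : ℝ) : ℂ)) = ∫ x, (K Ω : L2) x * φ x := by
  obtain ⟨K, hKc, hK⟩ := exists_advection_op hv ha ha1 hvA
  have hmem : ∀ f ∈ L2m m, K f ∈ L2m m := fun f hf => advection_op_mem_L2m hvr (hK f).2 hf
  refine ⟨(K.comp (L2m m).subtypeL).codRestrict (L2m m) fun f => hmem f f.2,
    (hKc.comp_clm (L2m m).subtypeL).codRestrict (fun f => hmem f f.2) (isClosed_L2m m), ?_⟩
  intro Ω φ
  have hφ := memLp_schwartz φ
  have := schwartzApprox_neBot (by omega : m ≠ 0) Ω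
  have hlim : Tendsto (fun ϑ : 𝓢(Plane, ℂ) => pairing hφ (K (ϑ.toLp 2))) (schwartzApprox m Ω)
      (𝓝 (pairing hφ (K Ω))) :=
    ((pairing hφ).continuous.comp K.continuous).continuousAt.tendsto.comp
      (tendsto_comap.mono_left inf_le_left)
  have heq : (fun ϑ : 𝓢(Plane, ℂ) => pairing hφ (K (ϑ.toLp 2))) =ᶠ[schwartzApprox m Ω]
      fun ϑ => ∫ x, ∑ j, biotSavartConv ϑ x j * (φ x * ((v x j : ℝ) : ℂ)) := by
    filter_upwards [mem_inf_of_right (mem_principal_self _)] with ϑ hϑ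
    rw [pairing_apply]
    refine integral_congr_ae ?_
    filter_upwards [ae_sum_biotSavartConv hm v hϑ, (hK (ϑ.toLp 2)).2] with x hx1 hx2
    have h3 : ∫ y, advectionKernel v x y * (ϑ.toLp 2 : L2) y = ∫ y, advectionKernel v x y * ϑ y :=
      integral_congr_ae ((ϑ.coeFn_toLp 2 volume).mono fun y hy => by simp only [hy])
    rw [hx2, h3, ← hx1, Finset.sum_mul]
    exact Finset.sum_congr rfl fun j _ => by ring
  rw [biotSavart, (hlim.congr' heq).limUnder_eq, pairing_apply]
  rfl

end BiotSavart

/-! ### The splitting of the operator and the theorem -/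

section Background

theorem fderiv_comp_norm_sq {G : ℝ → ℝ} (hG : Differentiable ℝ G) (x w : Plane) :
    fderiv ℝ (fun y : Plane => G (‖y‖ ^ 2)) x w = 2 * deriv G (‖x‖ ^ 2) * inner ℝ x w := by
  have h1 : HasFDerivAt (fun y : Plane => ‖y‖ ^ 2) (2 • innerSL ℝ x) x :=
    (hasStrictFDerivAt_norm_sq x).hasFDerivAt
  have h2 := (hG (‖x‖ ^ 2)).hasDerivAt.comp_hasFDerivAt x h1
  change fderiv ℝ (G ∘ fun y : Plane => ‖y‖ ^ 2) x w = _
  rw [h2.fderiv]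
  simp
  ring

/-- The gradient of a radial function `G(|x|²)`, as a vector field. -/
def radialGradient (G : ℝ → ℝ) (x : Plane) : Plane := (2 * deriv G (‖x‖ ^ 2)) • x

theorem grad_bgVorticity {g G : ℝ → ℝ} (hG : Differentiable ℝ G)
    (hgG : ∀ r, 0 ≤ r → g r = G (r ^ 2)) (x : Plane) (j : Fin 2) :
    grad (bgVorticity g) x j = radialGradient G x j := by
  have h : bgVorticity g = fun y => G (‖y‖ ^ 2) := funext fun y => hgG _ (norm_nonneg y)
  rw [grad, h, fderiv_comp_norm_sq hG]
  simp [radialGradient, EuclideanSpace.inner_single_right]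

theorem measurable_radialGradient {G : ℝ → ℝ} (hG : Continuous (deriv G)) :
    Measurable (radialGradient G) := by
  unfold radialGradient
  exact Continuous.measurable (by fun_prop)

theorem radialGradient_rot (G : ℝ → ℝ) (θ : ℝ) (x : Plane) :
    radialGradient G (rot θ x) = rot θ (radialGradient G x) := by
  simp only [radialGradient, norm_rot, rot_smul]

theorem norm_radialGradient_le {G : ℝ → ℝ} {a C : ℝ} (ha : 0 < a)
    (hC : ∀ s, 0 ≤ s → |deriv G s| ≤ C * (1 + s) ^ (-(a / 2) - 1)) (x : Plane) :
    ‖radialGradient G x‖ ≤ 2 * C * 2 ^ (a / 2 + 1) * (1 + ‖x‖) ^ (-(1 + a)) := by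
  have hC0 : 0 ≤ C := by simpa using (abs_nonneg _).trans (hC 0 le_rfl)
  set r := ‖x‖
  have hr : 0 ≤ r := norm_nonneg x
  have h1 : (1 + r ^ 2) ^ (-(a / 2) - 1) ≤ 2 ^ (a / 2 + 1) * (1 + r) ^ (-(2 + a)) := by
    have h2 : (1 + r) ^ 2 / 2 ≤ 1 + r ^ 2 := by nlinarith [sq_nonneg (1 - r)]
    calc (1 + r ^ 2) ^ (-(a / 2) - 1) ≤ ((1 + r) ^ 2 / 2) ^ (-(a / 2) - 1) :=
          Real.rpow_le_rpow_of_nonpos (by positivity) h2 (by linarith)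
      _ = _ := by
          rw [Real.div_rpow (by positivity) two_pos.le, ← Real.rpow_natCast,
            ← Real.rpow_mul (by positivity), div_eq_mul_inv, ← Real.rpow_neg two_pos.le, mul_comm]
          congr 2 <;> (push_cast; ring)
  calc ‖radialGradient G x‖ = 2 * |deriv G (r ^ 2)| * r := by
        rw [radialGradient, norm_smul, norm_mul, Real.norm_eq_abs, Real.norm_eq_abs, abs_two]
    _ ≤ 2 * (C * (2 ^ (a / 2 + 1) * (1 + r) ^ (-(2 + a)))) * (1 + r) := by
        gcongr
        · exact (hC _ (by positivity)).trans (by gcongr)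
        · linarith
    _ = 2 * C * 2 ^ (a / 2 + 1) * ((1 + r) ^ (-(2 + a)) * (1 + r) ^ (1 : ℝ)) := by
        rw [Real.rpow_one]
        ring
    _ = _ := by
        rw [← Real.rpow_add (by positivity)]
        congr 2
        ring

theorem bgVelocity_eq {g Z : ℝ → ℝ} (hgZ : ∀ r, r ≠ 0 → 0 ≤ r → zeta g r = Z (r ^ 2)) (x : Plane) :
    bgVelocity g x = Z (‖x‖ ^ 2) • perp x := by
  rcases eq_or_ne x 0 with rfl | hx
  · have h : perp (0 : Plane) = 0 := by simpa using norm_perp 0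
    simp [bgVelocity, h]
  · rw [bgVelocity, hgZ _ (norm_ne_zero_iff.2 hx) (norm_nonneg x)]

theorem integral_add_smul_mul (f h : L2) (c : ℂ) {φ : Plane → ℂ} (hφ : MemLp φ 2 volume) :
    ∫ x, (f + c • h : L2) x * φ x = (∫ x, f x * φ x) + c * ∫ x, h x * φ x := by
  rw [← pairing_apply hφ, ← pairing_apply hφ, ← pairing_apply hφ, map_add,
    ContinuousLinearMap.map_smul, smul_eq_mul]

end Background

/-- `exists_semigroup_growthBound_eq` with the compact operator written as a multiple `-c • K`. -/
theorem exists_semigroup_growthBound_eq_smul {X : Type*} [NormedAddCommGroup X] [NormedSpace ℂ X]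
    [CompleteSpace X] {T : C0Semigroup X} {K : X →L[ℂ] X} {A : X → X → Prop} {w₀ : ℝ} (c : ℂ)
    (hT : ∀ t : ℝ≥0, ‖T.toFun t‖ ≤ Real.exp (w₀ * t)) (hK : IsCompactOperator K)
    (hA : ∀ x y, A x y ↔ T.HasGen x (y + c • K x)) :
    ∃ S : C0Semigroup X, IsGenerator A S ∧ BddAbove (Complex.re '' spec A) ∧
      ∀ a₀ : ℝ, IsLUB (Complex.re '' spec A) a₀ → w₀ ≤ a₀ →
        growthBound S = (a₀ : EReal) ∧ ∀ δ : ℝ, 0 < δ → ∃ M : ℝ, ∀ (τ : ℝ≥0) (x : X),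
          ‖S.toFun τ x‖ ≤ M * Real.exp ((a₀ + δ) * τ) * ‖x‖ :=
  exists_semigroup_growthBound_eq (K := -(c • K)) hT (hK.smul c).neg fun x y => by
    simp [hA]

/-- `L_ss` is the generator of a transport semigroup with dilation rate `1 / α` minus the compact
operator `β K`, where `K Ω` is the advection of the background vorticity by `K₂ * Ω`. -/
theorem exists_transport_add_compact {α abar β : ℝ} (hα : 0 < α) (habar0 : 0 < abar)
    (habar : abar ≤ 1) {g : ℝ → ℝ} (hg : IsProfile abar g) {m : ℕ} (hm : 2 ≤ m) :
    ∃ (D : FlowData) (K : L2m m →L[ℂ] L2m m), D.γ = α⁻¹ ∧ IsCompactOperator K ∧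
      ∀ Ω Θ, Lss α β g m Ω Θ ↔ (D.transport m).HasGen Ω (Θ + (β : ℂ) • K Ω) := by
  obtain ⟨G, Z, W, hG, hZ, hW, hgG, hgZ, hZW, hZb, C, hC⟩ := hg.exists_radial habar0
  have hGd : Continuous (deriv G) := (hG.continuous_deriv (by simp))
  obtain ⟨K, hKc, hK⟩ := exists_advection_op_L2m hm (measurable_radialGradient hGd) habar0 habar
    (norm_radialGradient_le habar0 hC) (radialGradient_rot G _)
  let D : FlowData := ⟨α⁻¹, β, Z, W, inv_pos.2 hα, hZW, hZ, hW, hZb⟩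
  refine ⟨D, K, rfl, hKc, fun Ω Θ => ?_⟩
  rw [D.hasGen_transport_iff, Lss]
  refine forall_congr' fun φ => ?_
  have hfield : ∀ ξ, -(α⁻¹ • ξ) + β • bgVelocity g ξ = -D.field ξ := by
    intro ξ
    rw [bgVelocity_eq hgZ]
    simp only [D, FlowData.field, smul_smul]
    abel
  have h1 : LssDist α β g m Ω φ =
      D.weakTransport Ω φ - β * ∫ x, (K Ω : L2) x * φ x := by
    rw [LssDist, ← hK]
    simp only [grad_bgVorticity (hG.differentiable (by simp)) hgG, hfield, map_neg, mul_neg,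
      integral_neg]
    rw [FlowData.weakTransport, ← sub_eq_add_neg]
    simp only [D, div_eq_mul_inv]
  have h2 : ∫ x, ((Θ + (β : ℂ) • K Ω : L2m m) : L2) x * φ x =
      (∫ x, (Θ : L2) x * φ x) + β * ∫ x, (K Ω : L2) x * φ x :=
    integral_add_smul_mul _ _ _ (memLp_schwartz φ)
  rw [h1, h2, sub_eq_iff_eq_add]

end VortexSemigroup

end

theorem theorem3p4 (α abar β : ℝ) (hα : 0 < α) (hαabar : α ≤ abar) (habar : abar < 1)
    (hβ : 0 < β) (g : ℝ → ℝ) (hg : VortexSemigroup.IsProfile abar g) (m : ℕ) (hm : 2 ≤ m) :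
    ∃ S : VortexSemigroup.C0Semigroup (VortexSemigroup.L2m m),
      VortexSemigroup.IsGenerator (VortexSemigroup.Lss α β g m) S ∧
      BddAbove (Complex.re '' VortexSemigroup.spec (VortexSemigroup.Lss α β g m)) ∧
      ∀ a₀ : ℝ, IsLUB (Complex.re '' VortexSemigroup.spec (VortexSemigroup.Lss α β g m)) a₀ →
        1 - 1 / α ≤ a₀ →
        VortexSemigroup.growthBound S = (a₀ : EReal) ∧
        ∀ δ : ℝ, 0 < δ → ∃ M : ℝ, ∀ (τ : ℝ≥0) (Ω : VortexSemigroup.L2m m),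
          ‖S.toFun τ Ω‖ ≤ M * Real.exp ((a₀ + δ) * τ) * ‖Ω‖ := by
  obtain ⟨D, K, hγ, hK, hL⟩ := VortexSemigroup.exists_transport_add_compact (β := β) hα
    (hα.trans_le hαabar) habar.le hg hm
  have h := VortexSemigroup.exists_semigroup_growthBound_eq_smul β (D.norm_transport_le m) hK hL
  rwa [hγ, ← one_div] at h
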